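/- Let $E$ be a (real) countably Hilbertian nuclear space: a topological vector space whose topology is generated by an increasing sequence of Hilbertian seminorms $\|\cdot\|_0\le\|\cdot\|_1\le\cdots$ such that the completions $E_n$ of $(E,\|\cdot\|_n)$ are separable, $E=\bigcap_n E_n$ (i.e. every sequence $(\xi_n)$ with $\xi_n\in E_n$ that is compatible with the canonical maps $E_m\to E_n$, $m\ge n$, comes from a unique element of $E$), and for every $n$ there is $m>n$ such that $E_m\to E_n$ is Hilbert–Schmidt ($\sum_i\|e_i\|_n^2<\infty$ for every orthonormal sequence $(e_i)$ of $E_m$). Let $E'$ be the topological dual of $E$ with the strong topology, generated by the seminorms $p_B(f)=\sup_{\varphi\in B}|f(\varphi)|$, $B\subseteq E$ bounded. Let $T>0$, and let $D_{E'}$ be the set of càdlàg functions $[0,T]\to E'$. For $x\in D_{E'}$ put $x(0-)=x(0)$ and let $\gamma_x=\{(z,t): z=(1-a)x(t-)+a\,x(t)\text{ for some }a\in[0,1]\}\subseteq E'\times[0,T]$ be its completed graph, ordered by time and, at equal times, by the parameter $a$ along the interval from $x(t-)$ to $x(t)$. Let $\Lambda_x$ be the set of continuous non-decreasing surjections $(z,t):[0,1]\to\gamma_x$.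 The M1 topology on $D_{E'}$ is generated by the pseudometrics $$d_B(x,y)=\inf_{(z_x,t_x)\in\Lambda_x,\ (z_y,t_y)\in\Lambda_y}\ \sup_{s\in[0,1]}\max\{p_B(z_x(s)-z_y(s)),\,|t_x(s)-t_y(s)|\},\qquad B\subseteq E\text{ bounded}.$$ The M1 topology on the set $D_{\mathbb R}$ of càdlàg functions $[0,T]\to\mathbb R$ is defined in the same way, with the absolute value in place of the $p_B$. For $\varphi\in E$ let $\pi^\varphi:D_{E'}\to D_{\mathbb R}$, $\pi^\varphi(x)=(x_t(\varphi))_{t\in[0,T]}$. A sequence of Borel probability measures is called tight if for every $\varepsilon>0$ there is a compact set whose complement has measure at most $\varepsilon$ under all of them. **Theorem.** Let $(\mu_n)$ be a sequence of Borel probability measures on $(D_{E'},\mathrm{M1})$. Then $(\mu_n)$ is tight on $(D_{E'},\mathrm{M1})$ if and only if, for every $\varphi\in E$, the sequence $(\mu_n\circ(\pi^\varphi)^{-1})$ is tight on $(D_{\mathbb R},\mathrm{M1})$. Moreover, if $(\mu_n)$ is tight on $(D_{E'},\mathrm{M1})$, then it is relatively compact for weak convergence of Borel probability measures on $(D_{E'},\mathrm{M1})$: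 the closure of $\{\mu_n\}$ in the space of Borel probability measures is compact in the topology of weak convergence, and every subsequence of $(\mu_n)$ has a further subsequence that converges weakly to some Borel probability measure on $D_{E'}$. -/

import Mathlib

open MeasureTheory Filter Topology Set
open scoped ENNReal

noncomputable section

/-! ### Countably Hilbertian nuclear spaces -/

section Nuclear

variable {E : Type*} [AddCommGroup E] [Module ℝ E]

/-- The vector space `E` with the seminorm `‖x‖ = √⟪x, x⟫` of a positive semidefinite symmetric
bilinear form (a Hilbertian seminorm). -/
def HilbertianSpace (_c : PreInnerProductSpace.Core ℝ E) : Type _ := E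

instance (c : PreInnerProductSpace.Core ℝ E) : SeminormedAddCommGroup (HilbertianSpace c) :=
  @InnerProductSpace.Core.toSeminormedAddCommGroup ℝ E _ _ _ c

instance (c : PreInnerProductSpace.Core ℝ E) : InnerProductSpace ℝ (HilbertianSpace c) :=
  @InnerProductSpace.ofCore ℝ E _ _ _ c

/-- The identity map of `E`, viewed as a map to `E` with a Hilbertian seminorm. -/
def toHilbertianSpace (c : PreInnerProductSpace.Core ℝ E) : E →ₗ[ℝ] HilbertianSpace c where
  toFun x := x
  map_add' _ _ := rfl
  map_smul' _ _ := rfl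

/-- The Hilbertian seminorm on `E`. -/
def hilbertianSeminorm (c : PreInnerProductSpace.Core ℝ E) : Seminorm ℝ E :=
  (normSeminorm ℝ (HilbertianSpace c)).comp (toHilbertianSpace c)

/-- The Hilbert space obtained by (Hausdorff) completion of `E` for a Hilbertian seminorm. -/
abbrev HilbertCompletion (c : PreInnerProductSpace.Core ℝ E) : Type _ :=
  UniformSpace.Completion (HilbertianSpace c)

/-- The canonical map from `E` to its completion for a Hilbertian seminorm. -/
def toHilbertCompletion (c : PreInnerProductSpace.Core ℝ E) (x : E) : HilbertCompletion c :=
  (toHilbertianSpace c x : HilbertCompletion c)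

/-- The canonical map between the completions of `E` for two Hilbertian seminorms: the extension by
continuity of the identity map of `E` (used when the first seminorm dominates the second). -/
def canonicalMap (c d : PreInnerProductSpace.Core ℝ E) :
    HilbertCompletion c → HilbertCompletion d :=
  UniformSpace.Completion.map (fun x : HilbertianSpace c => toHilbertianSpace d x)

theorem canonicalMap_toHilbertCompletion {c d : PreInnerProductSpace.Core ℝ E}
    (h : hilbertianSeminorm d ≤ hilbertianSeminorm c) (x : E) :
    canonicalMap c d (toHilbertCompletion c x) = toHilbertCompletion d x := by
  refine UniformSpace.Completion.map_coe ?_ _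
  refine LipschitzWith.uniformContinuous (K := 1) ?_
  refine LipschitzWith.of_dist_le_mul fun a b => ?_
  rw [dist_eq_norm, dist_eq_norm, NNReal.coe_one, one_mul]
  exact h (show E from a - b)

/-- A countably Hilbertian nuclear structure on a real topological vector space `E`: an increasing
sequence of Hilbertian seminorms `‖·‖₀ ≤ ‖·‖₁ ≤ ⋯` generating the topology, with separable
completions `E₀, E₁, …`, such that `E` is the intersection (projective limit) of the `Eₙ` and such
that for every `n` there is `m > n` for which `Eₘ → Eₙ` is Hilbert-Schmidt. -/
structure CountablyHilbertianNuclear (E : Type*) [AddCommGroup E] [Module ℝ E]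
    [TopologicalSpace E] where
  /-- the semi-inner products -/
  form : ℕ → PreInnerProductSpace.Core ℝ E
  mono : Monotone fun n => hilbertianSeminorm (form n)
  withSeminorms : WithSeminorms fun n => hilbertianSeminorm (form n)
  separable : ∀ n, TopologicalSpace.SeparableSpace (HilbertCompletion (form n))
  inter_eq : ∀ ξ : (n : ℕ) → HilbertCompletion (form n),
    (∀ n m, n ≤ m → canonicalMap (form m) (form n) (ξ m) = ξ n) →
      ∃! x : E, ∀ n, toHilbertCompletion (form n) x = ξ n
  nuclear : ∀ n, ∃ m, n < m ∧ ∀ e : ℕ → HilbertCompletion (form m), Orthonormal ℝ e →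
    Summable fun i => ‖canonicalMap (form m) (form n) (e i)‖ ^ 2

end Nuclear

/-! ### Càdlàg paths and the M1 topology -/

/-- Càdlàg paths on `[0,T]` with values in a topological space `X`: right-continuous functions
with left limits. -/
@[ext]
structure CadlagPath (T : ℝ) (X : Type*) [TopologicalSpace X] where
  /-- the path as a function -/
  toFun : Icc (0 : ℝ) T → X
  right_cont : ∀ t, ContinuousWithinAt toFun (Ici t) t
  left_lim : ∀ t : Icc (0 : ℝ) T, 0 < (t : ℝ) → ∃ l, Tendsto toFun (𝓝[<] t) (𝓝 l)

namespace CadlagPath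

variable {T : ℝ} {X : Type*} [TopologicalSpace X]

/-- The left limit `x(t-)`, with the convention `x(0-) = x(0)`. -/
def leftLimit (x : CadlagPath T X) (t : Icc (0 : ℝ) T) : X := Function.leftLim x.toFun t

section Graph

variable [AddCommGroup X] [Module ℝ X]

/-- The point `(1 - a) x(t-) + a x(t)` of the interval `[x(t-), x(t)]`. -/
def jumpPoint (x : CadlagPath T X) (t : Icc (0 : ℝ) T) (a : ℝ) : X :=
  (1 - a) • x.leftLimit t + a • x.toFun t

/-- The completed graph of `x`. -/
def graph (x : CadlagPath T X) : Set (X × Icc (0 : ℝ) T) :=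
  {q | ∃ a ∈ Icc (0 : ℝ) 1, q.1 = x.jumpPoint q.2 a}

/-- The order on the completed graph of `x`. -/
def graphLE (x : CadlagPath T X) (q r : X × Icc (0 : ℝ) T) : Prop :=
  q.2 < r.2 ∨ (q.2 = r.2 ∧ ∃ a ∈ Icc (0 : ℝ) 1, ∃ b ∈ Icc (0 : ℝ) 1,
    a ≤ b ∧ q.1 = x.jumpPoint q.2 a ∧ r.1 = x.jumpPoint r.2 b)

/-- The parametric representations of the graph of `x`: continuous non-decreasing maps from
`[0,1]` onto the graph. -/
def paramReps (x : CadlagPath T X) : Set (unitInterval → X × Icc (0 : ℝ) T) :=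
  {u | Continuous u ∧ range u = x.graph ∧ ∀ s s', s ≤ s' → x.graphLE (u s) (u s')}

/-- The M1 distance of two paths, when distances in `X` are measured by `p (z - z')`. -/
def m1Dist (p : X → ℝ≥0∞) (x y : CadlagPath T X) : ℝ≥0∞ :=
  ⨅ u ∈ x.paramReps, ⨅ v ∈ y.paramReps,
    ⨆ s, max (p ((u s).1 - (v s).1)) (edist (u s).2 (v s).2)

/-- The topology generated by the M1 distances for a family `p` of (extended) seminorms on `X`: a
set is open if around each of its points `x` it contains a finite intersection of balls
`{y | m1Dist (p i) y x < ε}`. -/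
@[reducible] def m1Topology {ι : Type*} (p : ι → X → ℝ≥0∞) : TopologicalSpace (CadlagPath T X) where
  IsOpen U := ∀ x ∈ U, ∃ (J : Finset ι) (ε : ℝ≥0∞), 0 < ε ∧
    {y | ∀ i ∈ J, m1Dist (p i) y x < ε} ⊆ U
  isOpen_univ := fun _ _ => ⟨∅, 1, one_pos, subset_univ _⟩
  isOpen_inter := by
    classical
    rintro U V hU hV x ⟨hxU, hxV⟩
    obtain ⟨J, ε, hε, hJ⟩ := hU x hxU
    obtain ⟨K, δ, hδ, hK⟩ := hV x hxV
    refine ⟨J ∪ K, min ε δ, lt_min hε hδ, fun y hy => ⟨hJ fun i hi => ?_, hK fun i hi => ?_⟩⟩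
    · exact (hy i (Finset.mem_union_left _ hi)).trans_le (min_le_left _ _)
    · exact (hy i (Finset.mem_union_right _ hi)).trans_le (min_le_right _ _)
  isOpen_sUnion := by
    intro S hS x hx
    obtain ⟨U, hUS, hxU⟩ := hx
    obtain ⟨J, ε, hε, hJ⟩ := hS U hUS x hxU
    exact ⟨J, ε, hε, hJ.trans (subset_sUnion_of_mem hUS)⟩

end Graph

/-- The M1 topology on real-valued càdlàg paths. -/
instance : TopologicalSpace (CadlagPath T ℝ) :=
  m1Topology (fun (_ : Unit) (z : ℝ) => ‖z‖ₑ)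

theorem isOpen_iff_real (U : Set (CadlagPath T ℝ)) :
    IsOpen U ↔ ∀ x ∈ U, ∃ (J : Finset Unit) (ε : ℝ≥0∞), 0 < ε ∧
      {y | ∀ i ∈ J, m1Dist (fun z : ℝ => ‖z‖ₑ) y x < ε} ⊆ U := Iff.rfl

instance : MeasurableSpace (CadlagPath T ℝ) := borel _

instance : BorelSpace (CadlagPath T ℝ) := ⟨rfl⟩

section Dual

variable {E : Type*} [AddCommGroup E] [Module ℝ E] [TopologicalSpace E]

/-- The seminorm `p_B(f) = sup_{φ ∈ B} |f(φ)|` on the dual of `E`; for bounded `B` these seminorms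
generate the strong topology, which is the topology carried by `StrongDual ℝ E`. -/
def dualSeminorm (B : Set E) (f : StrongDual ℝ E) : ℝ≥0∞ := ⨆ φ ∈ B, ‖f φ‖ₑ

/-- The M1 topology on càdlàg paths in the strong dual of `E`, generated by the M1 distances for
the seminorms `p_B` with `B` bounded. -/
instance : TopologicalSpace (CadlagPath T (StrongDual ℝ E)) :=
  m1Topology fun B : {B : Set E // Bornology.IsVonNBounded ℝ B} => dualSeminorm (B : Set E)

theorem isOpen_iff_dual (U : Set (CadlagPath T (StrongDual ℝ E))) :
    IsOpen U ↔ ∀ x ∈ U, ∃ (J : Finset {B : Set E // Bornology.IsVonNBounded ℝ B}) (ε : ℝ≥0∞),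
      0 < ε ∧ {y | ∀ B ∈ J, m1Dist (dualSeminorm (B : Set E)) y x < ε} ⊆ U := Iff.rfl

instance : MeasurableSpace (CadlagPath T (StrongDual ℝ E)) := borel _

instance : BorelSpace (CadlagPath T (StrongDual ℝ E)) := ⟨rfl⟩

variable [ContinuousSMul ℝ E]

/-- The projection `x ↦ x(φ) = (x_t(φ))_t`. -/
def proj (φ : E) (x : CadlagPath T (StrongDual ℝ E)) : CadlagPath T ℝ where
  toFun t := x.toFun t φ
  right_cont t := ((continuous_eval_const φ).tendsto (x.toFun t)).comp (x.right_cont t)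
  left_lim t ht := by
    obtain ⟨l, hl⟩ := x.left_lim t ht
    exact ⟨l φ, ((continuous_eval_const φ).tendsto l).comp hl⟩

theorem leftLimit_proj (φ : E) (x : CadlagPath T (StrongDual ℝ E)) (t : Icc (0 : ℝ) T) :
    (proj φ x).leftLimit t = x.leftLimit t φ := by
  unfold leftLimit
  by_cases hb : 𝓝[<] t = ⊥
  · rw [leftLim_eq_of_eq_bot _ hb, leftLim_eq_of_eq_bot _ hb]; rfl
  · have ht : 0 < (t : ℝ) := by
      rcases t.2.1.eq_or_lt with h | h
      · refine absurd ?_ hb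
        have : Iio t = ∅ := by
          ext u
          simp only [mem_Iio, mem_empty_iff_false, iff_false, not_lt]
          exact Subtype.coe_le_coe.1 (h ▸ u.2.1)
        rw [this, nhdsWithin_empty]
      · exact h
    obtain ⟨l, hl⟩ := x.left_lim t ht
    have : (𝓝[<] t).NeBot := ⟨hb⟩
    have h1 : Function.leftLim x.toFun t = l := leftLim_eq_of_tendsto hl
    rw [h1]
    exact leftLim_eq_of_tendsto (((continuous_eval_const φ).tendsto l).comp hl)

theorem jumpPoint_proj (φ : E) (x : CadlagPath T (StrongDual ℝ E)) (t : Icc (0 : ℝ) T) (a : ℝ) :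
    (proj φ x).jumpPoint t a = x.jumpPoint t a φ := by
  unfold jumpPoint
  rw [leftLimit_proj]
  simp [proj]

theorem mem_paramReps_proj (φ : E) (x : CadlagPath T (StrongDual ℝ E))
    {u : unitInterval → StrongDual ℝ E × Icc (0 : ℝ) T} (hu : u ∈ x.paramReps) :
    (fun s => ((u s).1 φ, (u s).2)) ∈ (proj φ x).paramReps := by
  obtain ⟨hc, hr, hm⟩ := hu
  refine ⟨?_, ?_, ?_⟩
  · exact ((continuous_eval_const φ).comp (continuous_fst.comp hc)).prodMk
      (continuous_snd.comp hc)
  · apply Subset.antisymm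
    · rintro _ ⟨s, rfl⟩
      obtain ⟨a, ha, h⟩ : u s ∈ x.graph := hr ▸ mem_range_self s
      exact ⟨a, ha, by simp only [jumpPoint_proj, h]⟩
    · rintro ⟨z, t⟩ ⟨a, ha, h⟩
      obtain ⟨s, hs⟩ : (x.jumpPoint t a, t) ∈ range u := hr ▸ ⟨a, ha, rfl⟩
      refine ⟨s, ?_⟩
      simp only [jumpPoint_proj] at h
      simp only [hs, h]
  · intro s s' hss
    rcases hm s s' hss with h | ⟨h, a, ha, b, hb, hab, h1, h2⟩
    · exact Or.inl h
    · exact Or.inr ⟨h, a, ha, b, hb, hab, by simp only [jumpPoint_proj, h1],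
        by simp only [jumpPoint_proj, h2]⟩

theorem m1Dist_proj_le (φ : E) (x y : CadlagPath T (StrongDual ℝ E)) :
    m1Dist (fun z : ℝ => ‖z‖ₑ) (proj φ x) (proj φ y) ≤ m1Dist (dualSeminorm {φ}) x y := by
  refine le_iInf₂ fun u hu => le_iInf₂ fun v hv => ?_
  refine (iInf₂_le _ (mem_paramReps_proj φ x hu)).trans
    ((iInf₂_le _ (mem_paramReps_proj φ y hv)).trans ?_)
  simp [dualSeminorm]

/-- The projections are continuous, so that the images `μ.map (proj φ)` are the usual ones. -/
theorem continuous_proj (φ : E) :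
    Continuous (proj φ : CadlagPath T (StrongDual ℝ E) → CadlagPath T ℝ) := by
  rw [continuous_def]
  intro U hU
  refine (isOpen_iff_dual _).2 fun x hx => ?_
  obtain ⟨J, ε, hε, hJ⟩ := (isOpen_iff_real _).1 hU (proj φ x) hx
  let B : {B : Set E // Bornology.IsVonNBounded ℝ B} :=
    ⟨{φ}, Bornology.isVonNBounded_singleton φ⟩
  refine ⟨{B}, ε, hε, fun y hy => ?_⟩
  have hy' : m1Dist (dualSeminorm (B : Set E)) y x < ε := hy B (Finset.mem_singleton_self B)
  have hlt : m1Dist (fun z : ℝ => ‖z‖ₑ) (proj φ y) (proj φ x) < ε :=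
    (m1Dist_proj_le φ y x).trans_lt hy'
  have hmem : proj φ y ∈ U := hJ fun i _ => hlt
  exact hmem

theorem measurable_proj (φ : E) :
    Measurable (proj φ : CadlagPath T (StrongDual ℝ E) → CadlagPath T ℝ) :=
  (continuous_proj φ).measurable

end Dual

end CadlagPath

end

noncomputable section

namespace CadlagPath

/-! ### Graphs and parametric representations -/

section General

variable {T : ℝ} {X : Type*} [TopologicalSpace X]

/-! One direction is the continuity of the projections. For the converse, tightness of the
real-valued images has to confine the paths to a compact set of `E'` and control their oscillation.

Confinement (Mitoma's argument). The supremum over the measures of the mean of `min (sup_t |x_t(φ)|)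
1` is even, subadditive and lower semicontinuous in `φ`, and small at small multiples of each `φ`.
As `E` is Polish, Baire's theorem makes it small near 0; being at most 1, it is then bounded by a
small constant plus a multiple of `‖φ‖_m²`. Averaged over random signs of a Hilbert–Schmidt family,
with a Khinchin type inequality, this bounds `∑ x_t(e_j)²` uniformly in `t`, so that with high
probability the whole path lies in a ball of the dual of some `E_k`
(`exists_measure_not_mem_dualBall_le`). Nuclearity, used again, makes such balls strongly compact
(`isCompact_dualBall`).

Oscillation. On an M1-compact set of real paths, no value exceeds nearby earlier and later values by
much, and no path rises quickly from its initial value, uniformly over the set (`UpOsc`, `UpStart`).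
This is used only along a dense sequence of directions: a functional `a` lies on the segment from
`b` to `c` as soon as `a φ ≤ max (b φ) (c φ)` for a dense set of `φ`. On a compact set of values
this becomes quantitative, and over short times a path stays near its chords (`exists_nearChords`).

Compactness. Two curves that stay near their chords and have nearby endpoints can be matched by
their distance from the starting point. Hence paths that are close at finitely many suitable times
are M1-close (`exists_finset_m1Dist_le`), and the pointwise limit along an ultrafilter, made
right-continuous, is an M1 limit (`isCompact_oscSet`).

For subsequences, integrals of coordinates over rational intervals inject the path space
continuously into `ℕ → ℝ`. On a uniformly tight set of measures the push-forward is injective, so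
convergence along a subsequence can be lifted from the metrizable space of images
(`exists_tendsto_subseq_of_isTightMeasureSet`). -/

theorem nhdsLT_neBot_of_pos {t : Icc (0 : ℝ) T} (ht : 0 < (t : ℝ)) : (𝓝[<] t).NeBot :=
  nhdsLT_neBot_of_exists_lt
    ⟨⟨0, le_rfl, t.2.1.trans t.2.2⟩, Subtype.coe_lt_coe.1 (by simpa using ht)⟩

theorem tendsto_leftLimit (x : CadlagPath T X) (t : Icc (0 : ℝ) T) :
    Tendsto x.toFun (𝓝[<] t) (𝓝 (x.leftLimit t)) := by
  rcases t.2.1.eq_or_lt with h | h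
  · have : Iio t = ∅ := by
      ext u
      simp only [mem_Iio, mem_empty_iff_false, iff_false, not_lt]
      exact Subtype.coe_le_coe.1 (h ▸ u.2.1)
    rw [this, nhdsWithin_empty]
    exact tendsto_bot
  · exact tendsto_leftLim_of_tendsto (x.left_lim t h)

theorem leftLimit_of_eq_zero (x : CadlagPath T X) {t : Icc (0 : ℝ) T} (ht : (t : ℝ) = 0) :
    x.leftLimit t = x.toFun t :=
  leftLim_eq_of_isBot fun u => Subtype.coe_le_coe.1 (ht.le.trans u.2.1)

variable [AddCommGroup X] [Module ℝ X]

theorem jumpPoint_eq_add (x : CadlagPath T X) (t : Icc (0 : ℝ) T) (a : ℝ) :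
    x.jumpPoint t a = x.leftLimit t + a • (x.toFun t - x.leftLimit t) := by
  simp only [jumpPoint, sub_smul, smul_sub, one_smul]
  abel

theorem jumpPoint_one (x : CadlagPath T X) (t : Icc (0 : ℝ) T) : x.jumpPoint t 1 = x.toFun t := by
  simp [jumpPoint]

theorem jumpPoint_zero (x : CadlagPath T X) (t : Icc (0 : ℝ) T) :
    x.jumpPoint t 0 = x.leftLimit t := by
  simp [jumpPoint]

theorem jumpPoint_of_leftLimit_eq (x : CadlagPath T X) {t : Icc (0 : ℝ) T}
    (h : x.leftLimit t = x.toFun t) (a : ℝ) : x.jumpPoint t a = x.toFun t := by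
  rw [jumpPoint_eq_add, h, sub_self, smul_zero, add_zero]

theorem mem_graph_toFun (x : CadlagPath T X) (t : Icc (0 : ℝ) T) : (x.toFun t, t) ∈ x.graph :=
  ⟨1, ⟨zero_le_one, le_rfl⟩, (x.jumpPoint_one t).symm⟩

theorem graphLE.snd_le {x : CadlagPath T X} {q r : X × Icc (0 : ℝ) T} (h : x.graphLE q r) :
    q.2 ≤ r.2 :=
  h.elim le_of_lt fun h => h.1.le

theorem exists_paramReps_apply_eq {x : CadlagPath T X} {u : unitInterval → X × Icc (0 : ℝ) T}
    (hu : u ∈ x.paramReps) {q : X × Icc (0 : ℝ) T} (hq : q ∈ x.graph) : ∃ s, u s = q :=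
  (hu.2.1 ▸ hq : q ∈ range u)

theorem paramReps_mem_graph {x : CadlagPath T X} {u : unitInterval → X × Icc (0 : ℝ) T}
    (hu : u ∈ x.paramReps) (s : unitInterval) : u s ∈ x.graph :=
  hu.2.1 ▸ mem_range_self s

theorem paramReps_monotone_snd {x : CadlagPath T X} {u : unitInterval → X × Icc (0 : ℝ) T}
    (hu : u ∈ x.paramReps) : Monotone fun s => (u s).2 :=
  fun _ _ h => (hu.2.2 _ _ h).snd_le

theorem paramReps_le_of_snd_lt {x : CadlagPath T X} {u : unitInterval → X × Icc (0 : ℝ) T}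
    (hu : u ∈ x.paramReps) {s s' : unitInterval} (h : (u s).2 < (u s').2) : s ≤ s' := by
  by_contra hs
  exact absurd (paramReps_monotone_snd hu (le_of_not_ge hs)) (not_le.2 h)

/-- The convention x(0-) = x(0) leaves a single graph point over time 0. -/
theorem paramReps_zero {x : CadlagPath T X} {u : unitInterval → X × Icc (0 : ℝ) T}
    (hu : u ∈ x.paramReps) {o : Icc (0 : ℝ) T} (ho : (o : ℝ) = 0) : u 0 = (x.toFun o, o) := by
  obtain ⟨s, hs⟩ := exists_paramReps_apply_eq hu (x.mem_graph_toFun o)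
  have h0 : (u 0).2 = o := by
    have := paramReps_monotone_snd hu (show (0 : unitInterval) ≤ s from s.2.1)
    simp only [hs] at this
    exact le_antisymm this (Subtype.coe_le_coe.1 (ho.le.trans (u 0).2.2.1))
  obtain ⟨a, -, ha⟩ := paramReps_mem_graph hu 0
  refine Prod.ext ?_ h0
  rw [ha, h0, x.jumpPoint_of_leftLimit_eq (x.leftLimit_of_eq_zero ho)]

/-- A jump at T is allowed, but the order on the graph puts x(T) last. -/
theorem paramReps_one {x : CadlagPath T X} {u : unitInterval → X × Icc (0 : ℝ) T}
    (hu : u ∈ x.paramReps) {o : Icc (0 : ℝ) T} (ho : (o : ℝ) = T) : u 1 = (x.toFun o, o) := by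
  obtain ⟨s, hs⟩ := exists_paramReps_apply_eq hu (x.mem_graph_toFun o)
  have h := hu.2.2 s 1 s.2.2
  rw [hs] at h
  rcases h with h | ⟨h, a, ha, b, hb, hab, h1, h2⟩
  · exact absurd (Subtype.coe_le_coe.1 ((u 1).2.2.2.trans ho.ge)) (not_le.2 h)
  · refine Prod.ext ?_ h.symm
    simp only at h h1
    rw [h2, ← h]
    rw [jumpPoint_eq_add] at h1 ⊢
    -- The point x(T) is reached with weight `a`: either `a = 1`, which forces `b = 1`, or the jump
    -- is zero.
    have h3 : (1 - a) • (x.toFun o - x.leftLimit o) = 0 := by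
      rw [sub_smul, one_smul, sub_eq_zero]
      rw [sub_eq_iff_eq_add']
      exact h1
    rcases smul_eq_zero.1 h3 with h4 | h4
    · have : b = 1 := le_antisymm hb.2 (by linarith)
      simp [this]
    · rw [h4, smul_zero, add_zero]
      exact (sub_eq_zero.1 h4).symm

theorem exists_paramReps_of_m1Dist_lt {p : X → ℝ≥0∞} {x y : CadlagPath T X} {η : ℝ}
    (h : m1Dist p x y < ENNReal.ofReal η) : ∃ u ∈ x.paramReps, ∃ v ∈ y.paramReps,
      ∀ s, p ((u s).1 - (v s).1) < ENNReal.ofReal η ∧ |((u s).2 : ℝ) - (v s).2| < η := by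
  unfold m1Dist at h
  simp only [iInf_lt_iff] at h
  obtain ⟨u, hu, v, hv, h⟩ := h
  refine ⟨u, hu, v, hv, fun s => ?_⟩
  have := (le_iSup (fun s => max (p ((u s).1 - (v s).1)) (edist (u s).2 (v s).2)) s).trans_lt h
  obtain ⟨h1, h2⟩ := max_lt_iff.1 this
  refine ⟨h1, ?_⟩
  rw [edist_dist, ENNReal.ofReal_lt_ofReal_iff_of_nonneg dist_nonneg] at h2
  exact h2

end General

/-! ### Oscillations of real-valued paths -/

section Real

variable {T : ℝ}

/-- No value of `y` exceeds by more than `ε` the larger of two values of `y` before and after it,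
at times that differ by less than `δ`. -/
def UpOsc (y : Icc (0 : ℝ) T → ℝ) (δ ε : ℝ) : Prop :=
  ∀ t₁ t t₂ : Icc (0 : ℝ) T, t₁ ≤ t → t ≤ t₂ → (t₂ : ℝ) < t₁ + δ → y t ≤ max (y t₁) (y t₂) + ε

/-- Before time `δ` no value of `y` exceeds the initial value by more than `ε`. -/
def UpStart (y : Icc (0 : ℝ) T → ℝ) (δ ε : ℝ) : Prop :=
  ∀ o t : Icc (0 : ℝ) T, (o : ℝ) = 0 → (t : ℝ) < δ → y t ≤ y o + ε

theorem UpOsc.mono {y : Icc (0 : ℝ) T → ℝ} {δ δ' ε ε' : ℝ} (h : UpOsc y δ ε) (hδ : δ' ≤ δ)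
    (hε : ε ≤ ε') : UpOsc y δ' ε' := fun t₁ t t₂ h1 h2 h3 =>
  (h t₁ t t₂ h1 h2 (h3.trans_le (by linarith))).trans (by linarith)

theorem UpStart.mono {y : Icc (0 : ℝ) T → ℝ} {δ δ' ε ε' : ℝ} (h : UpStart y δ ε) (hδ : δ' ≤ δ)
    (hε : ε ≤ ε') : UpStart y δ' ε' := fun o t h1 h2 =>
  (h o t h1 (h2.trans_le hδ)).trans (by linarith)

theorem jumpPoint_le_max (y : CadlagPath T ℝ) (t : Icc (0 : ℝ) T) {a : ℝ}
    (ha : a ∈ Icc (0 : ℝ) 1) : y.jumpPoint t a ≤ max (y.leftLimit t) (y.toFun t) := by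
  have h1 := le_max_left (y.leftLimit t) (y.toFun t)
  have h2 := le_max_right (y.leftLimit t) (y.toFun t)
  simp only [jumpPoint, smul_eq_mul]
  nlinarith [ha.1, ha.2]

theorem min_le_jumpPoint (y : CadlagPath T ℝ) (t : Icc (0 : ℝ) T) {a : ℝ}
    (ha : a ∈ Icc (0 : ℝ) 1) : min (y.leftLimit t) (y.toFun t) ≤ y.jumpPoint t a := by
  have h1 := min_le_left (y.leftLimit t) (y.toFun t)
  have h2 := min_le_right (y.leftLimit t) (y.toFun t)
  simp only [jumpPoint, smul_eq_mul]
  nlinarith [ha.1, ha.2]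

/-- A value beyond `c` on the completed graph is approximated by values of the path at the same
time or just before. -/
theorem exists_lt_of_lt_leftLimit (y : CadlagPath T ℝ) {t : Icc (0 : ℝ) T} {c : ℝ}
    (h : c < y.leftLimit t) {w : ℝ} (hw : w < t) :
    ∃ t' ≤ t, w < t' ∧ c < y.toFun t' ∧ ((t : ℝ) ≠ 0 → t' < t) := by
  rcases t.2.1.eq_or_lt with h0 | h0
  · exact ⟨t, le_rfl, hw, by rwa [y.leftLimit_of_eq_zero h0.symm] at h, fun h => absurd h0.symm h⟩
  · have := nhdsLT_neBot_of_pos h0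
    have h1 := (y.tendsto_leftLimit t).eventually_const_lt h
    have h2 : ∀ᶠ t' : Icc (0 : ℝ) T in 𝓝[<] t, w < t' :=
      (continuous_subtype_val.tendsto t).mono_left nhdsWithin_le_nhds |>.eventually_const_lt hw
    obtain ⟨t', ⟨ht1, ht2⟩, ht3⟩ := ((h1.and h2).and self_mem_nhdsWithin).exists
    exact ⟨t', le_of_lt ht3, ht2, ht1, fun _ => ht3⟩

theorem exists_gt_of_leftLimit_lt (y : CadlagPath T ℝ) {t : Icc (0 : ℝ) T} {c : ℝ}
    (h : y.leftLimit t < c) {w : ℝ} (hw : w < t) :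
    ∃ t' ≤ t, w < t' ∧ y.toFun t' < c ∧ ((t : ℝ) ≠ 0 → t' < t) := by
  rcases t.2.1.eq_or_lt with h0 | h0
  · exact ⟨t, le_rfl, hw, by rwa [y.leftLimit_of_eq_zero h0.symm] at h, fun h => absurd h0.symm h⟩
  · have := nhdsLT_neBot_of_pos h0
    have h1 := (y.tendsto_leftLimit t).eventually_lt_const h
    have h2 : ∀ᶠ t' : Icc (0 : ℝ) T in 𝓝[<] t, w < t' :=
      (continuous_subtype_val.tendsto t).mono_left nhdsWithin_le_nhds |>.eventually_const_lt hw
    obtain ⟨t', ⟨ht1, ht2⟩, ht3⟩ := ((h1.and h2).and self_mem_nhdsWithin).exists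
    exact ⟨t', le_of_lt ht3, ht2, ht1, fun _ => ht3⟩

theorem exists_lt_of_lt_graph (y : CadlagPath T ℝ) {q : ℝ × Icc (0 : ℝ) T} (hq : q ∈ y.graph)
    {c : ℝ} (h : c < q.1) {w : ℝ} (hw : w < q.2) : ∃ t' ≤ q.2, w < t' ∧ c < y.toFun t' := by
  obtain ⟨a, ha, e⟩ := hq
  rcases lt_max_iff.1 (h.trans_le (e ▸ y.jumpPoint_le_max q.2 ha)) with h1 | h1
  · obtain ⟨t', h2, h3, h4, -⟩ := y.exists_lt_of_lt_leftLimit h1 hw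
    exact ⟨t', h2, h3, h4⟩
  · exact ⟨q.2, le_rfl, hw, h1⟩

theorem exists_gt_of_graph_lt (y : CadlagPath T ℝ) {q : ℝ × Icc (0 : ℝ) T} (hq : q ∈ y.graph)
    {c : ℝ} (h : q.1 < c) {w : ℝ} (hw : w < q.2) : ∃ t' ≤ q.2, w < t' ∧ y.toFun t' < c := by
  obtain ⟨a, ha, e⟩ := hq
  rcases min_lt_iff.1 ((e ▸ y.min_le_jumpPoint q.2 ha).trans_lt h) with h1 | h1
  · obtain ⟨t', h2, h3, h4, -⟩ := y.exists_gt_of_leftLimit_lt h1 hw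
    exact ⟨t', h2, h3, h4⟩
  · exact ⟨q.2, le_rfl, hw, h1⟩

/-- An oscillation bound for a path holds along all its parametric representations. -/
theorem UpOsc.paramReps {y : CadlagPath T ℝ} {δ ε : ℝ} (hO : UpOsc y.toFun δ ε) (hε : 0 ≤ ε)
    {u : unitInterval → ℝ × Icc (0 : ℝ) T} (hu : u ∈ y.paramReps) {s₁ s s₂ : unitInterval}
    (h₁ : s₁ ≤ s) (h₂ : s ≤ s₂) (hδ : ((u s₂).2 : ℝ) < (u s₁).2 + δ) :
    (u s).1 ≤ max (u s₁).1 (u s₂).1 + ε := by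
  by_contra hcon
  rw [not_le] at hcon
  -- The strict room around `c` lets graph points be replaced by values of the path at the same time
  -- or just before.
  obtain ⟨c, hc1, hc⟩ := exists_between hcon
  have hz1 : (u s₁).1 < c - ε := by linarith [le_max_left (u s₁).1 (u s₂).1]
  have hz2 : (u s₂).1 < c - ε := by linarith [le_max_right (u s₁).1 (u s₂).1]
  have key : ∀ t₁ t t₂ : Icc (0 : ℝ) T, t₁ ≤ t → t ≤ t₂ → (t₂ : ℝ) < t₁ + δ → y.toFun t₁ < c - ε →
      c < y.toFun t → y.toFun t₂ < c - ε → False := fun t₁ t t₂ h1 h2 h3 h4 h5 h6 => by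
    have := hO t₁ t t₂ h1 h2 h3
    have := max_lt h4 h6
    linarith
  have hg := paramReps_mem_graph hu s
  have hg1 := paramReps_mem_graph hu s₁
  have hg2 := paramReps_mem_graph hu s₂
  have hw : ((u s₂).2 : ℝ) - δ < (u s₁).2 := by linarith
  -- Graph points over the same time lie on one jump segment, traversed in order, so comparing two
  -- of them reveals the sign of the jump; then the two ends of the jump serve as values of the
  -- path.
  rcases hu.2.2 _ _ h₁ with hlt1 | ⟨he1, a₁, ha₁, a, ha, haa, e1, e⟩
  · have hlt1' : ((u s₁).2 : ℝ) < (u s).2 := hlt1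
    obtain ⟨r₁, hr1, hr1', hr1''⟩ := y.exists_gt_of_graph_lt hg1 hz1 hw
    rcases hu.2.2 _ _ h₂ with hlt2 | ⟨he2, b, hb, b₂, hb₂, hbb, f, f2⟩
    · obtain ⟨r, hr, hr', hr''⟩ := y.exists_lt_of_lt_graph hg hc hlt1'
      obtain ⟨r₂, hr2, hr2', hr2''⟩ := y.exists_gt_of_graph_lt hg2 hz2 (show ((u s).2 : ℝ) < (u s₂).2 from
        hlt2)
      have h3 : (r₂ : ℝ) ≤ (u s₂).2 := hr2
      exact key r₁ r r₂ (hr1.trans (le_of_lt hr')) (hr.trans (le_of_lt hr2')) (by linarith)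
        hr1'' hr'' hr2''
    · rw [← he2, jumpPoint_eq_add] at f2
      rw [jumpPoint_eq_add] at f
      simp only [smul_eq_mul] at f f2
      have hJ : y.toFun (u s).2 - y.leftLimit (u s).2 < 0 := by nlinarith
      have hl : c < y.leftLimit (u s).2 := by nlinarith [hb.1]
      have hr : y.toFun (u s).2 < c - ε := by nlinarith [hb₂.2]
      obtain ⟨r, hq1, hr2, hr3, -⟩ := y.exists_lt_of_lt_leftLimit hl hlt1'
      refine key r₁ r (u s).2 (hr1.trans (le_of_lt hr2)) hq1 ?_ hr1'' hr3 hr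
      rw [he2]; linarith
  · rw [he1, jumpPoint_eq_add] at e1
    rw [jumpPoint_eq_add] at e
    simp only [smul_eq_mul] at e e1
    have hJ : 0 < y.toFun (u s).2 - y.leftLimit (u s).2 := by nlinarith
    rcases hu.2.2 _ _ h₂ with hlt2 | ⟨he2, b, hb, b₂, hb₂, hbb, f, f2⟩
    · have hl : y.leftLimit (u s).2 < c - ε := by nlinarith [ha₁.1]
      have hr : c < y.toFun (u s).2 := by nlinarith [ha.2]
      obtain ⟨r₁, hr1, hr2, hr3, -⟩ := y.exists_gt_of_leftLimit_lt hl (he1 ▸ hw)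
      obtain ⟨r₂, hq2, hq2', hq2''⟩ := y.exists_gt_of_graph_lt hg2 hz2 (show ((u s).2 : ℝ) < (u s₂).2 from
        hlt2)
      have h3 : (r₂ : ℝ) ≤ (u s₂).2 := hq2
      exact key r₁ (u s).2 r₂ hr1 (le_of_lt hq2') (by linarith) hr3 hr hq2''
    · rw [← he2, jumpPoint_eq_add] at f2
      rw [jumpPoint_eq_add] at f
      simp only [smul_eq_mul] at f f2
      nlinarith

/-! ### Oscillations of a single path -/

theorem eventually_near (y : CadlagPath T ℝ) (t₀ : Icc (0 : ℝ) T) {ε : ℝ} (hε : 0 < ε) :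
    ∃ r > 0, ∀ t : Icc (0 : ℝ) T, |(t : ℝ) - t₀| < r →
      (t < t₀ → |y.toFun t - y.leftLimit t₀| < ε) ∧ (t₀ ≤ t → |y.toFun t - y.toFun t₀| < ε) := by
  have h1 := (Metric.tendsto_nhds.1 (y.tendsto_leftLimit t₀)) ε hε
  have h2 := (Metric.tendsto_nhds.1 (y.right_cont t₀)) ε hε
  rw [eventually_nhdsWithin_iff] at h1 h2
  obtain ⟨r, hr, h⟩ := Metric.eventually_nhds_iff.1 (h1.and h2)
  exact ⟨r, hr, fun t ht => ⟨(h ht).1, (h ht).2⟩⟩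

/-- Lebesgue number lemma for a cover by balls of varying radius. -/
theorem exists_uniform_radius {r : Icc (0 : ℝ) T → ℝ} (hr : ∀ t, 0 < r t) :
    ∃ δ > 0, ∀ t : Icc (0 : ℝ) T, ∃ t₀ : Icc (0 : ℝ) T, ∀ t' : Icc (0 : ℝ) T, |(t' : ℝ) - t| < δ → |(t' : ℝ) - t₀| < r t₀ := by
  obtain ⟨δ, hδ, h⟩ := lebesgue_number_lemma_of_metric (s := (univ : Set (Icc (0 : ℝ) T)))
    (c := fun t => Metric.ball t (r t)) isCompact_univ (fun t => Metric.isOpen_ball)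
    fun t _ => mem_iUnion.2 ⟨t, Metric.mem_ball_self (hr t)⟩
  refine ⟨δ, hδ, fun t => ?_⟩
  obtain ⟨t₀, h0⟩ := h t (mem_univ t)
  exact ⟨t₀, fun t' ht' => h0 ht'⟩

/-- Near any `t₀` the path is almost constant before `t₀` and almost constant after it; the middle
time is on the same side of `t₀` as one of the outer times. -/
theorem exists_upOsc (y : CadlagPath T ℝ) {ε : ℝ} (hε : 0 < ε) : ∃ δ > 0, UpOsc y.toFun δ ε := by
  choose r hr h using fun t₀ => y.eventually_near t₀ (half_pos hε)
  obtain ⟨δ, hδ, hd⟩ := exists_uniform_radius hr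
  refine ⟨δ, hδ, fun t₁ t t₂ h1 h2 h3 => ?_⟩
  have h1' : (t₁ : ℝ) ≤ t := h1
  have h2' : (t : ℝ) ≤ t₂ := h2
  obtain ⟨t₀, h0⟩ := hd t₁
  have k1 := h t₀ t₁ (h0 t₁ (by simpa using hδ))
  have k := h t₀ t (h0 t (abs_lt.2 ⟨by linarith, by linarith⟩))
  have k2 := h t₀ t₂ (h0 t₂ (abs_lt.2 ⟨by linarith, by linarith⟩))
  rcases lt_or_ge t t₀ with hlt | hge
  · have := abs_lt.1 (k.1 hlt)
    have := abs_lt.1 (k1.1 (h1.trans_lt hlt))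
    linarith [le_max_left (y.toFun t₁) (y.toFun t₂)]
  · have := abs_lt.1 (k.2 hge)
    have := abs_lt.1 (k2.2 (hge.trans h2))
    linarith [le_max_right (y.toFun t₁) (y.toFun t₂)]

theorem exists_upStart (y : CadlagPath T ℝ) {ε : ℝ} (hε : 0 < ε) :
    ∃ δ > 0, UpStart y.toFun δ ε := by
  by_cases hT : 0 ≤ T
  · obtain ⟨r, hr, h⟩ := y.eventually_near ⟨0, le_rfl, hT⟩ hε
    refine ⟨r, hr, fun o t ho ht => ?_⟩
    have ho' : o = ⟨0, le_rfl, hT⟩ := Subtype.ext ho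
    have := abs_lt.1 ((h t (by simpa [abs_of_nonneg t.2.1] using ht)).2 t.2.1)
    rw [ho']; linarith
  · exact ⟨1, one_pos, fun o => absurd (o.2.1.trans o.2.2) hT⟩

theorem exists_bound (y : CadlagPath T ℝ) : ∃ M : ℝ, ∀ t, |y.toFun t| ≤ M := by
  choose r hr h using fun t₀ => y.eventually_near t₀ one_pos
  obtain ⟨S, -, hS⟩ := isCompact_univ.elim_nhds_subcover (fun t => Metric.ball t (r t))
    fun t _ => Metric.ball_mem_nhds t (hr t)
  refine ⟨∑ t₀ ∈ S, (|y.leftLimit t₀| + |y.toFun t₀| + 1), fun t => ?_⟩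
  obtain ⟨t₀, h0, ht⟩ := mem_iUnion₂.1 (hS (mem_univ t))
  have k : |y.toFun t| ≤ |y.leftLimit t₀| + |y.toFun t₀| + 1 := by
    rcases lt_or_ge t t₀ with hlt | hge
    · have := (h t₀ t ht).1 hlt
      have := abs_sub_abs_le_abs_sub (y.toFun t) (y.leftLimit t₀)
      linarith [abs_nonneg (y.toFun t₀)]
    · have := (h t₀ t ht).2 hge
      have := abs_sub_abs_le_abs_sub (y.toFun t) (y.toFun t₀)
      linarith [abs_nonneg (y.leftLimit t₀)]
  exact k.trans (Finset.single_le_sum (f := fun t₀ => |y.leftLimit t₀| + |y.toFun t₀| + 1)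
    (fun _ _ => by positivity) h0)

/-! ### Open and compact sets of real-valued paths -/

/-- Openness asks for a ball around every point of the set. Sets whose constants leave slack satisfy
this directly, without the triangle inequality. -/
theorem isOpen_real_of_forall {U : Set (CadlagPath T ℝ)}
    (h : ∀ y ∈ U, ∃ η > 0, ∀ y', m1Dist (fun z : ℝ => ‖z‖ₑ) y' y < ENNReal.ofReal η → y' ∈ U) :
    IsOpen U := by
  refine (isOpen_iff_real _).2 fun y hy => ?_
  obtain ⟨η, hη, hU⟩ := h y hy
  exact ⟨{()}, ENNReal.ofReal η, ENNReal.ofReal_pos.2 hη,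
    fun y' hy' => hU y' (hy' () (Finset.mem_singleton_self _))⟩

theorem exists_paramReps_real {x y : CadlagPath T ℝ} {η : ℝ}
    (h : m1Dist (fun z : ℝ => ‖z‖ₑ) x y < ENNReal.ofReal η) :
    ∃ u ∈ x.paramReps, ∃ v ∈ y.paramReps,
      ∀ s, |(u s).1 - (v s).1| < η ∧ |((u s).2 : ℝ) - (v s).2| < η := by
  obtain ⟨u, hu, v, hv, h⟩ := exists_paramReps_of_m1Dist_lt h
  refine ⟨u, hu, v, hv, fun s => ⟨?_, (h s).2⟩⟩
  have := (h s).1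
  rwa [← ofReal_norm, ENNReal.ofReal_lt_ofReal_iff_of_nonneg (norm_nonneg _)] at this

/-- This yields the measurability of suprema over time. -/
theorem isOpen_setOf_exists_lt (c : ℝ) : IsOpen {y : CadlagPath T ℝ | ∃ t, c < y.toFun t} := by
  refine isOpen_real_of_forall fun y ⟨t, ht⟩ => ⟨y.toFun t - c, sub_pos.2 ht, fun y' hy' => ?_⟩
  obtain ⟨u, hu, v, hv, h⟩ := exists_paramReps_real hy'
  obtain ⟨s, hs⟩ := exists_paramReps_apply_eq hv (y.mem_graph_toFun t)
  have h1 := abs_lt.1 (h s).1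
  rw [hs] at h1
  obtain ⟨t', -, -, h'⟩ := y'.exists_lt_of_lt_graph (paramReps_mem_graph hu s)
    (c := c) (by linarith) (w := -1) (by linarith [(u s).2.2.1])
  exact ⟨t', h'⟩

/-- Each single path has a modulus, and a modulus with slack persists on an open neighbourhood;
compactness then gives a common one. -/
theorem exists_upOsc_of_isCompact {K : Set (CadlagPath T ℝ)} (hK : IsCompact K) {ε : ℝ}
    (hε : 0 < ε) : ∃ δ > 0, ∀ y ∈ K, UpOsc y.toFun δ ε := by
  refine hK.induction_on (p := fun S => ∃ δ > 0, ∀ y ∈ S, UpOsc y.toFun δ ε)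
    ⟨1, one_pos, fun y hy => hy.elim⟩ (fun S S' h ⟨δ, hδ, hS⟩ => ⟨δ, hδ, fun y hy => hS y (h hy)⟩)
    ?_ fun y _ => ?_
  · rintro S S' ⟨δ, hδ, h⟩ ⟨δ', hδ', h'⟩
    refine ⟨min δ δ', lt_min hδ hδ', fun y hy => hy.elim (fun hy => ?_) fun hy => ?_⟩
    · exact (h y hy).mono (min_le_left _ _) le_rfl
    · exact (h' y hy).mono (min_le_right _ _) le_rfl
  · obtain ⟨δ, hδ, hO⟩ := y.exists_upOsc (half_pos hε)
    refine ⟨{y | ∃ δ' > δ / 2, ∃ ε' < ε, 0 ≤ ε' ∧ UpOsc y.toFun δ' ε'}, mem_nhdsWithin_of_mem_nhds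
      (IsOpen.mem_nhds (isOpen_real_of_forall ?_)
        ⟨δ, by linarith, ε / 2, by linarith, by linarith, hO⟩),
      δ / 2, by linarith, fun y ⟨δ', h1, ε', h2, _, h⟩ => h.mono h1.le h2.le⟩
    rintro y ⟨δ', h1, ε', h2, h0, hO⟩
    -- A perturbation of size η costs at most 2η in time and 2η in value, that is, half of each
    -- slack.
    refine ⟨min ((δ' - δ / 2) / 4) ((ε - ε') / 4), lt_min (by linarith) (by linarith),
      fun y' hy' => ⟨(δ' + δ / 2) / 2, by linarith, (ε + ε') / 2, by linarith, by linarith, ?_⟩⟩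
    obtain ⟨u, hu, v, hv, h⟩ := exists_paramReps_real hy'
    intro t₁ t t₂ h1 h2 h3
    -- Only strictly ordered times force the order of the parameters; when two times coincide the
    -- bound is trivial.
    rcases h1.eq_or_lt with rfl | h1
    · linarith [le_max_left (y'.toFun t₁) (y'.toFun t₂)]
    rcases h2.eq_or_lt with rfl | h2
    · linarith [le_max_right (y'.toFun t₁) (y'.toFun t)]
    obtain ⟨s₁, hs1⟩ := exists_paramReps_apply_eq hu (y'.mem_graph_toFun t₁)
    obtain ⟨s, hs⟩ := exists_paramReps_apply_eq hu (y'.mem_graph_toFun t)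
    obtain ⟨s₂, hs2⟩ := exists_paramReps_apply_eq hu (y'.mem_graph_toFun t₂)
    have k1 := h s₁
    have k := h s
    have k2 := h s₂
    simp only [hs1, hs, hs2, lt_min_iff, abs_lt] at k1 k k2
    have := hO.paramReps h0 hv (paramReps_le_of_snd_lt hu (s := s₁) (s' := s) (by rwa [hs1, hs]))
      (paramReps_le_of_snd_lt hu (s := s) (s' := s₂) (by rwa [hs, hs2])) (by linarith)
    rcases max_cases (v s₁).1 (v s₂).1 with ⟨hm, -⟩ | ⟨hm, -⟩
    · linarith [le_max_left (y'.toFun t₁) (y'.toFun t₂)]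
    · linarith [le_max_right (y'.toFun t₁) (y'.toFun t₂)]

theorem exists_upStart_of_isCompact {K : Set (CadlagPath T ℝ)} (hK : IsCompact K) {ε : ℝ}
    (hε : 0 < ε) : ∃ δ > 0, ∀ y ∈ K, UpStart y.toFun δ ε := by
  refine hK.induction_on (p := fun S => ∃ δ > 0, ∀ y ∈ S, UpStart y.toFun δ ε)
    ⟨1, one_pos, fun y hy => hy.elim⟩ (fun S S' h ⟨δ, hδ, hS⟩ => ⟨δ, hδ, fun y hy => hS y (h hy)⟩)
    ?_ fun y _ => ?_
  · rintro S S' ⟨δ, hδ, h⟩ ⟨δ', hδ', h'⟩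
    refine ⟨min δ δ', lt_min hδ hδ', fun y hy => hy.elim (fun hy => ?_) fun hy => ?_⟩
    · exact (h y hy).mono (min_le_left _ _) le_rfl
    · exact (h' y hy).mono (min_le_right _ _) le_rfl
  · obtain ⟨δ, hδ, hO⟩ := y.exists_upStart (half_pos hε)
    refine ⟨{y | ∃ δ' > δ / 2, ∃ ε' < ε, UpStart y.toFun δ' ε'}, mem_nhdsWithin_of_mem_nhds
      (IsOpen.mem_nhds (isOpen_real_of_forall ?_) ⟨δ, by linarith, ε / 2, by linarith, hO⟩),
      δ / 2, by linarith, fun y ⟨δ', h1, ε', h2, h⟩ => h.mono h1.le h2.le⟩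
    rintro y ⟨δ', h1, ε', h2, hO⟩
    refine ⟨min ((δ' - δ / 2) / 4) ((ε - ε') / 8), lt_min (by linarith) (by linarith),
      fun y' hy' => ⟨(δ' + δ / 2) / 2, by linarith, (ε + ε') / 2, by linarith, ?_⟩⟩
    obtain ⟨u, hu, v, hv, h⟩ := exists_paramReps_real hy'
    intro o t ho ht
    obtain ⟨s, hs⟩ := exists_paramReps_apply_eq hu (y'.mem_graph_toFun t)
    have k := h s
    -- At parameter 0 both curves are at their initial points, which compares the initial values.
    have k0 := h 0
    simp only [hs, paramReps_zero hv ho, paramReps_zero hu ho, lt_min_iff, abs_lt] at k k0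
    obtain ⟨t', h3, -, h4⟩ := y.exists_lt_of_lt_graph (paramReps_mem_graph hv s)
      (c := (v s).1 - (ε - ε') / 8) (by linarith) (w := -1) (by linarith [(v s).2.2.1])
    have h3' : (t' : ℝ) ≤ (v s).2 := h3
    have := hO o t' ho (by linarith)
    linarith

theorem exists_le_of_isCompact {K : Set (CadlagPath T ℝ)} (hK : IsCompact K) :
    ∃ M : ℝ, ∀ y ∈ K, ∀ t, y.toFun t ≤ M := by
  refine hK.induction_on (p := fun S => ∃ M : ℝ, ∀ y ∈ S, ∀ t, y.toFun t ≤ M)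
    ⟨1, fun y hy => hy.elim⟩ (fun S S' h ⟨δ, hS⟩ => ⟨δ, fun y hy => hS y (h hy)⟩) ?_ fun y _ => ?_
  · rintro S S' ⟨M, h⟩ ⟨M', h'⟩
    refine ⟨max M M', fun y hy t => hy.elim (fun hy => ?_) fun hy => ?_⟩
    · exact (h y hy t).trans (le_max_left _ _)
    · exact (h' y hy t).trans (le_max_right _ _)
  · obtain ⟨M, hM⟩ := y.exists_bound
    refine ⟨{y | ∃ M' < M + 1, ∀ t, y.toFun t ≤ M'}, mem_nhdsWithin_of_mem_nhds
      (IsOpen.mem_nhds (isOpen_real_of_forall ?_)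
        ⟨M, by linarith, fun t => (le_abs_self _).trans (hM t)⟩),
      M + 1, fun y ⟨M', h1, h⟩ t => (h t).trans h1.le⟩
    rintro y ⟨M', h1, h⟩
    refine ⟨(M + 1 - M') / 4, by linarith, fun y' hy' => ⟨(M' + (M + 1)) / 2, by linarith,
      fun t => ?_⟩⟩
    obtain ⟨u, hu, v, hv, k⟩ := exists_paramReps_real hy'
    obtain ⟨s, hs⟩ := exists_paramReps_apply_eq hu (y'.mem_graph_toFun t)
    have k := k s
    simp only [hs, abs_lt] at k
    obtain ⟨t', h3, -, h4⟩ := y.exists_lt_of_lt_graph (paramReps_mem_graph hv s)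
      (c := (v s).1 - (M + 1 - M') / 8) (by linarith) (w := -1) (by linarith [(v s).2.2.1])
    linarith [h t']

end Real

end CadlagPath

/-! ### One-sided limits -/

section Countable

variable {α : Type*} [LinearOrder α] [TopologicalSpace α] [OrderTopology α] [DenselyOrdered α]
  [SecondCountableTopology α]

/-- If `z` lies strictly between f(t) and the right limit, then f stays above `z` on an interval
after `t`. Cutting at a point of a countable dense set makes this hold up to the cut, where such `t`
are countably many. -/
theorem countable_setOf_lt_rightLimit (f : α → ℝ) :
    {t | ∃ l, (𝓝[>] t).NeBot ∧ Tendsto f (𝓝[>] t) (𝓝 l) ∧ f t < l}.Countable := by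
  obtain ⟨D, hDc, hDd⟩ := TopologicalSpace.exists_countable_dense α
  refine (hDc.biUnion fun r _ => countable_image_lt_image_Ioi_within (Iio r) f).mono ?_
  rintro t ⟨l, hne, hl, hlt⟩
  obtain ⟨z, hz1, hz2⟩ := exists_between hlt
  obtain ⟨w, hw⟩ : ∃ w, t < w := (hne.nonempty_of_mem self_mem_nhdsWithin)
  obtain ⟨r, hr, hr'⟩ := (mem_nhdsGT_iff_exists_Ioo_subset' hw).1 (hl.eventually_const_lt hz2)
  obtain ⟨d, hd, hdD⟩ := hDd.exists_between hr
  exact mem_iUnion₂.2 ⟨d, hd, hdD.1, z, hz1, fun y hy hty => le_of_lt (hr' ⟨hty, hy.trans hdD.2⟩)⟩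

theorem countable_setOf_rightLimit_ne (f : α → ℝ) :
    {t | ∃ l, (𝓝[>] t).NeBot ∧ Tendsto f (𝓝[>] t) (𝓝 l) ∧ l ≠ f t}.Countable := by
  refine ((countable_setOf_lt_rightLimit f).union
    (countable_setOf_lt_rightLimit fun t => -f t)).mono ?_
  rintro t ⟨l, hne, hl, hlt⟩
  rcases lt_or_gt_of_ne hlt with h | h
  · exact Or.inr ⟨-l, hne, hl.neg, neg_lt_neg h⟩
  · exact Or.inl ⟨l, hne, hl, h⟩

theorem countable_setOf_leftLimit_ne (f : α → ℝ) :
    {t | ∃ l, (𝓝[<] t).NeBot ∧ Tendsto f (𝓝[<] t) (𝓝 l) ∧ l ≠ f t}.Countable :=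
  countable_setOf_rightLimit_ne (α := αᵒᵈ) f

end Countable

namespace CadlagPath

section Real

variable {T : ℝ}

theorem countable_jumps (y : CadlagPath T ℝ) : {t | y.leftLimit t ≠ y.toFun t}.Countable := by
  refine (countable_setOf_leftLimit_ne y.toFun).mono fun t ht => ?_
  have h0 : 0 < (t : ℝ) := t.2.1.lt_of_ne fun h => ht (y.leftLimit_of_eq_zero h.symm)
  exact ⟨_, nhdsLT_neBot_of_pos h0, y.tendsto_leftLimit t, ht⟩

theorem continuousAt_of_leftLimit_eq (y : CadlagPath T ℝ) {t : Icc (0 : ℝ) T}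
    (h : y.leftLimit t = y.toFun t) : ContinuousAt y.toFun t := by
  refine continuousAt_iff_continuous_left'_right'.2 ⟨?_, (y.right_cont t).mono Ioi_subset_Ici_self⟩
  have := y.tendsto_leftLimit t
  rwa [h] at this

/-! ### Continuous functionals on real-valued paths -/

/-- The path, extended to the real line by constants. -/
def extend (hT : 0 ≤ T) (y : CadlagPath T ℝ) (t : ℝ) : ℝ := y.toFun (projIcc 0 T hT t)

/-- An M1-close path takes at `t` a value near a graph point of `y` over a nearby time; if `y` is
continuous at `t`, all such graph points are near y(t). -/
theorem abs_extend_sub_lt (hT : 0 ≤ T) {y : CadlagPath T ℝ} {t : ℝ}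
    (ht : ContinuousAt y.toFun (projIcc 0 T hT t)) {ε : ℝ} (hε : 0 < ε) :
    ∃ η > 0, ∀ y', m1Dist (fun z : ℝ => ‖z‖ₑ) y' y < ENNReal.ofReal η →
      |extend hT y' t - extend hT y t| < ε := by
  set t₀ := projIcc 0 T hT t with ht₀
  obtain ⟨r, hr, h⟩ := Metric.continuousAt_iff.1 ht (ε / 4) (by linarith)
  refine ⟨min (r / 2) (ε / 4), lt_min (by linarith) (by linarith), fun y' hy' => ?_⟩
  obtain ⟨u, hu, v, hv, k⟩ := exists_paramReps_real hy'
  obtain ⟨s, hs⟩ := exists_paramReps_apply_eq hu (y'.mem_graph_toFun t₀)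
  have k := k s
  simp only [hs, abs_lt, lt_min_iff] at k
  have hn : ∀ t' : Icc (0 : ℝ) T, (v s).2 - r / 2 < t' → t' ≤ (v s).2 →
      |y.toFun t' - y.toFun t₀| < ε / 4 := fun t' h1 h2 => by
    have h2 : (t' : ℝ) ≤ (v s).2 := h2
    exact h (x := t') (show |(t' : ℝ) - t₀| < r from abs_lt.2 ⟨by linarith, by linarith⟩)
  obtain ⟨t₁, h1, h1', h1''⟩ := y.exists_lt_of_lt_graph (paramReps_mem_graph hv s)
    (c := (v s).1 - ε / 4) (by linarith) (w := (v s).2 - r / 2) (by linarith)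
  obtain ⟨t₂, h2, h2', h2''⟩ := y.exists_gt_of_graph_lt (paramReps_mem_graph hv s)
    (c := (v s).1 + ε / 4) (by linarith) (w := (v s).2 - r / 2) (by linarith)
  have e1 := abs_lt.1 (hn t₁ h1' h1)
  have e2 := abs_lt.1 (hn t₂ h2' h2)
  simp only [extend, ← ht₀]
  exact abs_lt.2 ⟨by linarith, by linarith⟩

theorem continuousAt_extend (hT : 0 ≤ T) {y : CadlagPath T ℝ} {t : ℝ}
    (ht : ContinuousAt y.toFun (projIcc 0 T hT t)) : ContinuousAt (extend hT y) t :=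
  ContinuousAt.comp (f := projIcc 0 T hT) (g := y.toFun) ht continuous_projIcc.continuousAt

/-- Off a countable set, `t ↦ y(t)` is continuous and evaluation at `t` is continuous at `y`. -/
theorem exists_countable_extend (hT : 0 ≤ T) (y : CadlagPath T ℝ) : ∃ S : Set ℝ, S.Countable ∧
    ∀ t, t ∉ S → ContinuousAt (extend hT y) t ∧ ∀ ε > 0, ∃ η > 0, ∀ y',
      m1Dist (fun z : ℝ => ‖z‖ₑ) y' y < ENNReal.ofReal η →
        |extend hT y' t - extend hT y t| < ε := by
  refine ⟨Subtype.val '' {t | y.leftLimit t ≠ y.toFun t}, y.countable_jumps.image _, fun t ht => ?_⟩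
  rcases le_or_gt t T with h | h
  · have hc : ContinuousAt y.toFun (projIcc 0 T hT t) := by
      refine y.continuousAt_of_leftLimit_eq ?_
      rcases le_or_gt 0 t with h0 | h0
      · rw [projIcc_of_mem hT ⟨h0, h⟩]
        by_contra hne
        exact ht ⟨_, hne, rfl⟩
      · refine y.leftLimit_of_eq_zero ?_
        rw [projIcc_of_le_left hT h0.le]
    exact ⟨continuousAt_extend hT hc, fun ε hε => abs_extend_sub_lt hT hc hε⟩
  -- Beyond T the extension equals the value at T. Evaluation at T is continuous even if there is a
  -- jump, because every representation ends at that value.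
  · have he : ∀ (z : CadlagPath T ℝ) (r : ℝ), T < r → extend hT z r = z.toFun ⟨T, hT, le_rfl⟩ :=
      fun z r hr => by rw [extend, projIcc_of_right_le hT hr.le]
    refine ⟨?_, fun ε hε => ⟨ε, hε, fun y' hy' => ?_⟩⟩
    · refine ContinuousAt.congr (f := fun _ => y.toFun ⟨T, hT, le_rfl⟩) continuousAt_const ?_
      filter_upwards [Ioi_mem_nhds h] with r hr using (he y r hr).symm
    · obtain ⟨u, hu, v, hv, k⟩ := exists_paramReps_real hy'
      have := (k 1).1
      rw [paramReps_one hu (o := ⟨T, hT, le_rfl⟩) rfl,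
        paramReps_one hv (o := ⟨T, hT, le_rfl⟩) rfl] at this
      rwa [he _ _ h, he _ _ h]

theorem abs_le_of_m1Dist_lt {y y' : CadlagPath T ℝ} {M η : ℝ} (hM : ∀ t, |y.toFun t| ≤ M)
    (h : m1Dist (fun z : ℝ => ‖z‖ₑ) y' y < ENNReal.ofReal η) (t : Icc (0 : ℝ) T) :
    |y'.toFun t| ≤ M + η := by
  obtain ⟨u, hu, v, hv, k⟩ := exists_paramReps_real h
  obtain ⟨s, hs⟩ := exists_paramReps_apply_eq hu (y'.mem_graph_toFun t)
  have k := abs_lt.1 (k s).1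
  rw [hs] at k
  have h1 : (v s).1 ≤ M := by
    by_contra hc
    obtain ⟨t', -, -, h'⟩ := y.exists_lt_of_lt_graph (paramReps_mem_graph hv s) (not_le.1 hc)
      (w := -1) (by linarith [(v s).2.2.1])
    linarith [(abs_le.1 (hM t')).2]
  have h2 : -M ≤ (v s).1 := by
    by_contra hc
    obtain ⟨t', -, -, h'⟩ := y.exists_gt_of_graph_lt (paramReps_mem_graph hv s) (not_le.1 hc)
      (w := -1) (by linarith [(v s).2.2.1])
    linarith [(abs_le.1 (hM t')).1]
  exact abs_le.2 ⟨by linarith, by linarith⟩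

theorem aestronglyMeasurable_extend (hT : 0 ≤ T) (y : CadlagPath T ℝ) :
    AEStronglyMeasurable (extend hT y) volume := by
  obtain ⟨S, hS, h⟩ := exists_countable_extend hT y
  have h1 : AEStronglyMeasurable (extend hT y) (volume.restrict Sᶜ) :=
    ContinuousOn.aestronglyMeasurable (fun t ht => (h t ht).1.continuousWithinAt)
      hS.measurableSet.compl
  rwa [Measure.restrict_eq_self_of_ae_mem] at h1
  exact measure_eq_zero_iff_ae_notMem.1 (hS.measure_zero volume)

theorem intervalIntegrable_extend (hT : 0 ≤ T) (y : CadlagPath T ℝ) (a b : ℝ) :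
    IntervalIntegrable (extend hT y) volume a b := by
  obtain ⟨M, hM⟩ := y.exists_bound
  refine (intervalIntegrable_const (c := M)).mono_fun
    (aestronglyMeasurable_extend hT y).restrict (ae_of_all _ fun t => ?_)
  exact (hM _).trans (le_abs_self M)

/-- Evaluations are continuous only at continuity times, but these are almost all times, and
M1-close paths are uniformly bounded: dominated convergence applies. Sequences suffice because a
single distance defines the topology. -/
theorem continuous_integral_extend (hT : 0 ≤ T) (a b : ℝ) :
    Continuous fun y : CadlagPath T ℝ => ∫ t in a..b, extend hT y t := by
  rw [continuous_def]
  intro V hV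
  refine isOpen_real_of_forall fun y hy => ?_
  by_contra! hcon
  obtain ⟨M, hM⟩ := y.exists_bound
  obtain ⟨S, hS, h⟩ := exists_countable_extend hT y
  choose z hz hzV using fun n : ℕ => hcon (1 / (n + 1)) Nat.one_div_pos_of_nat
  have hlim : ∀ η > 0, ∀ᶠ n in atTop, m1Dist (fun z : ℝ => ‖z‖ₑ) (z n) y < ENNReal.ofReal η := by
    intro η hη
    filter_upwards [(tendsto_one_div_add_atTop_nhds_zero_nat (𝕜 := ℝ)).eventually_lt_const hη]
      with n hn
    exact (hz n).trans ((ENNReal.ofReal_lt_ofReal_iff hη).2 hn)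
  have hI : Tendsto (fun n => ∫ t in a..b, extend hT (z n) t) atTop
      (𝓝 (∫ t in a..b, extend hT y t)) := by
    refine intervalIntegral.tendsto_integral_filter_of_dominated_convergence (fun _ => M + 1)
      (Eventually.of_forall fun n => (aestronglyMeasurable_extend hT _).restrict) ?_
      intervalIntegrable_const ?_
    · filter_upwards [hlim 1 one_pos] with n hn
      exact ae_of_all _ fun t _ => abs_le_of_m1Dist_lt hM hn _
    · filter_upwards [measure_eq_zero_iff_ae_notMem.1 (hS.measure_zero volume)] with t ht _
      refine Metric.tendsto_nhds.2 fun ε hε => ?_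
      obtain ⟨η, hη, hd⟩ := (h t ht).2 ε hε
      filter_upwards [hlim η hη] with n hn using hd _ hn
  obtain ⟨n, hn⟩ := (hI.eventually (hV.mem_nhds hy)).exists
  exact hzV n hn

/-- By right-continuity a strict inequality at `t` persists just after `t`, on an interval with
rational endpoints. At `t = T` this interval lies beyond T, where the extensions are constant. -/
theorem eq_of_integral_extend_eq (hT : 0 ≤ T) {x y : CadlagPath T ℝ}
    (h : ∀ a b : ℚ, ∫ t in (a : ℝ)..b, extend hT x t = ∫ t in (a : ℝ)..b, extend hT y t) :
    x = y := by
  have key : ∀ x y : CadlagPath T ℝ, (∀ a b : ℚ,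
      ∫ t in (a : ℝ)..b, extend hT x t = ∫ t in (a : ℝ)..b, extend hT y t) →
      ∀ t, x.toFun t ≤ y.toFun t := by
    intro x y h t
    by_contra! hlt
    have hc : ∀ z : CadlagPath T ℝ, ContinuousWithinAt (extend hT z) (Ici (t : ℝ)) t := fun z => by
      have h1 := z.right_cont t
      have h2 : projIcc 0 T hT t = t := projIcc_val hT t
      unfold extend
      refine ContinuousWithinAt.comp (t := Ici t) (by rw [h2]; exact h1)
        continuous_projIcc.continuousWithinAt fun r hr => ?_
      exact h2 ▸ monotone_projIcc hT hr
    have h0 : extend hT y t < extend hT x t := by simpa [extend] using hlt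
    obtain ⟨c, hc1, hc2⟩ := exists_between h0
    have hev := ((hc x).eventually_const_lt hc2).and ((hc y).eventually_lt_const hc1)
    obtain ⟨r, hr, hr'⟩ := (mem_nhdsGE_iff_exists_Ico_subset' (lt_add_one (t : ℝ))).1 hev
    obtain ⟨a, ha, ha'⟩ := exists_rat_btwn (show (t : ℝ) < r from hr)
    obtain ⟨b, hb, hb'⟩ := exists_rat_btwn ha'
    have hlt : ∫ s in (a : ℝ)..b, extend hT y s < ∫ s in (a : ℝ)..b, extend hT x s := by
      have h1 : ∀ s ∈ Icc (a : ℝ) b, c < extend hT x s ∧ extend hT y s < c := fun s hs =>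
        hr' ⟨ha.le.trans hs.1, hs.2.trans_lt hb'⟩
      have hab : (a : ℝ) < b := hb
      refine intervalIntegral.integral_lt_integral_of_ae_le_of_measure_setOfPred_lt_ne_zero hab.le
        (intervalIntegrable_extend hT y a b) (intervalIntegrable_extend hT x a b) ?_ ?_
      · filter_upwards [ae_restrict_mem measurableSet_Ioc] with s hs
        exact ((h1 s ⟨hs.1.le, hs.2⟩).2.trans (h1 s ⟨hs.1.le, hs.2⟩).1).le
      · rw [Measure.restrict_apply' measurableSet_Ioc]
        refine fun h2 => absurd (measure_mono_null (fun s hs => ?_) h2 : volume (Ioc (a : ℝ) b) = 0)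
          (by simp only [Real.volume_Ioc, ENNReal.ofReal_eq_zero, not_le]; linarith)
        exact ⟨(h1 s ⟨hs.1.le, hs.2⟩).2.trans (h1 s ⟨hs.1.le, hs.2⟩).1, hs⟩
    exact hlt.ne' (h a b)
  ext t
  exact le_antisymm (key x y h t) (key y x (fun a b => (h a b).symm) t)

theorem zero_le_of_mem (t : Icc (0 : ℝ) T) : 0 ≤ T := t.2.1.trans t.2.2

end Real

/-! ### Hausdorff property and separating functionals -/

section Separation

variable {T : ℝ}

instance : T2Space (CadlagPath T ℝ) := by
  refine ⟨fun x y hxy => ?_⟩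
  have hT : 0 ≤ T := by
    by_contra hT
    exact hxy (CadlagPath.ext (funext fun t => absurd (zero_le_of_mem t) hT))
  obtain ⟨a, b, hab⟩ : ∃ a b : ℚ,
      ∫ t in (a : ℝ)..b, extend hT x t ≠ ∫ t in (a : ℝ)..b, extend hT y t := by
    by_contra! h
    exact hxy (eq_of_integral_extend_eq hT h)
  exact separated_by_continuous (continuous_integral_extend hT a b) hab

variable {E : Type*} [AddCommGroup E] [Module ℝ E] [TopologicalSpace E] [ContinuousSMul ℝ E]

theorem eq_of_proj_eq {D : Set E} (hD : Dense D) {x y : CadlagPath T (StrongDual ℝ E)}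
    (h : ∀ φ ∈ D, proj φ x = proj φ y) : x = y := by
  ext t φ
  have : EqOn (x.toFun t) (y.toFun t) D := fun φ hφ =>
    congrFun (congrArg CadlagPath.toFun (h φ hφ)) t
  exact congrFun (Continuous.ext_on hD (x.toFun t).continuous (y.toFun t).continuous this) φ

instance : T2Space (CadlagPath T (StrongDual ℝ E)) := by
  refine ⟨fun x y hxy => ?_⟩
  obtain ⟨φ, hφ⟩ : ∃ φ, proj φ x ≠ proj φ y := by
    by_contra! h
    exact hxy (eq_of_proj_eq dense_univ fun φ _ => h φ)
  exact separated_by_continuous (continuous_proj φ) hφ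

/-- If `E` is separable, countably many continuous functionals separate the dual-valued paths. -/
theorem exists_continuous_injective [TopologicalSpace.SeparableSpace E] :
    ∃ F : CadlagPath T (StrongDual ℝ E) → ℕ → ℝ, Continuous F ∧ Function.Injective F := by
  by_cases hT : 0 ≤ T
  · obtain ⟨d, hd⟩ := TopologicalSpace.exists_dense_seq E
    obtain ⟨e, he⟩ : ∃ e : ℕ → ℕ × ℚ × ℚ, Function.Surjective e := exists_surjective_nat _
    refine ⟨fun x n => ∫ t in ((e n).2.1 : ℝ)..(e n).2.2, extend hT (proj (d (e n).1) x) t,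
      continuous_pi fun n => (continuous_integral_extend hT _ _).comp (continuous_proj _),
      fun x y hxy => eq_of_proj_eq hd ?_⟩
    rintro _ ⟨k, rfl⟩
    refine eq_of_integral_extend_eq hT fun a b => ?_
    obtain ⟨n, hn⟩ := he (k, a, b)
    have := congrFun hxy n
    simpa only [hn] using this
  · refine ⟨fun _ _ => 0, continuous_const, fun x y _ => ?_⟩
    exact CadlagPath.ext (funext fun t => absurd (zero_le_of_mem t) hT)

end Separation

end CadlagPath

namespace CadlagPath

/-! ### Reparametrization -/

/-- The parameters `(a', b')` can be reached from `(a, b)` by a monotone continuous motion through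
pairs that are related by `R`. -/
def MonotoneReach (R : unitInterval → unitInterval → Prop) (a b a' b' : unitInterval) : Prop :=
  ∃ (α : Path a a') (β : Path b b'), Monotone α ∧ Monotone β ∧ ∀ s, R (α s) (β s)

theorem monotone_path_trans {a b c : unitInterval} {γ : Path a b} {γ' : Path b c}
    (h : Monotone γ) (h' : Monotone γ') : Monotone (γ.trans γ') := by
  intro s t hst
  have hst' : (s : ℝ) ≤ t := hst
  rw [Path.trans_apply, Path.trans_apply]
  split_ifs with h1 h2 h2
  · exact h (Subtype.coe_le_coe.1 (by simpa using hst'))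
  · exact (h (show _ ≤ (1 : unitInterval) from unitInterval.le_one _)).trans
      ((γ.target.trans γ'.source.symm).le.trans (h' (unitInterval.nonneg _)))
  · exact absurd (hst'.trans h2) h1
  · exact h' (Subtype.coe_le_coe.1 (by simpa using hst'))

theorem MonotoneReach.trans {R : unitInterval → unitInterval → Prop}
    {a b a' b' a'' b'' : unitInterval} (h : MonotoneReach R a b a' b')
    (h' : MonotoneReach R a' b' a'' b'') : MonotoneReach R a b a'' b'' := by
  obtain ⟨α, β, hα, hβ, hR⟩ := h
  obtain ⟨α', β', hα', hβ', hR'⟩ := h'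
  refine ⟨α.trans α', β.trans β', monotone_path_trans hα hα', monotone_path_trans hβ hβ',
    fun s => ?_⟩
  rw [Path.trans_apply, Path.trans_apply]
  split_ifs
  · exact hR _
  · exact hR' _

theorem exists_monotone_path {a b : unitInterval} (h : a ≤ b) :
    ∃ γ : Path a b, Monotone γ ∧ ∀ s, γ s ∈ Icc a b := by
  have h' : (a : ℝ) ≤ b := h
  have hm : ∀ s : unitInterval, (a : ℝ) + s * (b - a) ∈ Icc (a : ℝ) b := fun s =>
    ⟨by nlinarith [s.2.1], by nlinarith [s.2.2]⟩
  refine ⟨⟨⟨fun s => ⟨(a : ℝ) + s * (b - a), a.2.1.trans (hm s).1, (hm s).2.trans b.2.2⟩,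
    by fun_prop⟩, Subtype.ext (by simp), Subtype.ext (by simp)⟩, fun s t hst => ?_, fun s => hm s⟩
  have hst' : (s : ℝ) ≤ t := hst
  refine Subtype.coe_le_coe.1 ?_
  change (a : ℝ) + s * (b - a) ≤ a + t * (b - a)
  nlinarith

theorem MonotoneReach.of_rectangle {R : unitInterval → unitInterval → Prop}
    {a b a' b' : unitInterval} (ha : a ≤ a') (hb : b ≤ b')
    (h : ∀ s ∈ Icc a a', ∀ s' ∈ Icc b b', R s s') : MonotoneReach R a b a' b' := by
  obtain ⟨α, hα, hα'⟩ := exists_monotone_path ha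
  obtain ⟨β, hβ, hβ'⟩ := exists_monotone_path hb
  exact ⟨α, β, hα, hβ, fun s => h _ (hα' s) _ (hβ' s)⟩

theorem MonotoneReach.mono {R R' : unitInterval → unitInterval → Prop}
    {a b a' b' : unitInterval} (h : MonotoneReach R a b a' b')
    (hR : ∀ s ∈ Icc a a', ∀ s' ∈ Icc b b', R s s' → R' s s') : MonotoneReach R' a b a' b' := by
  obtain ⟨α, β, hα, hβ, h⟩ := h
  refine ⟨α, β, hα, hβ, fun s => hR _ ⟨?_, ?_⟩ _ ⟨?_, ?_⟩ (h s)⟩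
  · simpa using hα (show (0 : unitInterval) ≤ s from unitInterval.nonneg s)
  · simpa using hα (show s ≤ (1 : unitInterval) from unitInterval.le_one s)
  · simpa using hβ (show (0 : unitInterval) ≤ s from unitInterval.nonneg s)
  · simpa using hβ (show s ≤ (1 : unitInterval) from unitInterval.le_one s)

section Reparam

variable {T : ℝ} {X : Type*} [TopologicalSpace X] [AddCommGroup X] [Module ℝ X]

theorem comp_mem_paramReps {x : CadlagPath T X} {u : unitInterval → X × Icc (0 : ℝ) T}
    (hu : u ∈ x.paramReps) {α : Path (0 : unitInterval) 1} (hα : Monotone α) :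
    u ∘ α ∈ x.paramReps := by
  refine ⟨hu.1.comp α.continuous, ?_, fun s s' h => hu.2.2 _ _ (hα h)⟩
  rw [← hu.2.1]
  refine Function.Surjective.range_comp (fun t => ?_) u
  have := intermediate_value_univ (0 : unitInterval) 1 α.continuous
  rw [α.source, α.target] at this
  exact this ⟨unitInterval.nonneg t, unitInterval.le_one t⟩

/-- A monotone path from 0 to 1 is onto, so composing with it gives another representation. Bounding
the distance thus reduces to matching the parameters of two fixed representations. -/
theorem m1Dist_le_of_monotoneReach {p : X → ℝ≥0∞} {x y : CadlagPath T X}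
    {u v : unitInterval → X × Icc (0 : ℝ) T} (hu : u ∈ x.paramReps) (hv : v ∈ y.paramReps)
    {η : ℝ≥0∞} (h : MonotoneReach
      (fun s s' => p ((u s).1 - (v s').1) ≤ η ∧ edist (u s).2 (v s').2 ≤ η) 0 0 1 1) :
    m1Dist p x y ≤ η := by
  obtain ⟨α, β, hα, hβ, h⟩ := h
  exact (iInf₂_le _ (comp_mem_paramReps hu hα)).trans
    ((iInf₂_le _ (comp_mem_paramReps hv hβ)).trans
      (iSup_le fun s => max_le (h s).1 (h s).2))

end Reparam

/-! ### Matching two curves that follow nearly the same segment -/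

section Matching

variable {X : Type*} [AddCommGroup X] [Module ℝ X]

/-- Between any two parameters in `[a, b]` the curve `z` stays within `ε` of the chord. -/
def NearChords (q : Seminorm ℝ X) (z : unitInterval → X) (a b : unitInterval) (ε : ℝ) : Prop :=
  ∀ s₁ s s₂, a ≤ s₁ → s₁ ≤ s → s ≤ s₂ → s₂ ≤ b →
    ∃ θ ∈ Icc (0 : ℝ) 1, q (z s - ((1 - θ) • z s₁ + θ • z s₂)) ≤ ε

theorem seminorm_chord_le (q : Seminorm ℝ X) {w A B P : X} {θ ε r : ℝ} (hθ : θ ∈ Icc (0 : ℝ) 1)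
    (hw : q (w - ((1 - θ) • A + θ • B)) ≤ ε) (hA : q (A - P) ≤ r) (hB : q (B - P) ≤ r) :
    q (w - P) ≤ ε + r := by
  have e : w - P = (w - ((1 - θ) • A + θ • B)) + ((1 - θ) • (A - P) + θ • (B - P)) := by
    module
  have h1 := map_add_le_add q (w - ((1 - θ) • A + θ • B)) ((1 - θ) • (A - P) + θ • (B - P))
  have h2 := map_add_le_add q ((1 - θ) • (A - P)) (θ • (B - P))
  rw [map_smul_eq_mul, map_smul_eq_mul, Real.norm_of_nonneg (sub_nonneg.2 hθ.2),
    Real.norm_of_nonneg hθ.1] at h2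
  rw [e]
  nlinarith [hθ.1, hθ.2, mul_le_mul_of_nonneg_left hA (sub_nonneg.2 hθ.2),
    mul_le_mul_of_nonneg_left hB hθ.1]

/-- The point is within ε of the chord point with some weight θ. Comparing distances to `z a` gives
|θ - r| q(z b - z a) ≤ ε, a second error of size ε. -/
theorem NearChords.level {q : Seminorm ℝ X} {z : unitInterval → X} {a b : unitInterval} {ε : ℝ}
    (h : NearChords q z a b ε) {c : unitInterval} (hc : c ∈ Icc a b) {r : ℝ}
    (hr : q (z c - z a) = r * q (z b - z a)) : q (z c - (z a + r • (z b - z a))) ≤ 2 * ε := by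
  obtain ⟨θ, hθ, h1⟩ := h a c b le_rfl hc.1 hc.2 le_rfl
  have e1 : z c - z a = (z c - ((1 - θ) • z a + θ • z b)) + θ • (z b - z a) := by module
  have e2 : θ • (z b - z a) = (z c - z a) - (z c - ((1 - θ) • z a + θ • z b)) := by module
  have e3 : z c - (z a + r • (z b - z a)) =
    (z c - ((1 - θ) • z a + θ • z b)) + (θ - r) • (z b - z a) := by module
  have h2 := map_add_le_add q (z c - ((1 - θ) • z a + θ • z b)) (θ • (z b - z a))
  have h3 := map_sub_le_add q (z c - z a) (z c - ((1 - θ) • z a + θ • z b))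
  have h4 := map_add_le_add q (z c - ((1 - θ) • z a + θ • z b)) ((θ - r) • (z b - z a))
  rw [← e1, hr, map_smul_eq_mul, Real.norm_of_nonneg hθ.1] at h2
  rw [← e2, hr, map_smul_eq_mul, Real.norm_of_nonneg hθ.1] at h3
  rw [← e3, map_smul_eq_mul, Real.norm_eq_abs] at h4
  have h5 : |θ - r| * q (z b - z a) ≤ ε := by
    have h6 : |θ - r| * q (z b - z a) = |(θ - r) * q (z b - z a)| := by
      rw [abs_mul, abs_of_nonneg (apply_nonneg q (z b - z a))]
    rw [h6]
    exact abs_le.2 ⟨by linarith, by linarith⟩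
  linarith

theorem exists_level {q : Seminorm ℝ X} {z : unitInterval → X} {a b c : unitInterval}
    (hz : Continuous fun s => q (z s - z a)) (hc : c ≤ b) {r : ℝ}
    (h1 : q (z c - z a) ≤ r) (h2 : r ≤ q (z b - z a)) :
    ∃ d ∈ Icc c b, q (z d - z a) = r :=
  intermediate_value_Icc hc hz.continuousOn ⟨h1, h2⟩

/-- Cut each curve where its distance from its start reaches i/N of the distance between its
endpoints. The i-th pieces remain within 4ε of the points at fraction i/N of their chords, and those
two points are within ε of each other. Hence any two points of corresponding pieces are within 4ε +
ε + 4ε, and the pieces may be traversed in any way. -/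
theorem NearChords.monotoneReach {q : Seminorm ℝ X} {z z' : unitInterval → X}
    {a b a' b' : unitInterval} {ε : ℝ} (h : NearChords q z a b ε) (h' : NearChords q z' a' b' ε)
    (hz : Continuous fun s => q (z s - z a)) (hz' : Continuous fun s => q (z' s - z' a'))
    (hab : a ≤ b) (hab' : a' ≤ b') (hε : 0 < ε) (ha : q (z a - z' a') ≤ ε)
    (hb : q (z b - z' b') ≤ ε) :
    MonotoneReach (fun s s' => q (z s - z' s') ≤ 9 * ε) a a' b b' := by
  set L := q (z b - z a) with hL
  set L' := q (z' b' - z' a') with hL'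
  obtain ⟨N, hN⟩ := exists_nat_gt (max (L / ε) (L' / ε))
  have hL0 : 0 ≤ L := apply_nonneg _ _
  have hL0' : 0 ≤ L' := apply_nonneg _ _
  have hN0 : (0 : ℝ) < N := lt_of_le_of_lt (le_max_of_le_left (by positivity)) hN
  have hLN : L / N ≤ ε := by
    rw [div_le_iff₀ hN0, ← div_le_iff₀' hε]
    exact (le_max_left _ _).trans hN.le
  have hLN' : L' / N ≤ ε := by
    rw [div_le_iff₀ hN0, ← div_le_iff₀' hε]
    exact (le_max_right _ _).trans hN.le
  have near : ∀ (z : unitInterval → X) (a b c d : unitInterval) (r : ℝ), NearChords q z a b ε →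
      c ∈ Icc a b → d ∈ Icc a b → q (z b - z a) / N ≤ ε →
      q (z c - z a) = r * q (z b - z a) → q (z d - z a) = (r + 1 / N) * q (z b - z a) →
      ∀ s ∈ Icc c d, q (z s - (z a + r • (z b - z a))) ≤ 4 * ε := by
    intro z a b c d r h hc hd hN hc' hd' s hs
    obtain ⟨θ, hθ, h1⟩ := h c s d hc.1 hs.1 hs.2 hd.2
    have k1 := h.level hc hc'
    have k2 := h.level hd hd'
    have e : z d - (z a + r • (z b - z a)) =
      (z d - (z a + (r + 1 / N) • (z b - z a))) + (1 / N : ℝ) • (z b - z a) := by module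
    have k3 := map_add_le_add q (z d - (z a + (r + 1 / (N : ℝ)) • (z b - z a)))
      ((1 / N : ℝ) • (z b - z a))
    rw [← e, map_smul_eq_mul, Real.norm_of_nonneg (by positivity)] at k3
    have k4 : 1 / (N : ℝ) * q (z b - z a) = q (z b - z a) / N := by ring
    have := seminorm_chord_le q hθ h1 (r := 3 * ε) (by linarith) (by linarith)
    linarith
  have cmp : ∀ (r : ℝ) (w w' : X), r ∈ Icc (0 : ℝ) 1 → q (w - (z a + r • (z b - z a))) ≤ 4 * ε →
      q (w' - (z' a' + r • (z' b' - z' a'))) ≤ 4 * ε → q (w - w') ≤ 9 * ε := by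
    intro r w w' hr h1 h2
    have h3 : q ((z a + r • (z b - z a)) - (z' a' + r • (z' b' - z' a'))) ≤ ε := by
      have e : (z a + r • (z b - z a)) - (z' a' + r • (z' b' - z' a')) =
        (1 - r) • (z a - z' a') + r • (z b - z' b') := by module
      have k := map_add_le_add q ((1 - r) • (z a - z' a')) (r • (z b - z' b'))
      rw [map_smul_eq_mul, map_smul_eq_mul, Real.norm_of_nonneg (sub_nonneg.2 hr.2),
        Real.norm_of_nonneg hr.1] at k
      rw [e]
      nlinarith [hr.1, hr.2]
    have e : w - w' = (w - (z a + r • (z b - z a))) +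
      ((z a + r • (z b - z a)) - (z' a' + r • (z' b' - z' a'))) -
      (w' - (z' a' + r • (z' b' - z' a'))) := by module
    have k1 := map_sub_le_add q ((w - (z a + r • (z b - z a))) +
      ((z a + r • (z b - z a)) - (z' a' + r • (z' b' - z' a'))))
      (w' - (z' a' + r • (z' b' - z' a')))
    have k2 := map_add_le_add q (w - (z a + r • (z b - z a)))
      ((z a + r • (z b - z a)) - (z' a' + r • (z' b' - z' a')))
    rw [e]
    linarith
  have ind : ∀ i : ℕ, i ≤ N → ∃ c ∈ Icc a b, ∃ c' ∈ Icc a' b', q (z c - z a) = (i / N : ℝ) * L ∧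
      q (z' c' - z' a') = (i / N : ℝ) * L' ∧
      MonotoneReach (fun s s' => q (z s - z' s') ≤ 9 * ε) a a' c c' := by
    intro i
    induction i with
    | zero =>
      refine fun _ => ⟨a, ⟨le_rfl, hab⟩, a', ⟨le_rfl, hab'⟩, by simp, by simp,
        MonotoneReach.of_rectangle le_rfl le_rfl fun s hs s' hs' => ?_⟩
      rw [le_antisymm hs.2 hs.1, le_antisymm hs'.2 hs'.1]
      linarith
    | succ i ih =>
      intro hi
      obtain ⟨c, hc, c', hc', e, e', hR⟩ := ih (by omega)
      have hi' : ((i + 1 : ℕ) : ℝ) ≤ N := by exact_mod_cast hi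
      push_cast at hi'
      have hr : (i / N : ℝ) ∈ Icc (0 : ℝ) 1 := ⟨by positivity, by rw [div_le_one hN0]; linarith⟩
      have hr1 : (i / N : ℝ) + 1 / N ≤ 1 := by rw [← add_div, div_le_one hN0]; linarith
      have hr2 : (0 : ℝ) ≤ 1 / N := by positivity
      -- The intermediate value theorem is applied after `c`, so that the cut points come in
      -- increasing order.
      obtain ⟨d, hd, f⟩ := exists_level hz hc.2 (r := ((i / N : ℝ) + 1 / N) * L)
        (by rw [e]; nlinarith) (by nlinarith)
      obtain ⟨d', hd', f'⟩ := exists_level hz' hc'.2 (r := ((i / N : ℝ) + 1 / N) * L')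
        (by rw [e']; nlinarith) (by nlinarith)
      refine ⟨d, ⟨hc.1.trans hd.1, hd.2⟩, d', ⟨hc'.1.trans hd'.1, hd'.2⟩, ?_, ?_, hR.trans ?_⟩
      · rw [f]; push_cast; ring
      · rw [f']; push_cast; ring
      · refine MonotoneReach.of_rectangle hd.1 hd'.1 fun s hs s' hs' => cmp _ _ _ hr
          (near z a b c d _ h hc ⟨hc.1.trans hd.1, hd.2⟩ hLN e f s hs)
          (near z' a' b' c' d' _ h' hc' ⟨hc'.1.trans hd'.1, hd'.2⟩ hLN' e' f' s' hs')
  obtain ⟨c, hc, c', hc', e, e', hR⟩ := ind N le_rfl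
  rw [div_self hN0.ne'] at e e'
  -- The full level may be reached before the endpoint; the rest of each curve stays near the
  -- endpoint of its chord.
  refine hR.trans (MonotoneReach.of_rectangle hc.2 hc'.2 fun s hs s' hs' =>
    cmp 1 _ _ ⟨zero_le_one, le_rfl⟩ ?_ ?_)
  · obtain ⟨θ, hθ, h1⟩ := h c s b hc.1 hs.1 hs.2 le_rfl
    have := seminorm_chord_le q hθ h1 (h.level hc e) (by simp [hε.le])
    linarith
  · obtain ⟨θ, hθ, h1⟩ := h' c' s' b' hc'.1 hs'.1 hs'.2 le_rfl
    have := seminorm_chord_le q hθ h1 (h'.level hc' e') (by simp [hε.le])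
    linarith

end Matching

end CadlagPath

/-! ### Dual-valued paths and their chords -/

namespace CadlagPath

section Dual

variable {E : Type*} [AddCommGroup E] [Module ℝ E] [TopologicalSpace E]
  {T : ℝ}

/-- Three functionals are collinear, the first between the others, if this holds for their values
at the points of a dense set. -/
theorem exists_mem_segment_of_forall_le {D : Set E} (hD : Dense D) {a b c : StrongDual ℝ E}
    (h : ∀ φ ∈ D, a φ ≤ max (b φ) (c φ)) : ∃ θ ∈ Icc (0 : ℝ) 1, a = (1 - θ) • b + θ • c := by
  have h1 : ∀ φ, a φ ≤ max (b φ) (c φ) := fun φ =>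
    hD.induction (P := fun φ => a φ ≤ max (b φ) (c φ)) h
      (isClosed_le a.continuous (b.continuous.max c.continuous)) φ
  have h2 : ∀ φ, (a - b) φ ≤ max 0 ((c - b) φ) := fun φ => by
    have := h1 φ
    simp only [FunLike.coe_sub, Pi.sub_apply]
    rw [← sub_self (b φ), max_sub_sub_right]
    linarith
  -- The lower bound is the upper bound for `-φ`.
  have h3 : ∀ φ, min 0 ((c - b) φ) ≤ (a - b) φ := fun φ => by
    have := h2 (-φ)
    rw [map_neg, map_neg, ← neg_zero, max_neg_neg] at this
    linarith
  by_cases hc : c - b = 0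
  · refine ⟨0, ⟨le_rfl, zero_le_one⟩, ?_⟩
    have : a - b = 0 := by
      ext φ
      have k2 := h2 φ
      have k3 := h3 φ
      rw [hc] at k2 k3
      simp only [FunLike.coe_zero, Pi.zero_apply, max_self, min_self] at k2 k3
      exact le_antisymm k2 k3
    rw [sub_eq_zero.1 this]
    simp
  · obtain ⟨φ₁, hφ₁⟩ : ∃ φ, (c - b) φ ≠ 0 := by
      by_contra! h
      exact hc (by ext φ; exact h φ)
    obtain ⟨φ₀, hφ₀⟩ : ∃ φ, (c - b) φ = 1 :=
      ⟨((c - b) φ₁)⁻¹ • φ₁, by rw [map_smul, smul_eq_mul, inv_mul_cancel₀ hφ₁]⟩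
    have k2 := h2 φ₀
    have k3 := h3 φ₀
    rw [hφ₀] at k2 k3
    norm_num at k2 k3
    -- Between the two bounds, `a - b` vanishes on the kernel of `c - b`, hence is a multiple of it;
    -- the factor is read off at `φ₀` and lies in [0,1].
    have key : a - b = ((a - b) φ₀) • (c - b) := by
      ext φ
      have e : (c - b) (φ - (c - b) φ • φ₀) = 0 := by
        rw [map_sub, map_smul, hφ₀, smul_eq_mul, mul_one, sub_self]
      have l2 := h2 (φ - (c - b) φ • φ₀)
      have l3 := h3 (φ - (c - b) φ • φ₀)
      rw [e, max_self] at l2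
      rw [e, min_self] at l3
      have l := le_antisymm l2 l3
      rw [map_sub, map_smul, smul_eq_mul, sub_eq_zero] at l
      rw [l, smul_apply, smul_eq_mul, mul_comm]
    refine ⟨(a - b) φ₀, ⟨by simpa using k3, by simpa using k2⟩, ?_⟩
    rw [← sub_eq_zero] at key ⊢
    rw [← key]
    module

theorem leftLimit_mem {B : Set (StrongDual ℝ E)} (hB : IsClosed B)
    {x : CadlagPath T (StrongDual ℝ E)} (hx : ∀ t, x.toFun t ∈ B) (t : Icc (0 : ℝ) T) :
    x.leftLimit t ∈ B := by
  rcases t.2.1.eq_or_lt with h | h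
  · rw [x.leftLimit_of_eq_zero h.symm]
    exact hx t
  · have := nhdsLT_neBot_of_pos h
    exact hB.mem_of_tendsto (x.tendsto_leftLimit t) (Eventually.of_forall fun s => hx s)

theorem graph_fst_mem {B : Set (StrongDual ℝ E)} (hB : IsClosed B) (hBc : Convex ℝ B)
    {x : CadlagPath T (StrongDual ℝ E)} (hx : ∀ t, x.toFun t ∈ B)
    {r : StrongDual ℝ E × Icc (0 : ℝ) T} (hr : r ∈ x.graph) : r.1 ∈ B := by
  obtain ⟨a, ha, e⟩ := hr
  rw [e]
  exact hBc (leftLimit_mem hB hx _) (hx _) (sub_nonneg.2 ha.2) ha.1 (by ring)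

variable [ContinuousSMul ℝ E]

/-- Scalar oscillation bounds along a dense set of directions, uniform over a family of paths with
values in a compact convex set, give a bound for the distance of the paths from their chords. -/
theorem exists_nearChords {D : Set E} (hD : Dense D) {B : Set (StrongDual ℝ E)}
    (hB : IsCompact B) (hBc : Convex ℝ B) {C : Set (CadlagPath T (StrongDual ℝ E))}
    (hCB : ∀ x ∈ C, ∀ t, x.toFun t ∈ B)
    (hCO : ∀ φ ∈ D, ∀ ε > 0, ∃ δ > 0, ∀ x ∈ C, UpOsc (proj φ x).toFun δ ε)
    {q : Seminorm ℝ (StrongDual ℝ E)} (hq : Continuous q) {ε : ℝ} (hε : 0 < ε) :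
    ∃ δ > 0, ∀ x ∈ C, ∀ u ∈ x.paramReps, ∀ a b : unitInterval, ((u b).2 : ℝ) < (u a).2 + δ →
      NearChords q (fun s => (u s).1) a b ε := by
  -- The compact set of bad triples: a middle point at distance at least ε from the whole chord of
  -- the other two.
  set F : Set (StrongDual ℝ E × StrongDual ℝ E × StrongDual ℝ E) :=
    (B ×ˢ (B ×ˢ B)) ∩ {w | ∀ θ ∈ Icc (0 : ℝ) 1, ε ≤ q (w.1 - ((1 - θ) • w.2.1 + θ • w.2.2))}
    with hF
  have hFc : IsCompact F := by
    refine (hB.prod (hB.prod hB)).inter_right ?_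
    simp only [ofPred_forall]
    exact isClosed_biInter fun θ _ => isClosed_le continuous_const (hq.comp (by fun_prop))
  have key : ∃ δ > 0, ∀ x ∈ C, ∀ u ∈ x.paramReps, ∀ s₁ s s₂ : unitInterval, s₁ ≤ s → s ≤ s₂ →
      ((u s₂).2 : ℝ) < (u s₁).2 + δ → ((u s).1, (u s₁).1, (u s₂).1) ∉ F := by
    refine hFc.induction_on (p := fun S => ∃ δ > 0, ∀ x ∈ C, ∀ u ∈ x.paramReps,
      ∀ s₁ s s₂ : unitInterval, s₁ ≤ s → s ≤ s₂ →
      ((u s₂).2 : ℝ) < (u s₁).2 + δ → ((u s).1, (u s₁).1, (u s₂).1) ∉ S)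
      ⟨1, one_pos, fun _ _ _ _ _ _ _ _ _ _ h => h⟩
      (fun S S' h ⟨δ, hδ, hS⟩ => ⟨δ, hδ, fun x hx u hu s₁ s s₂ h1 h2 h3 h4 =>
        hS x hx u hu s₁ s s₂ h1 h2 h3 (h h4)⟩) ?_ ?_
    · rintro S S' ⟨δ, hδ, h⟩ ⟨δ', hδ', h'⟩
      refine ⟨min δ δ', lt_min hδ hδ', fun x hx u hu s₁ s s₂ h1 h2 h3 h4 => ?_⟩
      rcases h4 with h4 | h4
      · exact h x hx u hu s₁ s s₂ h1 h2 (h3.trans_le (by gcongr; exact min_le_left _ _)) h4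
      · exact h' x hx u hu s₁ s s₂ h1 h2 (h3.trans_le (by gcongr; exact min_le_right _ _)) h4
    · rintro ⟨a, b, c⟩ ⟨-, hw⟩
      -- A bad triple is not collinear in order, so a direction in `D` detects it, also for nearby
      -- triples; the oscillation bound in that direction excludes them all. Compactness leaves
      -- finitely many directions.
      obtain ⟨φ, hφ, hlt⟩ : ∃ φ ∈ D, max (b φ) (c φ) < a φ := by
        by_contra! h
        obtain ⟨θ, hθ, e⟩ := exists_mem_segment_of_forall_le hD h
        have := hw θ hθ
        simp only [← e, sub_self, map_zero] at this
        exact absurd this (not_le.2 hε)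
      obtain ⟨η, hη, hlt'⟩ : ∃ η > 0, max (b φ) (c φ) + η < a φ :=
        ⟨(a φ - max (b φ) (c φ)) / 2, by linarith, by linarith⟩
      obtain ⟨δ, hδ, hO⟩ := hCO φ hφ η hη
      refine ⟨{w | max (w.2.1 φ) (w.2.2 φ) + η < w.1 φ}, mem_nhdsWithin_of_mem_nhds
        (IsOpen.mem_nhds (isOpen_lt ?_ ?_) hlt'), δ, hδ, fun x hx u hu s₁ s s₂ h1 h2 h3 => ?_⟩
      · exact ((((continuous_eval_const φ).comp (continuous_fst.comp continuous_snd)).max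
          ((continuous_eval_const φ).comp (continuous_snd.comp continuous_snd))).add
          continuous_const)
      · exact (continuous_eval_const φ).comp continuous_fst
      · exact not_lt.2 ((hO x hx).paramReps hη.le (mem_paramReps_proj φ x hu) h1 h2 h3)
  obtain ⟨δ, hδ, h⟩ := key
  refine ⟨δ, hδ, fun x hx u hu a b hab s₁ s s₂ h1 h2 h3 h4 => ?_⟩
  have hm := paramReps_monotone_snd hu
  have k1 : ((u a).2 : ℝ) ≤ (u s₁).2 := hm h1
  have k2 : ((u s₂).2 : ℝ) ≤ (u b).2 := hm h4
  have hn := h x hx u hu s₁ s s₂ h2 h3 (by linarith)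
  have hmem := fun s => graph_fst_mem hB.isClosed hBc (hCB x hx) (paramReps_mem_graph hu s)
  by_contra! hcon
  exact hn ⟨⟨hmem s, hmem s₁, hmem s₂⟩, fun θ hθ => (hcon θ hθ).le⟩

/-- Two paths of such a family that are close at suitable finitely many times are close in the
M1 distance. -/
theorem exists_finset_m1Dist_le {D : Set E} (hD : Dense D) {B : Set (StrongDual ℝ E)}
    (hB : IsCompact B) (hBc : Convex ℝ B) {C : Set (CadlagPath T (StrongDual ℝ E))}
    (hCB : ∀ x ∈ C, ∀ t, x.toFun t ∈ B)
    (hCO : ∀ φ ∈ D, ∀ ε > 0, ∃ δ > 0, ∀ x ∈ C, UpOsc (proj φ x).toFun δ ε)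
    (hCP : ∀ x ∈ C, x.paramReps.Nonempty)
    {q : Seminorm ℝ (StrongDual ℝ E)} (hq : Continuous q) {p : StrongDual ℝ E → ℝ≥0∞}
    (hp : ∀ z, p z ≤ ENNReal.ofReal (q z))
    {S : Set (Icc (0 : ℝ) T)} (hS : Dense S) (hS0 : ∀ t : Icc (0 : ℝ) T, (t : ℝ) = 0 → t ∈ S)
    (hST : ∀ t : Icc (0 : ℝ) T, (t : ℝ) = T → t ∈ S) (hT : 0 < T) {ε : ℝ} (hε : 0 < ε) :
    ∃ P : Finset (Icc (0 : ℝ) T), ↑P ⊆ S ∧ ∀ x ∈ C, ∀ y ∈ C,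
      (∀ t ∈ P, q (y.toFun t - x.toFun t) ≤ ε) → m1Dist p y x ≤ ENNReal.ofReal (9 * ε) := by
  classical
  obtain ⟨δ₀, hδ₀, hN⟩ := exists_nearChords hD hB hBc hCB hCO hq hε
  obtain ⟨δ, hδ, hδ1, hδ2⟩ : ∃ δ > 0, δ ≤ δ₀ ∧ δ ≤ 9 * ε :=
    ⟨min δ₀ (9 * ε), lt_min hδ₀ (by linarith), min_le_left _ _, min_le_right _ _⟩
  let R : (unitInterval → StrongDual ℝ E × Icc (0 : ℝ) T) →
    (unitInterval → StrongDual ℝ E × Icc (0 : ℝ) T) → unitInterval → unitInterval → Prop :=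
    fun u v s s' => q ((u s).1 - (v s').1) ≤ 9 * ε ∧ |((u s).2 : ℝ) - (v s').2| ≤ 9 * ε
  -- The matching is built forward in time: `Q t` says that closeness at finitely many times of `S`
  -- suffices to match the representations up to the graph points at time `t`.
  let Q : Icc (0 : ℝ) T → Prop := fun t => ∃ P : Finset (Icc (0 : ℝ) T), ↑P ⊆ S ∧ t ∈ P ∧
    ∀ x ∈ C, ∀ y ∈ C, (∀ t ∈ P, q (y.toFun t - x.toFun t) ≤ ε) →
    ∀ u ∈ y.paramReps, ∀ v ∈ x.paramReps, ∀ s s', u s = (y.toFun t, t) → v s' = (x.toFun t, t) →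
      MonotoneReach (R u v) 0 0 s s'
  have step : ∀ t t' : Icc (0 : ℝ) T, t < t' → t' ∈ S → (t' : ℝ) < t + δ → Q t → Q t' := by
    rintro t t' htt ht' hlt ⟨P, hPS, htP, hP⟩
    refine ⟨insert t' P, by simp [insert_subset_iff, ht', hPS], Finset.mem_insert_self _ _,
      fun x hx y hy hxy u hu v hv s s' hs hs' => ?_⟩
    obtain ⟨r, hr⟩ := exists_paramReps_apply_eq hu (y.mem_graph_toFun t)
    obtain ⟨r', hr'⟩ := exists_paramReps_apply_eq hv (x.mem_graph_toFun t)
    have h1 := hP x hx y hy (fun t ht => hxy t (Finset.mem_insert_of_mem ht)) u hu v hv r r' hr hr'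
    refine h1.trans ?_
    have hrs : r ≤ s := paramReps_le_of_snd_lt hu (by rw [hr, hs]; exact htt)
    have hrs' : r' ≤ s' := paramReps_le_of_snd_lt hv (by rw [hr', hs']; exact htt)
    have n1 := hN y hy u hu r s (by rw [hr, hs]; exact hlt.trans_le (by linarith))
    have n2 := hN x hx v hv r' s' (by rw [hr', hs']; exact hlt.trans_le (by linarith))
    have c1 : ∀ w : unitInterval → StrongDual ℝ E × Icc (0 : ℝ) T, Continuous w → ∀ a,
        Continuous fun s => q ((w s).1 - (w a).1) := fun w hw a =>
      hq.comp ((continuous_fst.comp hw).sub continuous_const)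
    refine (n1.monotoneReach n2 (c1 u hu.1 r) (c1 v hv.1 r') hrs hrs' hε ?_ ?_).mono
      fun a ha a' ha' h => ⟨h, ?_⟩
    · simp only [hr, hr']
      exact hxy t (Finset.mem_insert_of_mem htP)
    · simp only [hs, hs']
      exact hxy t' (Finset.mem_insert_self _ _)
    · have k1 : ((u r).2 : ℝ) ≤ (u a).2 := paramReps_monotone_snd hu ha.1
      have k2 : ((u a).2 : ℝ) ≤ (u s).2 := paramReps_monotone_snd hu ha.2
      have k3 : ((v r').2 : ℝ) ≤ (v a').2 := paramReps_monotone_snd hv ha'.1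
      have k4 : ((v a').2 : ℝ) ≤ (v s').2 := paramReps_monotone_snd hv ha'.2
      rw [hr] at k1
      rw [hs] at k2
      rw [hr'] at k3
      rw [hs'] at k4
      exact abs_le.2 ⟨by linarith, by linarith⟩
  let o : Icc (0 : ℝ) T := ⟨0, le_rfl, hT.le⟩
  have base : Q o := by
    refine ⟨{o}, by simpa using hS0 o rfl, Finset.mem_singleton_self _,
      fun x hx y hy hxy u hu v hv s s' hs hs' => ?_⟩
    refine MonotoneReach.of_rectangle (unitInterval.nonneg s) (unitInterval.nonneg s')
      fun a ha a' ha' => ?_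
    have e : ∀ (x : CadlagPath T (StrongDual ℝ E)) (u : unitInterval → _ × Icc (0 : ℝ) T),
        u ∈ x.paramReps → ∀ a s, a ≤ s → u s = (x.toFun o, o) → u a = (x.toFun o, o) := by
      intro x u hu a s has hs
      have h2 := paramReps_monotone_snd hu has
      simp only [hs] at h2
      have h3 : (u a).2 = o := le_antisymm h2 (u a).2.2.1
      obtain ⟨b, -, hb⟩ := paramReps_mem_graph hu a
      rw [h3, x.jumpPoint_of_leftLimit_eq (x.leftLimit_of_eq_zero rfl)] at hb
      exact Prod.ext hb h3
    change q ((u a).1 - (v a').1) ≤ 9 * ε ∧ |((u a).2 : ℝ) - (v a').2| ≤ 9 * ε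
    rw [e y u hu a s ha.2 hs, e x v hv a' s' ha'.2 hs']
    have := hxy o (Finset.mem_singleton_self _)
    exact ⟨this.trans (by linarith), by simpa using hε.le⟩
  have all : ∀ n : ℕ, ∀ t ∈ S, (t : ℝ) ≤ n * (δ / 2) → Q t := by
    intro n
    induction n with
    | zero =>
      intro t _ h0
      have : t = o := Subtype.ext (le_antisymm (h0.trans_eq (by simp [o])) t.2.1)
      exact this ▸ base
    | succ n ih =>
      intro t htS ht
      push_cast at ht
      rcases t.2.1.eq_or_lt with h0 | h0
      · exact (show t = o from Subtype.ext h0.symm) ▸ base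
      rcases lt_or_ge (t : ℝ) δ with h | h
      · exact step o t h0 htS (by simpa [o] using h) base
      -- The previous time is taken in `S` between t - δ and t - δ/2: each step is shorter than δ,
      -- but gains at least δ/2.
      · have hlt : (⟨t - δ, by linarith, by linarith [t.2.2]⟩ : Icc (0 : ℝ) T) <
            ⟨t - δ / 2, by linarith, by linarith [t.2.2]⟩ :=
          Subtype.coe_lt_coe.1 (by simp only; linarith)
        obtain ⟨r, hrS, hr⟩ := hS.exists_between hlt
        have h1 : (t : ℝ) - δ < r := hr.1
        have h2 : (r : ℝ) < t - δ / 2 := hr.2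
        exact step r t (Subtype.coe_lt_coe.1 (by linarith)) htS (by linarith)
          (ih r hrS (by linarith))
  obtain ⟨n, hn⟩ := exists_nat_ge (T / (δ / 2))
  let e : Icc (0 : ℝ) T := ⟨T, hT.le, le_rfl⟩
  obtain ⟨P, hPS, -, hP⟩ := all n e (hST e rfl) (by rwa [div_le_iff₀ (by linarith)] at hn)
  refine ⟨P, hPS, fun x hx y hy hxy => ?_⟩
  obtain ⟨u, hu⟩ := hCP y hy
  obtain ⟨v, hv⟩ := hCP x hx
  refine m1Dist_le_of_monotoneReach hu hv ((hP x hx y hy hxy u hu v hv 1 1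
    (paramReps_one hu rfl) (paramReps_one hv rfl)).mono fun s _ s' _ h => ⟨?_, ?_⟩)
  · exact (hp _).trans (ENNReal.ofReal_le_ofReal h.1)
  · rw [edist_dist]
    exact ENNReal.ofReal_le_ofReal h.2

end Dual

end CadlagPath

namespace CadlagPath

/-! ### Existence of parametric representations -/

section TimeChange

variable {T : ℝ}

/-- There is a strictly increasing function on `[0,T]` that grows at least at unit speed and jumps
at each point of a given countable set. -/
theorem exists_clock {R : Set (Icc (0 : ℝ) T)} (hR : R.Countable) :
    ∃ (τ w : Icc (0 : ℝ) T → ℝ), (∀ r, 0 < w r) ∧ (∀ t t', t ≤ t' → τ t + (t' - t) ≤ τ t') ∧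
      ∀ r ∈ R, ∀ t < r, τ t + w r ≤ τ r := by
  classical
  obtain ⟨w, hw, c, hc, -⟩ := hR.exists_pos_hasSum_le one_pos
  -- The clock will be `t` plus the sum of the summable weights of the points of `R` up to `t`.
  have hs : ∀ t : Icc (0 : ℝ) T, Summable fun r : R => if (r : Icc (0 : ℝ) T) ≤ t then w r else 0 :=
    fun t => Summable.of_nonneg_of_le (fun r => by split_ifs <;> simp [(hw r).le])
      (fun r => by split_ifs <;> simp [(hw r).le]) hc.summable
  refine ⟨fun t => t + ∑' r : R, if (r : Icc (0 : ℝ) T) ≤ t then w r else 0, w, hw,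
    fun t t' htt => ?_, fun r hr t htr => ?_⟩
  · have : (∑' r : R, if (r : Icc (0 : ℝ) T) ≤ t then w r else 0) ≤
        ∑' r : R, if (r : Icc (0 : ℝ) T) ≤ t' then w r else 0 := by
      refine (hs t).tsum_le_tsum (fun r => ?_) (hs t')
      by_cases h : (r : Icc (0 : ℝ) T) ≤ t
      · simp [h, h.trans htt]
      · simp only [h, if_false]
        split_ifs <;> simp [(hw r).le]
    linarith
  · have h1 : Summable fun r' : R => if r' = ⟨r, hr⟩ then w r else 0 :=
      (hasSum_ite_eq (⟨r, hr⟩ : R) (w r)).summable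
    have : (∑' r' : R, ((if (r' : Icc (0 : ℝ) T) ≤ t then w r' else 0) +
        if r' = ⟨r, hr⟩ then w r else 0)) ≤
        ∑' r' : R, if (r' : Icc (0 : ℝ) T) ≤ r then w r' else 0 := by
      refine ((hs t).add h1).tsum_le_tsum (fun r' => ?_) (hs r)
      by_cases h : r' = ⟨r, hr⟩
      · subst h
        simp [not_le.2 htr]
      · simp only [h, if_false, add_zero]
        by_cases h' : (r' : Icc (0 : ℝ) T) ≤ t
        · simp [h', h'.trans htr.le]
        · simp only [h', if_false]
          split_ifs <;> simp [(hw r').le]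
    rw [(hs t).tsum_add h1, tsum_ite_eq] at this
    have : (t : ℝ) < r := htr
    linarith

/-- There is a continuous monotone map of `[0,1]` onto `[0,T]` that is constant on a nondegenerate
interval over each point of a given countable set. -/
theorem exists_timeChange (hT : 0 < T) {R : Set (Icc (0 : ℝ) T)} (hR : R.Countable)
    (hR0 : ∀ r ∈ R, 0 < (r : ℝ)) :
    ∃ σ : unitInterval → Icc (0 : ℝ) T, Continuous σ ∧ Monotone σ ∧ Function.Surjective σ ∧
      ∀ r ∈ R, ∃ s s', s < s' ∧ σ s = r ∧ σ s' = r := by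
  obtain ⟨τ', w, hw, hτ', hτR'⟩ := exists_clock hR
  let o : Icc (0 : ℝ) T := ⟨0, le_rfl, hT.le⟩
  let e : Icc (0 : ℝ) T := ⟨T, hT.le, le_rfl⟩
  let τ : Icc (0 : ℝ) T → ℝ := fun t => τ' t - τ' o
  have hτ : ∀ t t', t ≤ t' → τ t + (t' - t) ≤ τ t' := fun t t' h => by
    have := hτ' t t' h
    simp only [τ]; linarith
  have hτR : ∀ r ∈ R, ∀ t < r, τ t + w r ≤ τ r := fun r hr t h => by
    have := hτR' r hr t h
    simp only [τ]; linarith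
  have hmono : ∀ t t', t ≤ t' → τ t ≤ τ t' := fun t t' h => by
    have := hτ t t' h
    have : (t : ℝ) ≤ t' := h
    linarith
  have h0 : τ o = 0 := sub_self _
  have hM : 0 < τ e := by
    have := hτ o e hT.le
    simp only [h0, o, e] at this ⊢
    linarith
  let A : ℝ → Set ℝ := fun s => {t | ∃ h : t ∈ Icc (0 : ℝ) T, τ ⟨t, h⟩ ≤ s}
  have hA0 : ∀ s, 0 ≤ s → (0 : ℝ) ∈ A s := fun s hs => ⟨o.2, h0.le.trans hs⟩
  have hbdd : ∀ s, BddAbove (A s) := fun s => ⟨T, fun t ht => ht.1.2⟩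
  -- The generalized inverse of the clock. It is 1-Lipschitz because the clock runs at least at unit
  -- speed, and constant across each jump of the clock.
  let g : ℝ → ℝ := fun s => sSup (A s)
  have hg0 : ∀ s, 0 ≤ s → 0 ≤ g s := fun s hs => le_csSup (hbdd s) (hA0 s hs)
  have hgT : ∀ s, 0 ≤ s → g s ≤ T := fun s hs => csSup_le ⟨0, hA0 s hs⟩ fun t ht => ht.1.2
  have hgm : ∀ s s', 0 ≤ s → s ≤ s' → g s ≤ g s' := fun s s' hs h =>
    csSup_le_csSup (hbdd s') ⟨0, hA0 s hs⟩ fun t ⟨ht, h'⟩ => ⟨ht, h'.trans h⟩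
  have hgl : ∀ s s', 0 ≤ s → s ≤ s' → g s' ≤ g s + (s' - s) := by
    intro s s' hs h
    refine csSup_le ⟨0, hA0 s' (hs.trans h)⟩ fun t ⟨ht, h'⟩ => ?_
    rcases le_or_gt (t - (s' - s)) 0 with h1 | h1
    · linarith [hg0 s hs]
    · have hm : t - (s' - s) ∈ Icc (0 : ℝ) T := ⟨h1.le, by linarith [ht.2]⟩
      have := hτ ⟨_, hm⟩ ⟨t, ht⟩ (Subtype.coe_le_coe.1 (by simpa using h))
      simp only at this
      have : t - (s' - s) ≤ g s := le_csSup (hbdd s) ⟨hm, by linarith⟩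
      linarith
  have hgτ : ∀ t, g (τ t) = t := fun t => by
    refine IsGreatest.csSup_eq ⟨⟨t.2, le_rfl⟩, fun t' ⟨ht', h⟩ => ?_⟩
    by_contra! hlt
    have := hτ t ⟨t', ht'⟩ (Subtype.coe_le_coe.1 hlt.le)
    simp only at this
    linarith
  have hsM : ∀ s : unitInterval, 0 ≤ s * τ e := fun s => mul_nonneg s.2.1 hM.le
  let σ : unitInterval → Icc (0 : ℝ) T := fun s =>
    ⟨g (s * τ e), hg0 _ (hsM s), hgT _ (hsM s)⟩
  have hpre : ∀ r : ℝ, 0 ≤ r → r ≤ τ e → ∃ s : unitInterval, (s : ℝ) * τ e = r := fun r h h' =>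
    ⟨⟨r / τ e, div_nonneg h hM.le, (div_le_one hM).2 h'⟩, div_mul_cancel₀ _ hM.ne'⟩
  refine ⟨σ, ?_, fun s s' h => ?_, fun t => ?_, fun r hr => ?_⟩
  · refine Continuous.subtype_mk ?_ _
    have hL : LipschitzWith 1 fun s : Ici (0 : ℝ) => g s := by
      refine LipschitzWith.of_le_add fun s s' => ?_
      rw [Subtype.dist_eq, Real.dist_eq]
      rcases le_total (s : ℝ) s' with h | h
      · linarith [hgm s s' s.2 h, abs_nonneg ((s : ℝ) - s')]
      · linarith [hgl s' s s'.2 h, le_abs_self ((s : ℝ) - s')]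
    exact hL.continuous.comp (Continuous.subtype_mk (p := fun s => s ∈ Ici (0 : ℝ))
      (continuous_subtype_val.mul continuous_const) hsM)
  · exact hgm _ _ (hsM s) (mul_le_mul_of_nonneg_right h hM.le)
  · obtain ⟨s, hs⟩ := hpre (τ t) (h0.symm.le.trans (hmono o t t.2.1)) (hmono t e t.2.2)
    exact ⟨s, Subtype.ext ((congrArg g hs).trans (hgτ t))⟩
  · have h1 := hτR r hr o (hR0 r hr)
    obtain ⟨s, hs⟩ := hpre (τ r - w r) (by linarith) (by linarith [hw r, hmono r e r.2.2])
    obtain ⟨s', hs'⟩ := hpre (τ r) (by linarith [hw r]) (hmono r e r.2.2)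
    refine ⟨s, s', ?_, Subtype.ext ?_, Subtype.ext ((congrArg g hs').trans (hgτ r))⟩
    · have : (s : ℝ) * τ e < s' * τ e := by linarith [hw r]
      exact Subtype.coe_lt_coe.1 (lt_of_mul_lt_mul_right this hM.le)
    · change g (s * τ e) = r
      rw [hs]
      refine le_antisymm ((hgm _ _ (by linarith) (by linarith [hw r])).trans_eq (hgτ r)) ?_
      refine le_of_forall_lt fun c hc => ?_
      obtain ⟨d, hd1, hd2⟩ := exists_between (max_lt hc (hR0 r hr))
      have hd : d ∈ Icc (0 : ℝ) T := ⟨((le_max_right c 0).trans_lt hd1).le, hd2.le.trans r.2.2⟩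
      exact ((le_max_left c 0).trans_lt hd1).trans_le (le_csSup (hbdd _)
        ⟨hd, by linarith [hτR r hr ⟨d, hd⟩ hd2]⟩)

/-- Points of the completed graph close to `t₀` on one side are close to the one-sided limit. -/
theorem exists_near_graph (y : CadlagPath T ℝ) (t₀ : Icc (0 : ℝ) T) {ε : ℝ} (hε : 0 < ε) :
    ∃ r > 0, ∀ q ∈ y.graph, |(q.2 : ℝ) - t₀| < r →
      (q.2 < t₀ → |q.1 - y.leftLimit t₀| < ε) ∧ (t₀ < q.2 → |q.1 - y.toFun t₀| < ε) := by
  obtain ⟨r, hr, h⟩ := y.eventually_near t₀ (half_pos hε)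
  refine ⟨r, hr, fun q hq hqr => ?_⟩
  have hqr' := abs_lt.1 hqr
  constructor
  · intro hlt
    have key : ∀ t' ≤ q.2, (t₀ : ℝ) - r < t' → |y.toFun t' - y.leftLimit t₀| < ε / 2 :=
      fun t' h1 h2 => by
        have h1' : (t' : ℝ) ≤ q.2 := h1
        have h3 : t' < t₀ := h1.trans_lt hlt
        have h3' : (t' : ℝ) < t₀ := h3
        exact (h t' (abs_lt.2 ⟨by linarith, by linarith⟩)).1 h3
    rw [abs_lt]
    constructor
    · by_contra! hc
      obtain ⟨t', h1, h2, h3⟩ := y.exists_gt_of_graph_lt hq (c := y.leftLimit t₀ - ε / 2)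
        (by linarith) (w := t₀ - r) (by linarith)
      linarith [(abs_lt.1 (key t' h1 h2)).1]
    · by_contra! hc
      obtain ⟨t', h1, h2, h3⟩ := y.exists_lt_of_lt_graph hq (c := y.leftLimit t₀ + ε / 2)
        (by linarith) (w := t₀ - r) (by linarith)
      linarith [(abs_lt.1 (key t' h1 h2)).2]
  · intro hlt
    have key : ∀ t' ≤ q.2, (t₀ : ℝ) < t' → |y.toFun t' - y.toFun t₀| < ε / 2 :=
      fun t' h1 h2 => by
        have h1' : (t' : ℝ) ≤ q.2 := h1
        exact (h t' (abs_lt.2 ⟨by linarith, by linarith⟩)).2 h2.le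
    rw [abs_lt]
    constructor
    · by_contra! hc
      obtain ⟨t', h1, h2, h3⟩ := y.exists_gt_of_graph_lt hq (c := y.toFun t₀ - ε / 2)
        (by linarith) (w := t₀) hlt
      linarith [(abs_lt.1 (key t' h1 h2)).1]
    · by_contra! hc
      obtain ⟨t', h1, h2, h3⟩ := y.exists_lt_of_lt_graph hq (c := y.toFun t₀ + ε / 2)
        (by linarith) (w := t₀) hlt
      linarith [(abs_lt.1 (key t' h1 h2)).2]

/-- If `σ` is a time change with fibres `[l t, r t]`, nondegenerate over the jump times of `y`, then
filling in the jumps linearly gives a continuous curve. -/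
theorem continuous_jumpPoint (y : CadlagPath T ℝ) {σ : unitInterval → Icc (0 : ℝ) T}
    (hσ : Continuous σ) (hσm : Monotone σ) {l r : Icc (0 : ℝ) T → unitInterval}
    (hl : ∀ t, IsLeast (σ ⁻¹' {t}) (l t)) (hr : ∀ t, IsGreatest (σ ⁻¹' {t}) (r t))
    (hj : ∀ t, y.leftLimit t ≠ y.toFun t → l t < r t) :
    Continuous fun s => y.jumpPoint (σ s)
      (((s : ℝ) - l (σ s)) / (r (σ s) - l (σ s))) := by
  have hmem : ∀ s : unitInterval, ((s : ℝ) - l (σ s)) / (r (σ s) - l (σ s)) ∈ Icc (0 : ℝ) 1 := fun s => by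
    have h1 : (l (σ s) : ℝ) ≤ s := (hl (σ s)).2 rfl
    have h2 : (s : ℝ) ≤ r (σ s) := (hr (σ s)).2 rfl
    exact ⟨div_nonneg (by linarith) (by linarith), div_le_one_of_le₀ (by linarith) (by linarith)⟩
  have hgr : ∀ s : unitInterval, (y.jumpPoint (σ s) (((s : ℝ) - l (σ s)) / (r (σ s) - l (σ s))), σ s) ∈ y.graph :=
    fun s => ⟨_, hmem s, rfl⟩
  have hfib : ∀ t s, l t ≤ s → s ≤ r t → σ s = t := fun t s h1 h2 =>
    le_antisymm ((hσm h2).trans_eq (hr t).1) ((hl t).1.symm.le.trans (hσm h1))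
  have hlin : ∀ t, Continuous fun s : unitInterval =>
      y.jumpPoint t (((s : ℝ) - l t) / (r t - l t)) := fun t => by
    unfold jumpPoint
    fun_prop
  refine continuous_iff_continuousAt.2 fun s₀ => continuousAt_iff_continuous_left'_right'.2 ⟨?_, ?_⟩
  -- Inside a fibre the curve is affine. From outside, the curve approaches the left limit at the
  -- left end of the fibre and the value of the path at the right end.
  · rcases ((hl (σ s₀)).2 rfl : l (σ s₀) ≤ s₀).lt_or_eq with h | h
    · refine (hlin (σ s₀)).continuousWithinAt.congr_of_eventuallyEq ?_ rfl
      filter_upwards [Ioo_mem_nhdsLT h] with s hs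
      rw [hfib (σ s₀) s hs.1.le (hs.2.le.trans ((hr (σ s₀)).2 rfl))]
    · refine Metric.tendsto_nhds.2 fun ε hε => ?_
      obtain ⟨ρ, hρ, hn⟩ := y.exists_near_graph (σ s₀) hε
      filter_upwards [self_mem_nhdsWithin, nhdsWithin_le_nhds
        (Metric.tendsto_nhds.1 (hσ.tendsto s₀) ρ hρ)] with s hs hsρ
      have hlt : σ s < σ s₀ := (hσm (le_of_lt hs)).lt_of_ne fun he =>
        absurd ((hl (σ s₀)).2 he) (by rw [h]; exact not_le.2 hs)
      have := (hn _ (hgr s) hsρ).1 hlt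
      have e : y.jumpPoint (σ s₀) (((s₀ : ℝ) - l (σ s₀)) / (r (σ s₀) - l (σ s₀))) =
          y.leftLimit (σ s₀) := by
        rw [h, sub_self, zero_div, jumpPoint_zero]
      rwa [e, Real.dist_eq]
  · rcases ((hr (σ s₀)).2 rfl : s₀ ≤ r (σ s₀)).lt_or_eq with h | h
    · refine (hlin (σ s₀)).continuousWithinAt.congr_of_eventuallyEq ?_ rfl
      filter_upwards [Ioo_mem_nhdsGT h] with s hs
      rw [hfib (σ s₀) s (le_trans ((hl (σ s₀)).2 rfl) hs.1.le) hs.2.le]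
    · refine Metric.tendsto_nhds.2 fun ε hε => ?_
      obtain ⟨ρ, hρ, hn⟩ := y.exists_near_graph (σ s₀) hε
      filter_upwards [self_mem_nhdsWithin, nhdsWithin_le_nhds
        (Metric.tendsto_nhds.1 (hσ.tendsto s₀) ρ hρ)] with s hs hsρ
      have hlt : σ s₀ < σ s := (hσm (le_of_lt hs)).lt_of_ne fun he =>
        absurd ((hr (σ s₀)).2 he.symm) (not_le.2 (h ▸ hs))
      have := (hn _ (hgr s) hsρ).2 hlt
      have e : y.jumpPoint (σ s₀) (((s₀ : ℝ) - l (σ s₀)) / (r (σ s₀) - l (σ s₀))) =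
          y.toFun (σ s₀) := by
        -- On a one-point fibre the weight is 0/0 = 0; this is harmless, as there is no jump there.
        by_cases hJ : y.leftLimit (σ s₀) = y.toFun (σ s₀)
        · exact y.jumpPoint_of_leftLimit_eq hJ _
        · have : (l (σ s₀) : ℝ) < r (σ s₀) := hj _ hJ
          rw [← h] at this ⊢
          rw [h] at this ⊢
          rw [← h, div_self (by rw [h]; exact (sub_pos.2 this).ne'), jumpPoint_one]
      rwa [e, Real.dist_eq]

end TimeChange

section Dual

variable {E : Type*} [AddCommGroup E] [Module ℝ E] [TopologicalSpace E] [ContinuousSMul ℝ E]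
  {T : ℝ}

/-- Weak and strong continuity agree for maps into a compact subset of the dual. -/
theorem continuous_of_forall_eval {Y : Type*} [TopologicalSpace Y] {B : Set (StrongDual ℝ E)}
    (hB : IsCompact B) {f : Y → StrongDual ℝ E} (hf : ∀ y, f y ∈ B)
    (h : ∀ φ, Continuous fun y => f y φ) : Continuous f := by
  refine continuous_iff_continuousAt.2 fun y => ?_
  refine hB.tendsto_nhds_of_unique_mapClusterPt (Eventually.of_forall hf) fun g _ hg => ?_
  ext φ
  have h1 : MapClusterPt (g φ) (𝓝 y) fun y => f y φ :=
    hg.continuousAt_comp (continuous_eval_const φ).continuousAt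
  have := ClusterPt.mono h1 ((h φ).tendsto y)
  exact eq_of_nhds_neBot this

/-- A path with values in a compact convex set has a parametric representation. -/
theorem paramReps_nonempty [TopologicalSpace.SeparableSpace E] (hT : 0 < T)
    {B : Set (StrongDual ℝ E)} (hB : IsCompact B) (hBc : Convex ℝ B)
    {x : CadlagPath T (StrongDual ℝ E)} (hx : ∀ t, x.toFun t ∈ B) : x.paramReps.Nonempty := by
  obtain ⟨D, hDc, hD⟩ := TopologicalSpace.exists_countable_dense E
  -- Jumps of the coordinates in a countable dense set of directions account for all jumps of `x`,
  -- so they are countably many.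
  let R : Set (Icc (0 : ℝ) T) := ⋃ φ ∈ D, {t | (proj φ x).leftLimit t ≠ (proj φ x).toFun t}
  have hR : R.Countable := hDc.biUnion fun φ _ => (proj φ x).countable_jumps
  have hjump : ∀ t ∉ R, x.leftLimit t = x.toFun t := fun t ht => by
    ext φ
    have : EqOn (x.leftLimit t) (x.toFun t) D := fun φ hφ => by
      by_contra hne
      exact ht (mem_iUnion₂.2 ⟨φ, hφ, by rw [mem_ofPred_eq, leftLimit_proj]; exact hne⟩)
    exact congrFun (Continuous.ext_on hD (x.leftLimit t).continuous (x.toFun t).continuous this) φ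
  obtain ⟨σ, hσ, hσm, hσs, hσR⟩ := exists_timeChange hT hR fun r hr => by
    obtain ⟨φ, -, h⟩ := mem_iUnion₂.1 hr
    exact r.2.1.lt_of_ne fun h0 => h ((proj φ x).leftLimit_of_eq_zero h0.symm)
  have hfc : ∀ t, IsCompact (σ ⁻¹' {t}) := fun t => (isClosed_singleton.preimage hσ).isCompact
  choose l hl using fun t => (hfc t).exists_isLeast (hσs t)
  choose r hr using fun t => (hfc t).exists_isGreatest (hσs t)
  have hlr : ∀ t ∈ R, l t < r t := fun t ht => by
    obtain ⟨s, s', h1, h2, h3⟩ := hσR t ht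
    exact ((hl t).2 h2).trans_lt (h1.trans_le ((hr t).2 h3))
  let a : unitInterval → ℝ := fun s => ((s : ℝ) - l (σ s)) / (r (σ s) - l (σ s))
  have ha : ∀ s, a s ∈ Icc (0 : ℝ) 1 := fun s => by
    have h1 : (l (σ s) : ℝ) ≤ s := (hl (σ s)).2 rfl
    have h2 : (s : ℝ) ≤ r (σ s) := (hr (σ s)).2 rfl
    exact ⟨div_nonneg (by linarith) (by linarith), div_le_one_of_le₀ (by linarith) (by linarith)⟩
  refine ⟨fun s => (x.jumpPoint (σ s) (a s), σ s), ?_, ?_, fun s s' hss => ?_⟩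
  -- The curve stays in the compact set `B`, so strong continuity follows from that of each
  -- coordinate.
  · refine Continuous.prodMk (continuous_of_forall_eval hB
      (fun s => graph_fst_mem hB.isClosed hBc hx (r := (_, σ s)) ⟨a s, ha s, rfl⟩) fun φ => ?_) hσ
    simp only [← jumpPoint_proj]
    refine continuous_jumpPoint (proj φ x) hσ hσm hl hr fun t ht => hlr t ?_
    by_contra hR
    exact ht (by rw [leftLimit_proj, hjump t hR]; rfl)
  · refine Subset.antisymm ?_ ?_
    · rintro _ ⟨s, rfl⟩
      exact ⟨a s, ha s, rfl⟩
    · rintro ⟨z, t⟩ ⟨b, hb, hz⟩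
      simp only at hz
      subst hz
      by_cases ht : t ∈ R
      · have hlt : (l t : ℝ) < r t := hlr t ht
        have h1 : (l t : ℝ) ≤ l t + b * (r t - l t) := by nlinarith [hb.1]
        have h2 : l t + b * (r t - l t) ≤ r t := by nlinarith [hb.2]
        let s : unitInterval := ⟨l t + b * (r t - l t), (l t).2.1.trans h1, h2.trans (r t).2.2⟩
        have hs : σ s = t := le_antisymm ((hσm (show s ≤ r t from h2)).trans_eq (hr t).1)
          ((hl t).1.symm.le.trans (hσm (show l t ≤ s from h1)))
        refine ⟨s, Prod.ext ?_ hs⟩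
        have : a s = b := by
          simp only [a, hs, s]
          rw [add_sub_cancel_left, mul_div_assoc, div_self (sub_pos.2 hlt).ne', mul_one]
        simp only [this, hs]
      · obtain ⟨s, hs⟩ := hσs t
        refine ⟨s, Prod.ext ?_ hs⟩
        simp only [hs, x.jumpPoint_of_leftLimit_eq (hjump t ht)]
  · rcases (hσm hss).lt_or_eq with h | h
    · exact Or.inl h
    · refine Or.inr ⟨h, a s, ha s, a s', ha s', ?_, rfl, rfl⟩
      have h1 : (l (σ s') : ℝ) ≤ r (σ s') := (hl (σ s')).2 (hr (σ s')).1
      simp only [a, h]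
      exact div_le_div_of_nonneg_right (sub_le_sub_right (show (s : ℝ) ≤ s' from hss) _) (by linarith)

end Dual

end CadlagPath

namespace CadlagPath

section Dual

variable {E : Type*} [AddCommGroup E] [Module ℝ E] [TopologicalSpace E]
  {T : ℝ}

/-! ### The seminorms of the strong topology -/

theorem dualSeminorm_lt_top {B : Set E} (hB : Bornology.IsVonNBounded ℝ B) (f : StrongDual ℝ E) :
    dualSeminorm B f < ⊤ := by
  obtain ⟨r, hr⟩ := ((NormedSpace.isVonNBounded_iff ℝ).1 (hB.image f)).exists_norm_le
  refine (iSup₂_le (a := ENNReal.ofReal r) fun φ hφ => ?_).trans_lt ENNReal.ofReal_lt_top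
  rw [← ofReal_norm]
  exact ENNReal.ofReal_le_ofReal (hr _ (mem_image_of_mem f hφ))

/-- Boundedness of `B` makes p_B finite, and its unit ball is then a basic neighbourhood of zero for
the strong topology. -/
theorem exists_seminorm_dualSeminorm {B : Set E} (hB : Bornology.IsVonNBounded ℝ B) :
    ∃ q : Seminorm ℝ (StrongDual ℝ E), Continuous q ∧
      ∀ f, dualSeminorm B f ≤ ENNReal.ofReal (q f) := by
  have hfin := fun f => (dualSeminorm_lt_top hB f).ne
  let q : Seminorm ℝ (StrongDual ℝ E) := Seminorm.ofSMulLE (fun f => (dualSeminorm B f).toReal)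
    (by simp [dualSeminorm])
    (fun f g => by
      rw [← ENNReal.toReal_add (hfin f) (hfin g)]
      refine ENNReal.toReal_mono (ENNReal.add_ne_top.2 ⟨hfin f, hfin g⟩) (iSup₂_le fun φ hφ => ?_)
      refine (enorm_add_le (f φ) (g φ)).trans (add_le_add ?_ ?_)
      · exact le_iSup₂ (f := fun φ (_ : φ ∈ B) => ‖f φ‖ₑ) φ hφ
      · exact le_iSup₂ (f := fun φ (_ : φ ∈ B) => ‖g φ‖ₑ) φ hφ)
    (fun r f => by
      rw [← toReal_enorm r, ← ENNReal.toReal_mul]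
      refine ENNReal.toReal_mono (ENNReal.mul_ne_top enorm_ne_top (hfin f))
        (iSup₂_le fun φ hφ => ?_)
      rw [smul_apply, enorm_smul]
      gcongr
      exact le_iSup₂ (f := fun φ (_ : φ ∈ B) => ‖f φ‖ₑ) φ hφ)
  refine ⟨q, Seminorm.continuous' (r := 1) ?_, fun f => (ENNReal.ofReal_toReal (hfin f)).ge⟩
  refine (ContinuousLinearMap.hasBasis_nhds_zero (𝕜₁ := ℝ) (𝕜₂ := ℝ) (σ := RingHom.id ℝ)).mem_iff.2
    ⟨(B, Metric.closedBall 0 1), ⟨hB, Metric.closedBall_mem_nhds _ one_pos⟩, fun f hf => ?_⟩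
  rw [Seminorm.mem_closedBall_zero]
  refine ENNReal.toReal_le_of_le_ofReal zero_le_one (iSup₂_le fun φ hφ => ?_)
  rw [← ofReal_norm]
  exact ENNReal.ofReal_le_ofReal (mem_closedBall_zero_iff.1 (hf φ hφ))

variable [ContinuousSMul ℝ E]

/-! ### A compactness criterion -/

/-- The paths with values in `B` that satisfy prescribed oscillation bounds along the directions
`d i`. -/
def oscSet (T : ℝ) (B : Set (StrongDual ℝ E)) (d : ℕ → E) (δ : ℕ → ℕ → ℝ) :
    Set (CadlagPath T (StrongDual ℝ E)) :=
  {x | (∀ t, x.toFun t ∈ B) ∧ ∀ i k, UpOsc (proj (d i) x).toFun (δ i k) (1 / (k + 1)) ∧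
    UpStart (proj (d i) x).toFun (δ i k) (1 / (k + 1))}

/-- One-sided limits exist along a filter in which any two recurrent events alternate within short
time. -/
theorem exists_tendsto_of_upOsc {B : Set (StrongDual ℝ E)} (hB : IsCompact B) {d : ℕ → E}
    (hd : DenseRange d) {δ : ℕ → ℕ → ℝ} (hδ : ∀ i k, 0 < δ i k)
    {g : Icc (0 : ℝ) T → StrongDual ℝ E} (hg : ∀ t, g t ∈ B)
    (hO : ∀ i k, UpOsc (fun t => g t (d i)) (δ i k) (1 / (k + 1)))
    {f : Filter (Icc (0 : ℝ) T)}
    (hf : ∀ (P Q : Icc (0 : ℝ) T → Prop) (r : ℝ), 0 < r → (∃ᶠ t in f, P t) → (∃ᶠ t in f, Q t) →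
      ∃ t₁ t t₂ : Icc (0 : ℝ) T, t₁ ≤ t ∧ t ≤ t₂ ∧ (t₂ : ℝ) < t₁ + r ∧ P t₁ ∧ Q t ∧ P t₂) :
    ∃ l, Tendsto g f (𝓝 l) := by
  -- If two cluster points differed along `d i`, the values would be near the lower one, then the
  -- upper one, then the lower one again within arbitrarily short time.
  have key : ∀ a b : StrongDual ℝ E, MapClusterPt a f g → MapClusterPt b f g → ∀ i,
      b (d i) ≤ a (d i) := by
    intro a b ha hb i
    by_contra! hlt
    obtain ⟨k, hk⟩ := exists_nat_one_div_lt (show 0 < (b (d i) - a (d i)) / 3 by linarith)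
    have ha' : ∃ᶠ t in f, g t (d i) < a (d i) + (b (d i) - a (d i)) / 3 :=
      ha.frequently (((continuous_eval_const (d i)).tendsto a).eventually_lt_const
        (show a (d i) < _ by linarith))
    have hb' : ∃ᶠ t in f, b (d i) - (b (d i) - a (d i)) / 3 < g t (d i) :=
      hb.frequently (((continuous_eval_const (d i)).tendsto b).eventually_const_lt
        (show _ < b (d i) by linarith))
    obtain ⟨t₁, t, t₂, h1, h2, h3, k1, k2, k3⟩ := hf _ _ _ (hδ i k) ha' hb'
    have := hO i k t₁ t t₂ h1 h2 h3
    have := max_lt k1 k3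
    linarith
  rcases f.eq_or_neBot with rfl | hne
  · exact ⟨0, tendsto_bot⟩
  obtain ⟨l, -, hl⟩ := hB.exists_mapClusterPt (f := f) (u := g)
    (tendsto_principal.2 (Eventually.of_forall hg))
  refine ⟨l, hB.tendsto_nhds_of_unique_mapClusterPt (Eventually.of_forall hg) fun b _ hb => ?_⟩
  ext φ
  exact congrFun (Continuous.ext_on hd b.continuous l.continuous
    (by rintro _ ⟨i, rfl⟩; exact le_antisymm (key l b hl hb i) (key b l hb hl i))) φ

/-- The times are picked from the last to the first, each closer to `t₀` than the one before. -/
theorem alternate_nhdsGT (t₀ : Icc (0 : ℝ) T) (P Q : Icc (0 : ℝ) T → Prop) (r : ℝ) (hr : 0 < r)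
    (hP : ∃ᶠ t in 𝓝[>] t₀, P t) (hQ : ∃ᶠ t in 𝓝[>] t₀, Q t) :
    ∃ t₁ t t₂ : Icc (0 : ℝ) T, t₁ ≤ t ∧ t ≤ t₂ ∧ (t₂ : ℝ) < t₁ + r ∧ P t₁ ∧ Q t ∧ P t₂ := by
  have h1 : ∀ᶠ t : Icc (0 : ℝ) T in 𝓝[>] t₀, (t : ℝ) < t₀ + r :=
    nhdsWithin_le_nhds (continuous_subtype_val.continuousAt.eventually_lt_const (by simpa using hr))
  obtain ⟨t₂, hP2, h2, h2'⟩ := (hP.and_eventually (h1.and self_mem_nhdsWithin)).exists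
  obtain ⟨t, hQt, ht⟩ := (hQ.and_eventually (Ioo_mem_nhdsGT h2')).exists
  obtain ⟨t₁, hP1, ht1⟩ := (hP.and_eventually (Ioo_mem_nhdsGT ht.1)).exists
  have h3 : (t₀ : ℝ) < t₁ := ht1.1
  exact ⟨t₁, t, t₂, ht1.2.le, ht.2.le, by linarith, hP1, hQt, hP2⟩

theorem alternate_nhdsLT (t₀ : Icc (0 : ℝ) T) (P Q : Icc (0 : ℝ) T → Prop) (r : ℝ) (hr : 0 < r)
    (hP : ∃ᶠ t in 𝓝[<] t₀, P t) (hQ : ∃ᶠ t in 𝓝[<] t₀, Q t) :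
    ∃ t₁ t t₂ : Icc (0 : ℝ) T, t₁ ≤ t ∧ t ≤ t₂ ∧ (t₂ : ℝ) < t₁ + r ∧ P t₁ ∧ Q t ∧ P t₂ := by
  have h1 : ∀ᶠ t : Icc (0 : ℝ) T in 𝓝[<] t₀, (t₀ : ℝ) - r < t :=
    nhdsWithin_le_nhds (continuous_subtype_val.continuousAt.eventually_const_lt (by simpa using hr))
  obtain ⟨t₁, hP1, h2, h2'⟩ := (hP.and_eventually (h1.and self_mem_nhdsWithin)).exists
  obtain ⟨t, hQt, ht⟩ := (hQ.and_eventually (Ioo_mem_nhdsLT h2')).exists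
  obtain ⟨t₂, hP2, ht2⟩ := (hP.and_eventually (Ioo_mem_nhdsLT ht.2)).exists
  have h3 : (t₂ : ℝ) < t₀ := ht2.2
  exact ⟨t₁, t, t₂, ht.1.le, ht2.1.le, by linarith, hP1, hQt, hP2⟩

theorem dense_of_countable_compl (hT : 0 < T) {S : Set (Icc (0 : ℝ) T)} (hS : Sᶜ.Countable) :
    Dense S := by
  have : Nontrivial (Icc (0 : ℝ) T) :=
    ⟨⟨0, le_rfl, hT.le⟩, ⟨T, hT.le, le_rfl⟩, fun h => hT.ne (congrArg Subtype.val h)⟩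
  refine dense_of_exists_between fun a b hab => ?_
  obtain ⟨t, ht, hab⟩ := ((hS.image Subtype.val).dense_compl ℝ).exists_between
    (Subtype.coe_lt_coe.2 hab)
  refine ⟨⟨t, a.2.1.trans hab.1.le, hab.2.le.trans b.2.2⟩, ?_, hab.1, hab.2⟩
  by_contra h
  exact ht ⟨_, h, rfl⟩

/-- Along an ultrafilter the paths converge pointwise in `B` to some `g`, which inherits the
oscillation bounds and so has right limits. Its right-limit function `x` is càdlàg and satisfies the
same bounds. It agrees with `g` off a countable set, at 0 by the bound at the start, and at T;
closeness at finitely many such times gives M1 convergence to `x`. -/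
theorem isCompact_oscSet [TopologicalSpace.SeparableSpace E] (hT : 0 < T)
    {B : Set (StrongDual ℝ E)} (hB : IsCompact B) (hBc : Convex ℝ B) {d : ℕ → E}
    (hd : DenseRange d) {δ : ℕ → ℕ → ℝ} (hδ : ∀ i k, 0 < δ i k) :
    IsCompact (oscSet T B d δ) := by
  refine isCompact_iff_ultrafilter_le_nhds.2 fun F hF => ?_
  have hFC : ∀ᶠ x in (F : Filter (CadlagPath T (StrongDual ℝ E))), x ∈ oscSet T B d δ :=
    le_principal_iff.1 hF
  have hex : ∀ t, ∃ l ∈ B, Tendsto (fun x : CadlagPath T (StrongDual ℝ E) => x.toFun t) F (𝓝 l) :=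
    fun t => hB.ultrafilter_le_nhds
      (F.map fun x : CadlagPath T (StrongDual ℝ E) => x.toFun t) (tendsto_principal.2 (hFC.mono fun x hx => hx.1 t))
  choose g hgB hg using hex
  have hgφ : ∀ t φ, Tendsto (fun x : CadlagPath T (StrongDual ℝ E) => x.toFun t φ) F (𝓝 (g t φ)) :=
    fun t φ => ((continuous_eval_const φ).tendsto (g t)).comp (hg t)
  have hgO : ∀ i k, UpOsc (fun t => g t (d i)) (δ i k) (1 / (k + 1)) :=
    fun i k t₁ t t₂ h1 h2 h3 => le_of_tendsto_of_tendsto (hgφ t (d i))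
      (((hgφ t₁ (d i)).max (hgφ t₂ (d i))).add_const _)
      (hFC.mono fun x hx => (hx.2 i k).1 t₁ t t₂ h1 h2 h3)
  have hgS : ∀ i k, UpStart (fun t => g t (d i)) (δ i k) (1 / (k + 1)) :=
    fun i k o t h1 h2 => le_of_tendsto_of_tendsto (hgφ t (d i)) ((hgφ o (d i)).add_const _)
      (hFC.mono fun x hx => (hx.2 i k).2 o t h1 h2)
  have hR : ∀ t, Tendsto g (𝓝[>] t) (𝓝 (Function.rightLim g t)) := fun t =>
    tendsto_rightLim_of_tendsto
      (exists_tendsto_of_upOsc hB hd hδ hgB hgO (alternate_nhdsGT t))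
  have hRφ : ∀ t φ, Tendsto (fun s => g s φ) (𝓝[>] t) (𝓝 (Function.rightLim g t φ)) := fun t φ =>
    ((continuous_eval_const φ).tendsto _).comp (hR t)
  -- At the last time, where there is nothing to the right, `rightLim` is by convention the value
  -- itself.
  have hRbot : ∀ t, 𝓝[>] t = ⊥ → Function.rightLim g t = g t := fun t =>
    rightLim_eq_of_eq_bot g
  have hRB : ∀ t, Function.rightLim g t ∈ B := fun t => by
    rcases (𝓝[>] t).eq_or_neBot with h | h
    · rw [hRbot t h]; exact hgB t
    · exact hB.isClosed.mem_of_tendsto (hR t) (Eventually.of_forall hgB)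
  have near : ∀ (t : Icc (0 : ℝ) T) (φ : E) (U : Set ℝ), IsOpen U → Function.rightLim g t φ ∈ U →
      ∀ w : ℝ, t < w → ∃ s, t ≤ s ∧ (s : ℝ) < w ∧ g s φ ∈ U := by
    intro t φ U hU hm w hw
    rcases (𝓝[>] t).eq_or_neBot with h | h
    · exact ⟨t, le_rfl, hw, by rwa [← hRbot t h]⟩
    · have h1 : ∀ᶠ s : Icc (0 : ℝ) T in 𝓝[>] t, (s : ℝ) < w :=
        nhdsWithin_le_nhds (continuous_subtype_val.continuousAt.eventually_lt_const hw)
      obtain ⟨s, hs1, hs2, hs3⟩ := (((hRφ t φ).eventually (hU.mem_nhds hm)).and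
        (h1.and self_mem_nhdsWithin)).exists
      exact ⟨s, le_of_lt hs3, hs2, hs1⟩
  have hxO : ∀ i k, UpOsc (fun t => Function.rightLim g t (d i)) (δ i k) (1 / (k + 1)) := by
    intro i k t₁ t t₂ h1 h2 h3
    have hk : (0 : ℝ) < 1 / (k + 1) := Nat.one_div_pos_of_nat
    by_contra! hlt
    have h1' : t₁ < t := h1.lt_of_ne fun h => by
      subst h
      linarith [le_max_left (Function.rightLim g t₁ (d i)) (Function.rightLim g t₂ (d i))]
    have h2' : t < t₂ := h2.lt_of_ne fun h => by
      subst h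
      linarith [le_max_right (Function.rightLim g t₁ (d i)) (Function.rightLim g t (d i))]
    obtain ⟨c, hc1, hc2⟩ := exists_between hlt
    have hm := max_lt_iff.1 (show max (Function.rightLim g t₁ (d i)) (Function.rightLim g t₂ (d i)) <
      c - 1 / (k + 1 : ℝ) by linarith)
    obtain ⟨s₁, a1, a2, a3⟩ := near t₁ (d i) _ isOpen_Iio hm.1 t h1'
    obtain ⟨s, b1, b2, b3⟩ := near t (d i) _ isOpen_Ioi hc2 t₂ h2'
    obtain ⟨s₂, c1, c2, c3⟩ := near t₂ (d i) _ isOpen_Iio hm.2 (t₁ + δ i k) h3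
    have a1' : (t₁ : ℝ) ≤ s₁ := a1
    have := hgO i k s₁ s s₂ (le_trans (le_of_lt a2) b1) (le_trans (le_of_lt b2) c1) (by linarith)
    have := max_lt (mem_Iio.1 a3) (mem_Iio.1 c3)
    have : c < g s (d i) := b3
    linarith
  -- Without the bound at the start, a jump could move to time 0 in the limit, where x(0-) = x(0)
  -- does not allow one. The one-sided inequality on a dense set of directions gives equality
  -- through a degenerate segment.
  have hx0 : ∀ o : Icc (0 : ℝ) T, (o : ℝ) = 0 → Function.rightLim g o = g o := by
    intro o ho
    obtain ⟨θ, -, e⟩ := exists_mem_segment_of_forall_le (a := Function.rightLim g o) (b := g o)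
      (c := g o) hd (by
        rintro _ ⟨i, rfl⟩
        rw [max_self]
        refine le_of_forall_pos_lt_add fun ε hε => ?_
        by_contra! hlt
        obtain ⟨k, hk⟩ := exists_nat_one_div_lt (half_pos hε)
        obtain ⟨s, -, h2, h3⟩ := near o (d i) (Ioi (g o (d i) + ε / 2)) isOpen_Ioi
          (show g o (d i) + ε / 2 < Function.rightLim g o (d i) by linarith) (δ i k) (by rw [ho]; exact hδ i k)
        have h3 : g o (d i) + ε / 2 < g s (d i) := h3
        have := hgS i k o s ho h2
        linarith)
    rw [e, ← add_smul, sub_add_cancel, one_smul]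
  have hxS : ∀ i k, UpStart (fun t => Function.rightLim g t (d i)) (δ i k) (1 / (k + 1)) := by
    intro i k o t ho ht
    by_contra! hlt
    obtain ⟨s, -, h2, h3⟩ := near t (d i) _ isOpen_Ioi hlt (δ i k) ht
    have := hgS i k o s ho h2
    rw [hx0 o ho] at h3
    exact absurd h3 (not_lt.2 this)
  let x : CadlagPath T (StrongDual ℝ E) :=
    { toFun := Function.rightLim g
      right_cont := fun t => continuousWithinAt_rightLim_Ici (hR t)
      left_lim := fun t _ => exists_tendsto_of_upOsc hB hd hδ hRB hxO (alternate_nhdsLT t) }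
  have hxC : x ∈ oscSet T B d δ := ⟨hRB, fun i k => ⟨hxO i k, hxS i k⟩⟩
  refine ⟨x, hxC, ?_⟩
  let S : Set (Icc (0 : ℝ) T) := {t | g t = Function.rightLim g t}
  have hSd : Dense S := by
    refine dense_of_countable_compl hT ?_
    refine (countable_iUnion fun i => countable_setOf_rightLimit_ne fun t => g t (d i)).mono
      fun t ht => ?_
    have hne : (𝓝[>] t).NeBot := ⟨fun h => ht (hRbot t h).symm⟩
    by_contra hcon
    refine ht ?_
    ext φ
    refine congrFun (Continuous.ext_on hd (g t).continuous (Function.rightLim g t).continuous ?_) φ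
    rintro _ ⟨i, rfl⟩
    by_contra hi
    exact hcon (mem_iUnion.2 ⟨i, _, hne, hRφ t (d i), fun h => hi h.symm⟩)
  refine le_nhds_iff.2 fun U hxU hU => ?_
  obtain ⟨J, ε, hε, hJ⟩ := (isOpen_iff_dual U).1 hU x hxU
  refine mem_of_superset ?_ hJ
  have hall : ∀ b ∈ J, ∀ᶠ y in (F : Filter (CadlagPath T (StrongDual ℝ E))),
      m1Dist (dualSeminorm (b : Set E)) y x < ε := by
    intro b _
    obtain ⟨q, hq, hqb⟩ := exists_seminorm_dualSeminorm b.2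
    obtain ⟨ε', hε', hlt⟩ : ∃ ε' : ℝ, 0 < ε' ∧ ENNReal.ofReal (9 * ε') < ε := by
      obtain ⟨r, hr0, hr⟩ := ENNReal.lt_iff_exists_real_btwn.1 hε
      refine ⟨r / 9, ?_, ?_⟩
      · have := ENNReal.ofReal_pos.1 hr.1
        linarith
      · rw [mul_div_cancel₀ _ (by norm_num)]
        exact hr.2
    obtain ⟨P, hPS, hP⟩ := exists_finset_m1Dist_le hd hB hBc (C := oscSet T B d δ)
      (fun x hx => hx.1)
      (by
        rintro _ ⟨i, rfl⟩ η hη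
        obtain ⟨k, hk⟩ := exists_nat_one_div_lt hη
        exact ⟨δ i k, hδ i k, fun x hx => ((hx.2 i k).1).mono le_rfl hk.le⟩)
      (fun x hx => paramReps_nonempty hT hB hBc hx.1) hq hqb hSd (fun t ht => (hx0 t ht).symm)
      (fun t ht => by
        refine (hRbot t ?_).symm
        have : Ioi t = ∅ := by
          ext s
          simp only [mem_Ioi, mem_empty_iff_false, iff_false, not_lt]
          exact Subtype.coe_le_coe.1 (s.2.2.trans ht.ge)
        rw [this, nhdsWithin_empty]) hT hε'
    have hev : ∀ᶠ y in (F : Filter (CadlagPath T (StrongDual ℝ E))),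
        ∀ t ∈ P, q (y.toFun t - x.toFun t) ≤ ε' := by
      refine (P.eventually_all).2 fun t ht => ?_
      have h1 : Tendsto (fun y : CadlagPath T (StrongDual ℝ E) => q (y.toFun t - x.toFun t)) F
          (𝓝 (q (g t - x.toFun t))) := (hq.tendsto _).comp ((hg t).sub_const _)
      have h2 : g t - x.toFun t = 0 := sub_eq_zero.2 (hPS ht)
      rw [h2, map_zero] at h1
      exact (h1.eventually_lt_const hε').mono fun y hy => hy.le
    filter_upwards [hFC, hev] with y hy hyP
    exact (hP x hxC y hy hyP).trans_lt hlt
  exact (J.eventually_all).2 hall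

end Dual

end CadlagPath

/-! ### Countably Hilbertian nuclear spaces -/

theorem norm_toHilbertCompletion {E : Type*} [AddCommGroup E] [Module ℝ E]
    (c : PreInnerProductSpace.Core ℝ E) (x : E) :
    ‖toHilbertCompletion c x‖ = hilbertianSeminorm c x :=
  UniformSpace.Completion.norm_coe _

/-- The canonical map to the completion as a linear map. -/
def toHilbertCompletionₗ {E : Type*} [AddCommGroup E] [Module ℝ E]
    (c : PreInnerProductSpace.Core ℝ E) : E →ₗ[ℝ] HilbertCompletion c where
  toFun := toHilbertCompletion c
  map_add' x y := UniformSpace.Completion.coe_add (toHilbertianSpace c x) (toHilbertianSpace c y)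
  map_smul' r x := UniformSpace.Completion.coe_smul r (toHilbertianSpace c x)

/-- A vector in the span of orthogonal unit or zero vectors is the sum of its projections. -/
theorem sum_inner_smul_eq_of_mem_span {H : Type*} [NormedAddCommGroup H] [InnerProductSpace ℝ H]
    {G : ℕ → H} (hG : Orthonormal ℝ fun i : {i | G i ≠ 0} => G i) {n : ℕ} {v : H}
    (hv : v ∈ Submodule.span ℝ (G '' Iic n)) :
    ∑ j ∈ Finset.Iic n, inner ℝ (G j) v • G j = v := by
  induction hv using Submodule.span_induction with
  | mem x hx =>
    obtain ⟨l, hl, rfl⟩ := hx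
    by_cases h0 : G l = 0
    · simp [h0]
    · rw [Finset.sum_eq_single l]
      · have := hG.1 ⟨l, h0⟩
        simp only at this
        rw [real_inner_self_eq_norm_sq, this, one_pow, one_smul]
      · intro j _ hj
        by_cases hj0 : G j = 0
        · simp [hj0]
        · have := hG.2 (i := ⟨j, hj0⟩) (j := ⟨l, h0⟩) (by simpa using hj)
          simp only at this
          rw [this, zero_smul]
      · intro h
        exact absurd (Finset.mem_Iic.2 hl) h
  | zero => simp
  | add x y _ _ hx hy =>
    simp only [inner_add_right, add_smul, Finset.sum_add_distrib]
    rw [hx, hy]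
  | smul a x _ hx =>
    simp only [inner_smul_right, mul_smul, ← Finset.smul_sum]
    rw [hx]

/-- Gram–Schmidt may produce zero vectors, whereas nuclearity speaks of infinite orthonormal
sequences: either only finitely many vectors are nonzero, or the nonzero ones are enumerated. -/
theorem summable_of_orthonormal_ne_zero {H : Type*} [NormedAddCommGroup H] [InnerProductSpace ℝ H]
    {G : ℕ → H} (hG : Orthonormal ℝ fun i : {i | G i ≠ 0} => G i) {F : H → ℝ} (hF0 : F 0 = 0)
    (hF : ∀ e : ℕ → H, Orthonormal ℝ e → Summable fun i => F (e i)) :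
    Summable fun i => F (G i) := by
  by_cases hfin : {i | G i ≠ 0}.Finite
  · refine summable_of_hasFiniteSupport (hfin.subset fun i hi h => hi ?_)
    simp only [h, hF0]
  · have : Infinite {i | G i ≠ 0} := infinite_coe_iff.2 hfin
    let o := Nat.Subtype.orderIsoOfNat {i | G i ≠ 0}
    have h1 := hF (fun n => G (o n)) (hG.comp o o.injective)
    refine (Function.Injective.summable_iff (g := fun n => (o n : ℕ))
      (Subtype.val_injective.comp o.injective) fun i hi => ?_).1 h1
    by_contra h
    have h0 : i ∈ {i | G i ≠ 0} := fun h0 => h (by rw [h0, hF0])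
    exact hi ⟨o.symm ⟨i, h0⟩, by simp⟩

namespace CountablyHilbertianNuclear

variable {E : Type*} [AddCommGroup E] [Module ℝ E] [TopologicalSpace E]

/-- The seminorms of a countably Hilbertian nuclear space. -/
abbrev seminorm (hE : CountablyHilbertianNuclear E) (n : ℕ) : Seminorm ℝ E :=
  hilbertianSeminorm (hE.form n)

theorem continuous_seminorm (hE : CountablyHilbertianNuclear E) (n : ℕ) :
    Continuous (hE.seminorm n) :=
  hE.withSeminorms.continuous_seminorm n

theorem exists_seminorm_ball_subset (hE : CountablyHilbertianNuclear E) {x : E} {U : Set E}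
    (hU : U ∈ 𝓝 x) : ∃ n, ∃ r > 0, ∀ y, hE.seminorm n (y - x) < r → y ∈ U := by
  obtain ⟨s, r, hr, h⟩ := (hE.withSeminorms.mem_nhds_iff x U).1 hU
  refine ⟨s.sup id, r, hr, fun y hy => h ?_⟩
  rw [Seminorm.mem_ball]
  refine lt_of_le_of_lt ?_ hy
  have : s.sup (fun n => hilbertianSeminorm (hE.form n)) ≤ hE.seminorm (s.sup id) :=
    Finset.sup_le fun i hi => hE.mono (Finset.le_sup (f := id) hi)
  exact this _

/-- The image is cut out by the closed compatibility relations. Hence `E` is Polish, which supplies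
both Baire's theorem and countable dense sets. -/
theorem isClosedEmbedding (hE : CountablyHilbertianNuclear E) [IsTopologicalAddGroup E] :
    IsClosedEmbedding fun (x : E) (n : ℕ) => toHilbertCompletion (hE.form n) x := by
  have hcont : ∀ n, Continuous fun x : E => toHilbertCompletion (hE.form n) x := fun n => by
    refine continuous_iff_continuousAt.2 fun x => tendsto_iff_norm_sub_tendsto_zero.2 ?_
    have h1 : Tendsto (fun y => hE.seminorm n (y - x)) (𝓝 x) (𝓝 (hE.seminorm n (x - x))) :=
      ((hE.continuous_seminorm n).comp (continuous_id.sub continuous_const)).tendsto x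
    rw [sub_self, map_zero] at h1
    refine h1.congr fun y => ?_
    rw [← norm_toHilbertCompletion]
    exact congrArg norm (map_sub (toHilbertCompletionₗ (hE.form n)) y x)
  have hinj : Function.Injective fun (x : E) (n : ℕ) => toHilbertCompletion (hE.form n) x := by
    intro x y hxy
    obtain ⟨z, -, hz⟩ := hE.inter_eq (fun n => toHilbertCompletion (hE.form n) x)
      fun n m hnm => canonicalMap_toHilbertCompletion (hE.mono hnm) x
    exact (hz x fun n => rfl).trans (hz y fun n => (congrFun hxy n).symm).symm
  refine ⟨⟨isInducing_iff_nhds.2 fun x => le_antisymm ?_ ?_, hinj⟩, ?_⟩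
  · exact (continuous_pi hcont).continuousAt.le_comap
  · intro U hU
    obtain ⟨n, r, hr, h⟩ := hE.exists_seminorm_ball_subset hU
    refine mem_comap.2 ⟨{ξ | ξ n ∈ Metric.ball (toHilbertCompletion (hE.form n) x) r},
      (continuous_apply n).continuousAt.preimage_mem_nhds (Metric.ball_mem_nhds _ hr),
      fun y hy => h y ?_⟩
    have hy' := mem_ball_iff_norm.1 (show _ ∈ Metric.ball _ _ from hy)
    rw [← norm_toHilbertCompletion]
    refine lt_of_eq_of_lt ?_ hy'
    exact congrArg norm (map_sub (toHilbertCompletionₗ (hE.form n)) y x)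
  · have : (range fun (x : E) (n : ℕ) => toHilbertCompletion (hE.form n) x) =
        ⋂ (n) (m) (_ : n ≤ m), {ξ | canonicalMap (hE.form m) (hE.form n) (ξ m) = ξ n} := by
      ext ξ
      simp only [mem_iInter, mem_range]
      constructor
      · rintro ⟨x, rfl⟩ n m hnm
        exact canonicalMap_toHilbertCompletion (hE.mono hnm) x
      · intro h
        obtain ⟨x, hx, -⟩ := hE.inter_eq ξ h
        exact ⟨x, funext hx⟩
    rw [this]
    refine isClosed_iInter fun n => isClosed_iInter fun m => isClosed_iInter fun _ =>
      isClosed_eq ?_ (continuous_apply n)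
    exact UniformSpace.Completion.continuous_map.comp (continuous_apply m)

theorem polishSpace (hE : CountablyHilbertianNuclear E) [IsTopologicalAddGroup E] :
    PolishSpace E := by
  have := hE.separable
  have : ∀ n, PolishSpace (HilbertCompletion (hE.form n)) := fun n => inferInstance
  exact hE.isClosedEmbedding.polishSpace

/-- For every seminorm there are vectors, square summable in it, that control the dual norm of a
stronger seminorm. -/
theorem exists_summable_controlling [IsTopologicalAddGroup E]
    (hE : CountablyHilbertianNuclear E) (m : ℕ) :
    ∃ (k : ℕ) (h : ℕ → E), m < k ∧ (Summable fun j => hE.seminorm m (h j) ^ 2) ∧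
      ∀ (f : StrongDual ℝ E) (M : ℝ), 0 ≤ M → (∀ J, ∑ j ∈ Finset.range J, f (h j) ^ 2 ≤ M ^ 2) →
        ∀ φ, |f φ| ≤ M * hE.seminorm k φ := by
  have := hE.polishSpace
  obtain ⟨k, hmk, hnuc⟩ := hE.nuclear m
  obtain ⟨d, hd⟩ := TopologicalSpace.exists_dense_seq E
  let ι := toHilbertCompletionₗ (hE.form k)
  -- Gram–Schmidt on the images of a dense sequence of `E` stays in their algebraic span, so its
  -- vectors lift to `E`.
  let G : ℕ → HilbertCompletion (hE.form k) := InnerProductSpace.gramSchmidtNormed ℝ (ι ∘ d)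
  have hG : Orthonormal ℝ fun i : {i | G i ≠ 0} => G i :=
    InnerProductSpace.gramSchmidtNormed_orthonormal' _
  have hspan : ∀ n, Submodule.span ℝ (G '' Iic n) = Submodule.span ℝ ((ι ∘ d) '' Iic n) := fun n =>
    (InnerProductSpace.span_gramSchmidtNormed _ _).trans
      (InnerProductSpace.span_gramSchmidt_Iic ℝ _ n)
  have hlift : ∀ j, ∃ e, ι e = G j := fun j => by
    have h1 : G j ∈ Submodule.span ℝ ((ι ∘ d) '' Iic j) :=
      hspan j ▸ Submodule.subset_span (mem_image_of_mem G self_mem_Iic)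
    have h2 : Submodule.span ℝ ((ι ∘ d) '' Iic j) ≤ LinearMap.range ι := by
      rw [Submodule.span_le]
      rintro _ ⟨i, -, rfl⟩
      exact ⟨d i, rfl⟩
    exact h2 h1
  choose e he using hlift
  -- These vectors are null for the k-th seminorm, but `f` is not yet known to vanish on them. All
  -- their integer multiples are put into the family: they add nothing to the sum, and a bound on
  -- `f` along all multiples forces `f (κ i) = 0`.
  let κ : ℕ → E := fun i => d i - ∑ j ∈ Finset.Iic i, inner ℝ (G j) (ι (d i)) • e j
  have hexp : ∀ i, ∑ j ∈ Finset.Iic i, inner ℝ (G j) (ι (d i)) • G j = ι (d i) := fun i =>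
    sum_inner_smul_eq_of_mem_span hG
      (hspan i ▸ Submodule.subset_span ⟨i, self_mem_Iic, rfl⟩)
  have hκ : ∀ i, ι (κ i) = 0 := fun i => by
    simp only [κ, map_sub, map_sum, map_smul, he]
    rw [hexp, sub_self]
  have hnorm : ∀ φ, ‖ι φ‖ = hE.seminorm k φ := norm_toHilbertCompletion _
  let h₀ : ℕ ⊕ (ℕ × ℕ) → E := Sum.elim e fun ic => (ic.2 : ℝ) • κ ic.1
  obtain ⟨η⟩ : Nonempty (ℕ ≃ ℕ ⊕ (ℕ × ℕ)) := ⟨(Denumerable.eqv _).symm⟩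
  refine ⟨k, h₀ ∘ η, hmk, ?_, fun f M hM hf => ?_⟩
  · have h1 : Summable fun j => hE.seminorm m (e j) ^ 2 := by
      have := summable_of_orthonormal_ne_zero hG
        (F := fun v => ‖canonicalMap (hE.form k) (hE.form m) v‖ ^ 2) (by
          have h0 := canonicalMap_toHilbertCompletion (hE.mono hmk.le) (0 : E)
          have h1 : toHilbertCompletion (hE.form k) (0 : E) = 0 := map_zero ι
          have h2 : toHilbertCompletion (hE.form m) (0 : E) = 0 :=
            map_zero (toHilbertCompletionₗ (hE.form m))
          rw [h1, h2] at h0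
          simp [h0]) hnuc
      refine this.congr fun j => ?_
      rw [← he j]
      have h0 := canonicalMap_toHilbertCompletion (hE.mono hmk.le) (e j)
      rw [← norm_toHilbertCompletion, ← h0]
      rfl
    have h2 : Summable fun s => hE.seminorm m (h₀ s) ^ 2 := by
      refine Summable.sum _ h1 ?_
      refine summable_zero.congr fun ic => ?_
      have h3 : hE.seminorm m (κ ic.1) ≤ 0 := by
        refine (hE.mono hmk.le (κ ic.1)).trans ?_
        rw [← hnorm, hκ, norm_zero]
      have h4 : hE.seminorm m (κ ic.1) = 0 := le_antisymm h3 (apply_nonneg _ _)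
      simp [h₀, map_smul_eq_mul, h4]
    exact h2.comp_injective η.injective
  · have hfin : ∀ s : Finset (ℕ ⊕ (ℕ × ℕ)), ∑ j ∈ s, f (h₀ j) ^ 2 ≤ M ^ 2 := fun s => by
      have h1 : ∑ j ∈ s, f (h₀ j) ^ 2 = ∑ j ∈ s.map η.symm.toEmbedding, f ((h₀ ∘ η) j) ^ 2 := by
        rw [Finset.sum_map]
        simp
      rw [h1]
      obtain ⟨J, hJ⟩ := (s.map η.symm.toEmbedding).exists_nat_subset_range
      exact (Finset.sum_le_sum_of_subset_of_nonneg hJ fun _ _ _ => sq_nonneg _).trans (hf J)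
    have hfκ : ∀ i, f (κ i) = 0 := fun i => by
      by_contra hne
      obtain ⟨c, hc⟩ := exists_nat_gt (M / |f (κ i)|)
      rw [div_lt_iff₀ (abs_pos.2 hne)] at hc
      have := hfin {Sum.inr (i, c)}
      simp only [Finset.sum_singleton, h₀, Sum.elim_inr, map_smul, smul_eq_mul] at this
      have h2 := abs_le_of_sq_le_sq this hM
      have h3 : |(c : ℝ) * f (κ i)| = c * |f (κ i)| := by
        rw [abs_mul, abs_of_nonneg (Nat.cast_nonneg c)]
      linarith
    -- Once `f` vanishes on `κ i`, Cauchy–Schwarz applies to the orthonormal expansion of `d i`.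
    have hfd : ∀ i, |f (d i)| ≤ M * hE.seminorm k (d i) := fun i => by
      have h1 : f (d i) = ∑ j ∈ Finset.Iic i, inner ℝ (G j) (ι (d i)) * f (e j) := by
        have := hfκ i
        simp only [κ, map_sub, map_sum, map_smul, smul_eq_mul] at this
        exact sub_eq_zero.1 this
      have h2 : ∑ j ∈ Finset.Iic i, inner ℝ (G j) (ι (d i)) ^ 2 = hE.seminorm k (d i) ^ 2 := by
        rw [← hnorm, ← real_inner_self_eq_norm_sq]
        nth_rw 3 [← hexp i]
        rw [inner_sum]
        refine Finset.sum_congr rfl fun j _ => ?_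
        rw [real_inner_smul_right, real_inner_comm (G j), sq]
      have h3 : ∑ j ∈ Finset.Iic i, f (e j) ^ 2 ≤ M ^ 2 := by
        have := hfin ((Finset.Iic i).map Function.Embedding.inl)
        simpa [h₀] using this
      have h4 := Finset.sum_mul_sq_le_sq_mul_sq (Finset.Iic i)
        (fun j => inner ℝ (G j) (ι (d i))) fun j => f (e j)
      rw [← h1, h2] at h4
      refine abs_le_of_sq_le_sq ?_ (mul_nonneg hM (apply_nonneg _ _))
      rw [mul_pow, mul_comm]
      exact h4.trans (mul_le_mul_of_nonneg_left h3 (sq_nonneg _))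
    intro φ
    exact hd.induction_on (p := fun φ => |f φ| ≤ M * hE.seminorm k φ) φ
      (isClosed_le f.continuous.abs (continuous_const.mul (hE.continuous_seminorm k))) hfd

/-- The polar-type ball `{f | ∀ φ, |f φ| ≤ M ‖φ‖ₙ}` of the dual. -/
def dualBall (hE : CountablyHilbertianNuclear E) (n : ℕ) (M : ℝ) : Set (StrongDual ℝ E) :=
  {f | ∀ φ, |f φ| ≤ M * hE.seminorm n φ}

theorem convex_dualBall (hE : CountablyHilbertianNuclear E) (n : ℕ) (M : ℝ) :
    Convex ℝ (hE.dualBall n M) := by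
  intro f hf g hg a b ha hb hab φ
  have h1 := abs_add_le (a * f φ) (b * g φ)
  rw [abs_mul, abs_mul, abs_of_nonneg ha, abs_of_nonneg hb] at h1
  have h2 := mul_le_mul_of_nonneg_left (hf φ) ha
  have h3 := mul_le_mul_of_nonneg_left (hg φ) hb
  change |a * f φ + b * g φ| ≤ _
  have h4 : a * (M * hE.seminorm n φ) + b * (M * hE.seminorm n φ) = M * hE.seminorm n φ := by
    rw [← add_mul, hab, one_mul]
  linarith

/-- Pointwise limits along an ultrafilter exist by boundedness and remain in the ball. Convergence
is strong because a stronger dual norm is controlled by the sum of (f - g)(h_j)²: its tail is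
uniformly small by square summability, its head by pointwise convergence. -/
theorem isCompact_dualBall [IsTopologicalAddGroup E] (hE : CountablyHilbertianNuclear E) (n : ℕ)
    (M : ℝ) : IsCompact (hE.dualBall n M) := by
  refine isCompact_iff_ultrafilter_le_nhds.2 fun F hF => ?_
  have hFB : ∀ᶠ f in (F : Filter (StrongDual ℝ E)), f ∈ hE.dualBall n M := le_principal_iff.1 hF
  have hex : ∀ φ, ∃ l ∈ Icc (-(M * hE.seminorm n φ)) (M * hE.seminorm n φ),
      Tendsto (fun f : StrongDual ℝ E => f φ) F (𝓝 l) := fun φ =>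
    isCompact_Icc.ultrafilter_le_nhds (F.map fun f : StrongDual ℝ E => f φ)
      (tendsto_principal.2 (hFB.mono fun f hf => abs_le.1 (hf φ)))
  choose g hgB hg using hex
  let gl : E →ₗ[ℝ] ℝ :=
    { toFun := g
      map_add' := fun φ ψ => tendsto_nhds_unique (hg (φ + ψ))
        (((hg φ).add (hg ψ)).congr fun f => (map_add f φ ψ).symm)
      map_smul' := fun r φ => tendsto_nhds_unique (hg (r • φ))
        (((hg φ).const_mul r).congr fun f => (map_smul f r φ).symm) }
  have hgc : Continuous gl := by
    refine continuous_of_continuousAt_zero gl ?_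
    have h1 : Tendsto (fun φ => M * hE.seminorm n φ) (𝓝 0) (𝓝 0) := by
      have := ((hE.continuous_seminorm n).const_mul M).tendsto 0
      simpa using this
    rw [ContinuousAt, map_zero]
    exact squeeze_zero_norm (fun φ => abs_le.2 (hgB φ)) h1
  let g' : StrongDual ℝ E := ⟨gl, hgc⟩
  refine ⟨g', fun φ => abs_le.2 (hgB φ), ?_⟩
  obtain ⟨k, h, -, hsum, hctrl⟩ := hE.exists_summable_controlling n
  suffices hlim : Tendsto (fun f : StrongDual ℝ E => f - g') F (𝓝 0) by
    exact tendsto_sub_nhds_zero_iff.1 hlim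
  refine (ContinuousLinearMap.hasBasis_nhds_zero (𝕜₁ := ℝ) (𝕜₂ := ℝ)
    (σ := RingHom.id ℝ)).tendsto_right_iff.2 ?_
  rintro ⟨S, U⟩ ⟨hS, hU⟩
  obtain ⟨ε, hε, hεU⟩ := Metric.mem_nhds_iff.1 hU
  obtain ⟨R, hR, hSR⟩ := (hE.withSeminorms.isVonNBounded_iff_seminorm_bounded).1 hS k
  -- The seminorm k is below `R` on the bounded set `S`, so dual norm η gives values below ηR = ε.
  set η := ε / R with hη
  have hη0 : 0 < η := div_pos hε hR
  have htail := (tendsto_sum_nat_add fun j => 4 * M ^ 2 * hE.seminorm n (h j) ^ 2)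
  obtain ⟨J, hJ⟩ := (htail.eventually_lt_const (show (0 : ℝ) < η ^ 2 / 2 by positivity)).exists
  have hhead : Tendsto (fun f : StrongDual ℝ E => ∑ j ∈ Finset.range J, ((f - g') (h j)) ^ 2) F
      (𝓝 0) := by
    have : Tendsto (fun f : StrongDual ℝ E => ∑ j ∈ Finset.range J, ((f - g') (h j)) ^ 2) F
        (𝓝 (∑ j ∈ Finset.range J, (g (h j) - g (h j)) ^ 2)) :=
      tendsto_finsetSum _ fun j _ => ((hg (h j)).sub_const (g (h j))).pow 2
    simpa using this
  filter_upwards [hFB, hhead.eventually_lt_const (show (0 : ℝ) < η ^ 2 / 2 by positivity)]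
    with f hf hfh φ hφ
  have hs4 : Summable fun j => 4 * M ^ 2 * hE.seminorm n (h j) ^ 2 := hsum.mul_left _
  have hsq : ∀ j, (f - g') (h j) ^ 2 ≤ 4 * M ^ 2 * hE.seminorm n (h j) ^ 2 := fun j => by
    have h2 := abs_le.1 (hf (h j))
    have h3 := hgB (h j)
    have h4 : |(f - g') (h j)| ≤ 2 * M * hE.seminorm n (h j) := by
      change |f (h j) - g (h j)| ≤ _
      exact abs_le.2 ⟨by linarith [h2.1, h3.2], by linarith [h2.2, h3.1]⟩
    calc (f - g') (h j) ^ 2 = |(f - g') (h j)| ^ 2 := (sq_abs _).symm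
      _ ≤ (2 * M * hE.seminorm n (h j)) ^ 2 := pow_le_pow_left₀ (abs_nonneg _) h4 2
      _ = _ := by ring
  have hall : ∀ L, ∑ j ∈ Finset.range L, (f - g') (h j) ^ 2 ≤ η ^ 2 := fun L => by
    have h1 : ∑ j ∈ Finset.range L, (f - g') (h j) ^ 2 ≤
        ∑ j ∈ Finset.range (J + L), (f - g') (h j) ^ 2 :=
      Finset.sum_le_sum_of_subset_of_nonneg
        (Finset.range_subset_range.2 (Nat.le_add_left L J)) fun _ _ _ => sq_nonneg _
    rw [Finset.sum_range_add] at h1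
    have h2 : ∑ j ∈ Finset.range L, (f - g') (h (J + j)) ^ 2 ≤
        ∑' j, 4 * M ^ 2 * hE.seminorm n (h (j + J)) ^ 2 := by
      refine (Finset.sum_le_sum fun j _ => ?_).trans
        (((summable_nat_add_iff J).2 hs4).sum_le_tsum (Finset.range L) fun j _ => by positivity)
      rw [add_comm J j]
      exact hsq _
    linarith
  refine hεU (mem_ball_zero_iff.2 ?_)
  rw [Real.norm_eq_abs]
  calc |(f - g') φ| ≤ η * hE.seminorm k φ := hctrl _ η hη0.le hall φ
    _ < η * R := mul_lt_mul_of_pos_left (hSR φ hφ) hη0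
    _ = ε := div_mul_cancel₀ _ hR.ne'

end CountablyHilbertianNuclear

/-! ### Sums over signs -/

section SignSum

variable {E : Type*} [AddCommGroup E]

/-- The sum of `F (φ ± e₁ ± ⋯ ± eₗ)` over all choices of signs. -/
def signSum {M : Type*} [Add M] (F : E → M) : List E → E → M
  | [], φ => F φ
  | e :: l, φ => signSum F l (φ + e) + signSum F l (φ - e)

/-- The cross terms of a quadratic form cancel when averaged over signs. -/
theorem signSum_eq_of_parallelogram {Q : E → ℝ}
    (hQ : ∀ x y, Q (x + y) + Q (x - y) = 2 * Q x + 2 * Q y) (l : List E) (φ : E) :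
    signSum Q l φ = 2 ^ l.length * (Q φ + (l.map Q).sum) := by
  induction l generalizing φ with
  | nil => simp [signSum]
  | cons e l ih =>
    rw [signSum, ih, ih, List.length_cons, List.map_cons, List.sum_cons, pow_succ]
    linear_combination (2 : ℝ) ^ l.length * hQ φ e

/-- The fourth moment of a Rademacher sum is at most three times its squared variance. In the
induction the two sides differ by a multiple of f(e)⁴. -/
theorem signSum_pow_four_le (f : E →+ ℝ) (l : List E) (φ : E) :
    signSum (fun ψ => f ψ ^ 4) l φ ≤ 2 ^ l.length * (f φ ^ 4 +
      6 * f φ ^ 2 * (l.map fun e => f e ^ 2).sum + 3 * (l.map fun e => f e ^ 2).sum ^ 2) := by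
  induction l generalizing φ with
  | nil => simp [signSum]
  | cons e l ih =>
    rw [signSum, List.length_cons, List.map_cons, List.sum_cons, pow_succ]
    refine (add_le_add (ih _) (ih _)).trans ?_
    rw [map_add, map_sub]
    have h : 0 ≤ (2 : ℝ) ^ l.length * (4 * f e ^ 4) := by positivity
    linarith

theorem signSum_mono {M : Type*} [Add M] [Preorder M] [AddLeftMono M] [AddRightMono M]
    {F G : E → M} (h : ∀ ψ, F ψ ≤ G ψ) (l : List E) (φ : E) :
    signSum F l φ ≤ signSum G l φ := by
  induction l generalizing φ with
  | nil => exact h φ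
  | cons e l ih => exact add_le_add (ih _) (ih _)

theorem signSum_add {M : Type*} [AddCommSemigroup M] (F G : E → M) (l : List E) (φ : E) :
    signSum (fun ψ => F ψ + G ψ) l φ = signSum F l φ + signSum G l φ := by
  induction l generalizing φ with
  | nil => rfl
  | cons e l ih => simp only [signSum, ih]; exact add_add_add_comm _ _ _ _

theorem signSum_const_mul {M : Type*} [Distrib M] (c : M) (F : E → M) (l : List E) (φ : E) :
    signSum (fun ψ => c * F ψ) l φ = c * signSum F l φ := by
  induction l generalizing φ with
  | nil => rfl
  | cons e l ih => simp only [signSum, ih, mul_add]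

theorem signSum_const {M : Type*} [CommSemiring M] (c : M) (l : List E) (φ : E) :
    signSum (fun _ => c) l φ = 2 ^ l.length * c := by
  induction l generalizing φ with
  | nil => simp [signSum]
  | cons e l ih => simp only [signSum, ih, List.length_cons]; ring

theorem signSum_nonneg {F : E → ℝ} (h : ∀ ψ, 0 ≤ F ψ) (l : List E) (φ : E) :
    0 ≤ signSum F l φ := by
  induction l generalizing φ with
  | nil => exact h φ
  | cons e l ih => exact add_nonneg (ih _) (ih _)

theorem signSum_ofReal {F : E → ℝ} (h : ∀ ψ, 0 ≤ F ψ) (l : List E) (φ : E) :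
    signSum (fun ψ => ENNReal.ofReal (F ψ)) l φ = ENNReal.ofReal (signSum F l φ) := by
  induction l generalizing φ with
  | nil => rfl
  | cons e l ih =>
    simp only [signSum, ih]
    rw [ENNReal.ofReal_add (signSum_nonneg h _ _) (signSum_nonneg h _ _)]

theorem measurable_signSum {Ω : Type*} [MeasurableSpace Ω] {F : E → Ω → ℝ≥0∞}
    (hF : ∀ ψ, Measurable (F ψ)) (l : List E) (φ : E) :
    Measurable fun x => signSum (fun ψ => F ψ x) l φ := by
  induction l generalizing φ with
  | nil => exact hF φ
  | cons e l ih => exact (ih _).add (ih _)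

theorem lintegral_signSum {Ω : Type*} [MeasurableSpace Ω] (μ : Measure Ω) {F : E → Ω → ℝ≥0∞}
    (hF : ∀ ψ, Measurable (F ψ)) (l : List E) (φ : E) :
    ∫⁻ x, signSum (fun ψ => F ψ x) l φ ∂μ = signSum (fun ψ => ∫⁻ x, F ψ x ∂μ) l φ := by
  induction l generalizing φ with
  | nil => rfl
  | cons e l ih =>
    simp only [signSum]
    rw [lintegral_add_left (measurable_signSum hF _ _), ih, ih]

/-- A Khinchin type lower bound: if the variance is not small, then neither is the truncated
first moment. -/
theorem third_le_signSum_min_abs (f : E →+ ℝ) (l : List E)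
    (hl : 2 / 3 ≤ (l.map fun e => f e ^ 2).sum) :
    2 ^ l.length * (1 / 3) ≤ signSum (fun ψ => min |f ψ| 1) l 0 := by
  set S := (l.map fun e => f e ^ 2).sum with hS
  have hS0 : 0 < S := by linarith
  -- With `τ * S = 2/3`, the second and fourth moments give 2/3 - (3/4)(2/3)² = 1/3, the best value
  -- of x - 3x²/4.
  set τ := 2 / 3 / S with hτ
  have hτ0 : 0 < τ := by positivity
  have hτ1 : τ ≤ 1 := (div_le_one hS0).2 hl
  have hτS : τ * S = 2 / 3 := div_mul_cancel₀ _ hS0.ne'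
  have h2 : signSum (fun ψ => f ψ ^ 2) l 0 = 2 ^ l.length * S := by
    rw [signSum_eq_of_parallelogram fun x y => by rw [map_add, map_sub]; ring]
    simp [hS]
  have h4 : signSum (fun ψ => f ψ ^ 4) l 0 ≤ 2 ^ l.length * (3 * S ^ 2) := by
    refine (signSum_pow_four_le f l 0).trans_eq ?_
    simp [hS]
  -- For |f ψ| ≤ 1 this uses τ ≤ 1; otherwise it is the square of τ f(ψ)²/2 - 1.
  have hpt : ∀ ψ, τ * f ψ ^ 2 ≤ min |f ψ| 1 + τ ^ 2 / 4 * f ψ ^ 4 := fun ψ => by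
    rcases le_total |f ψ| 1 with h | h
    · rw [min_eq_left h, ← sq_abs]
      have h1 : 0 ≤ |f ψ| := abs_nonneg _
      have h3 : τ * |f ψ| ^ 2 ≤ |f ψ| := by nlinarith
      have : 0 ≤ τ ^ 2 / 4 * f ψ ^ 4 := by positivity
      linarith
    · rw [min_eq_right h]
      nlinarith [sq_nonneg (τ * f ψ ^ 2 / 2 - 1)]
  have h5 := signSum_mono hpt l 0
  rw [signSum_add, signSum_const_mul, signSum_const_mul, h2] at h5
  have h6 := mul_le_mul_of_nonneg_left h4 (show 0 ≤ τ ^ 2 / 4 by positivity)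
  have h7 : τ * (2 ^ l.length * S) = 2 ^ l.length * (2 / 3) := by rw [← hτS]; ring
  have h8 : τ ^ 2 / 4 * (2 ^ l.length * (3 * S ^ 2)) = 2 ^ l.length * (1 / 3) := by
    have : τ ^ 2 * S ^ 2 = 4 / 9 := by rw [← mul_pow, hτS]; norm_num
    linear_combination (2 : ℝ) ^ l.length * (3 / 4) * this
  linarith

end SignSum

/-- A lower semicontinuous, even, subadditive functional that is small at small multiples of every
vector is small near zero. -/
theorem setOf_le_mem_nhds_zero {E : Type*} [AddCommGroup E] [Module ℝ E] [TopologicalSpace E]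
    [IsTopologicalAddGroup E] [ContinuousSMul ℝ E] [BaireSpace E] {W : E → ℝ≥0∞} {ε : ℝ≥0∞}
    (hadd : ∀ φ ψ, W (φ + ψ) ≤ W φ + W ψ) (hneg : ∀ φ, W (-φ) = W φ)
    (hcl : IsClosed {φ | W φ ≤ ε}) (hsmall : ∀ φ, ∃ k : ℕ, W ((k + 1 : ℝ)⁻¹ • φ) ≤ ε) :
    {φ | W φ ≤ ε + ε} ∈ 𝓝 (0 : E) := by
  -- Closed sets indexed by the scaling factor cover `E`, so by Baire one of them has an interior
  -- point.
  obtain ⟨k, φ₀, hφ₀⟩ := nonempty_interior_of_iUnion_of_closed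
    (f := fun k : ℕ => {φ : E | W ((k + 1 : ℝ)⁻¹ • φ) ≤ ε})
    (fun k => hcl.preimage (continuous_const_smul _)) (eq_univ_of_forall fun φ => mem_iUnion.2
      (hsmall φ))
  have hc : Continuous fun ψ : E => φ₀ + (k + 1 : ℝ) • ψ := by fun_prop
  have h0 : φ₀ + (k + 1 : ℝ) • (0 : E) = φ₀ := by simp
  have hk : (k + 1 : ℝ) ≠ 0 := by positivity
  filter_upwards [hc.continuousAt.preimage_mem_nhds
    (show interior _ ∈ 𝓝 (φ₀ + (k + 1 : ℝ) • (0 : E)) by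
      rw [h0]; exact isOpen_interior.mem_nhds hφ₀)] with ψ hψ
  have hsub := interior_subset (s := {φ : E | W ((k + 1 : ℝ)⁻¹ • φ) ≤ ε})
  have h1 : W ((k + 1 : ℝ)⁻¹ • (φ₀ + (k + 1 : ℝ) • ψ)) ≤ ε := hsub hψ
  have h2 : W ((k + 1 : ℝ)⁻¹ • φ₀) ≤ ε := hsub hφ₀
  -- A small `ψ` is a difference of two rescaled points of that set, which costs ε twice.
  have h3 : ψ = (k + 1 : ℝ)⁻¹ • (φ₀ + (k + 1 : ℝ) • ψ) + -((k + 1 : ℝ)⁻¹ • φ₀) := by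
    rw [smul_add, smul_smul, inv_mul_cancel₀ hk, one_smul]
    abel
  calc W ψ ≤ W ((k + 1 : ℝ)⁻¹ • (φ₀ + (k + 1 : ℝ) • ψ)) + W (-((k + 1 : ℝ)⁻¹ • φ₀)) := by
        nth_rw 1 [h3]
        exact hadd _ _
    _ ≤ ε + ε := add_le_add h1 ((hneg _).trans_le h2)

/-! ### Truncated suprema over time and their means -/

namespace CadlagPath

variable {T : ℝ} {E : Type*} [AddCommGroup E] [Module ℝ E] [TopologicalSpace E]

/-- The truncated supremum `min (sup_t |x_t(φ)|) 1`. -/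
def truncSup (φ : E) (x : CadlagPath T (StrongDual ℝ E)) : ℝ≥0∞ :=
  min (⨆ t, ‖x.toFun t φ‖ₑ) 1

theorem truncSup_neg (φ : E) (x : CadlagPath T (StrongDual ℝ E)) :
    truncSup (-φ) x = truncSup φ x := by
  simp only [truncSup, map_neg, enorm_neg]

theorem truncSup_add_le (φ ψ : E) (x : CadlagPath T (StrongDual ℝ E)) :
    truncSup (φ + ψ) x ≤ truncSup φ x + truncSup ψ x := by
  have h : (⨆ t, ‖x.toFun t (φ + ψ)‖ₑ) ≤ (⨆ t, ‖x.toFun t φ‖ₑ) + ⨆ t, ‖x.toFun t ψ‖ₑ :=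
    iSup_le fun t => by
      rw [map_add]
      exact (enorm_add_le _ _).trans (add_le_add (le_iSup (fun t => ‖x.toFun t φ‖ₑ) t)
        (le_iSup (fun t => ‖x.toFun t ψ‖ₑ) t))
  unfold truncSup
  rcases le_total (⨆ t, ‖x.toFun t φ‖ₑ) 1 with h1 | h1
  · rcases le_total (⨆ t, ‖x.toFun t ψ‖ₑ) 1 with h2 | h2
    · rw [min_eq_left h1, min_eq_left h2]
      exact (min_le_left _ _).trans h
    · rw [min_eq_right h2]
      exact (min_le_right _ _).trans le_add_self
  · rw [min_eq_right h1]
    exact (min_le_right _ _).trans le_self_add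

theorem lowerSemicontinuous_truncSup (x : CadlagPath T (StrongDual ℝ E)) :
    LowerSemicontinuous fun φ => truncSup φ x := by
  refine LowerSemicontinuous.inf (lowerSemicontinuous_iSup fun t => ?_)
    lowerSemicontinuous_const
  exact (continuous_enorm.comp (x.toFun t).continuous).lowerSemicontinuous

/-- The supremum of |x_t(φ)| exceeds a level exactly if the path of `φ` or that of `-φ` does at some
time, which is an open condition. -/
theorem measurable_truncSup [ContinuousSMul ℝ E] (φ : E) :
    Measurable (truncSup φ : CadlagPath T (StrongDual ℝ E) → ℝ≥0∞) := by
  refine Measurable.min (measurable_of_Ioi fun c => IsOpen.measurableSet ?_) measurable_const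
  rcases eq_or_ne c ⊤ with rfl | hc
  · simp
  have : (fun x : CadlagPath T (StrongDual ℝ E) => ⨆ t, ‖x.toFun t φ‖ₑ) ⁻¹' Ioi c =
      proj φ ⁻¹' {y | ∃ t, c.toReal < y.toFun t} ∪
        proj (-φ) ⁻¹' {y | ∃ t, c.toReal < y.toFun t} := by
    ext x
    have h : ∀ t, c < ‖x.toFun t φ‖ₑ ↔ c.toReal < x.toFun t φ ∨ c.toReal < x.toFun t (-φ) :=
      fun t => by
        rw [← ofReal_norm, ENNReal.lt_ofReal_iff_toReal_lt hc, Real.norm_eq_abs, lt_abs,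
          map_neg]
    change c < ⨆ t, ‖x.toFun t φ‖ₑ ↔
      (∃ t, c.toReal < x.toFun t φ) ∨ ∃ t, c.toReal < x.toFun t (-φ)
    rw [lt_iSup_iff, ← exists_or]
    exact exists_congr h
  rw [this]
  exact ((isOpen_setOf_exists_lt _).preimage (continuous_proj φ)).union
    ((isOpen_setOf_exists_lt _).preimage (continuous_proj (-φ)))

/-- Fatou's lemma passes lower semicontinuity from each path to the mean. -/
theorem isClosed_setOf_lintegral_truncSup_le [ContinuousSMul ℝ E] [FrechetUrysohnSpace E]
    (μ : Measure (CadlagPath T (StrongDual ℝ E))) (c : ℝ≥0∞) :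
    IsClosed {φ : E | ∫⁻ x, truncSup φ x ∂μ ≤ c} := by
  refine IsSeqClosed.isClosed fun u φ hu hφ => ?_
  calc ∫⁻ x, truncSup φ x ∂μ ≤ ∫⁻ x, liminf (fun i => truncSup (u i) x) atTop ∂μ :=
        lintegral_mono fun x => ((lowerSemicontinuous_truncSup x).le_liminf φ).trans
          (liminf_le_liminf_of_le hφ)
    _ ≤ liminf (fun i => ∫⁻ x, truncSup (u i) x ∂μ) atTop :=
        lintegral_liminf_le fun i => measurable_truncSup (u i)
    _ ≤ c := liminf_le_of_frequently_le (Frequently.of_forall hu) (by isBoundedDefault)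

/-- Tightness along `φ` and `-φ` bounds |x_t(φ)| outside two sets of measure at most ε/3; scaling
makes the supremum at most ε/3 there, and on the exceptional sets the truncation at 1 applies. -/
theorem exists_lintegral_truncSup_smul_le [ContinuousSMul ℝ E]
    {S : Set (Measure (CadlagPath T (StrongDual ℝ E)))} (hS : ∀ μ ∈ S, IsProbabilityMeasure μ)
    (h : ∀ φ : E, IsTightMeasureSet ((fun μ => μ.map (proj φ)) '' S)) (φ : E) {ε : ℝ}
    (hε : 0 < ε) :
    ∃ k : ℕ, ∀ μ ∈ S, ∫⁻ x, truncSup ((k + 1 : ℝ)⁻¹ • φ) x ∂μ ≤ ENNReal.ofReal ε := by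
  have hb : ∀ φ : E, ∃ (M : ℝ) (A : Set (CadlagPath T (StrongDual ℝ E))), MeasurableSet A ∧
      (∀ μ ∈ S, μ A ≤ ENNReal.ofReal (ε / 3)) ∧ ∀ x ∉ A, ∀ t, x.toFun t φ ≤ M := fun φ => by
    obtain ⟨K, hK, hμK⟩ := isTightMeasureSet_iff_exists_isCompact_measure_compl_le.1 (h φ)
      (ENNReal.ofReal (ε / 3)) (by positivity)
    obtain ⟨M, hM⟩ := exists_le_of_isCompact hK
    refine ⟨M, proj φ ⁻¹' Kᶜ, measurable_proj φ hK.isClosed.measurableSet.compl,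
      fun μ hμ => ?_, fun x hx => hM _ (not_not.1 hx)⟩
    rw [← Measure.map_apply (measurable_proj φ) hK.isClosed.measurableSet.compl]
    exact hμK _ (mem_image_of_mem _ hμ)
  obtain ⟨M₁, A₁, hA₁, hμ₁, hM₁⟩ := hb φ
  obtain ⟨M₂, A₂, hA₂, hμ₂, hM₂⟩ := hb (-φ)
  obtain ⟨k, hk⟩ := exists_nat_gt (max M₁ M₂ / (ε / 3))
  rw [div_lt_iff₀ (by positivity)] at hk
  have hk0 : (0 : ℝ) < k + 1 := by positivity
  refine ⟨k, fun μ hμ => ?_⟩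
  have := hS μ hμ
  have hpt : ∀ x, truncSup ((k + 1 : ℝ)⁻¹ • φ) x ≤
      ENNReal.ofReal (ε / 3) + (A₁ ∪ A₂).indicator 1 x := fun x => by
    by_cases hx : x ∈ A₁ ∪ A₂
    · rw [indicator_of_mem hx]
      exact (min_le_right _ _).trans le_add_self
    · rw [mem_union, not_or] at hx
      refine (min_le_left _ _).trans (le_trans (iSup_le fun t => ?_) le_self_add)
      rw [← ofReal_norm, map_smul, norm_smul, norm_inv, Real.norm_of_nonneg hk0.le]
      refine ENNReal.ofReal_le_ofReal ?_
      rw [inv_mul_le_iff₀ hk0]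
      have h1 := hM₁ x hx.1 t
      have h2 := hM₂ x hx.2 t
      rw [map_neg] at h2
      have h3 : ‖x.toFun t φ‖ ≤ max M₁ M₂ := abs_le'.2
        ⟨h1.trans (le_max_left _ _), h2.trans (le_max_right _ _)⟩
      nlinarith
  calc ∫⁻ x, truncSup ((k + 1 : ℝ)⁻¹ • φ) x ∂μ
      ≤ ∫⁻ x, (ENNReal.ofReal (ε / 3) + (A₁ ∪ A₂).indicator 1 x) ∂μ := lintegral_mono hpt
    _ = ENNReal.ofReal (ε / 3) + μ (A₁ ∪ A₂) := by
        rw [lintegral_add_left measurable_const, lintegral_const, measure_univ, mul_one,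
          lintegral_indicator_one (hA₁.union hA₂)]
    _ ≤ ENNReal.ofReal (ε / 3) + (ENNReal.ofReal (ε / 3) + ENNReal.ofReal (ε / 3)) :=
        add_le_add le_rfl ((measure_union_le _ _).trans (add_le_add (hμ₁ μ hμ) (hμ₂ μ hμ)))
    _ = ENNReal.ofReal ε := by
        rw [← ENNReal.ofReal_add (by positivity) (by positivity),
          ← ENNReal.ofReal_add (by positivity) (by positivity)]
        congr 1
        ring

/-- Under a bound of the mean truncated suprema by a Hilbertian seminorm, the coordinates along a
finite family are small together. -/
theorem measure_exists_sum_sq_le [ContinuousSMul ℝ E]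
    (μ : Measure (CadlagPath T (StrongDual ℝ E))) [IsProbabilityMeasure μ] {Q : E → ℝ}
    (hQ0 : ∀ φ, 0 ≤ Q φ) (hQz : Q 0 = 0)
    (hQ : ∀ x y, Q (x + y) + Q (x - y) = 2 * Q x + 2 * Q y) {ε : ℝ} (hε : 0 ≤ ε)
    (hμ : ∀ φ, ∫⁻ x, truncSup φ x ∂μ ≤ ENNReal.ofReal (ε + Q φ)) (l : List E) :
    μ {x | ∃ t, 2 / 3 ≤ (l.map fun e => x.toFun t e ^ 2).sum} ≤
      ENNReal.ofReal (3 * (ε + (l.map Q).sum)) := by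
  have hpos : (0 : ℝ) < 2 ^ l.length * (1 / 3) := by positivity
  -- The Khinchin bound is applied to the single functional x_t; passing to suprema over time then
  -- removes `t` before Markov's inequality, which gives the factor 3.
  have hlow : {x : CadlagPath T (StrongDual ℝ E) |
        ∃ t, 2 / 3 ≤ (l.map fun e => x.toFun t e ^ 2).sum} ⊆
      {x | ENNReal.ofReal (2 ^ l.length * (1 / 3)) ≤ signSum (fun ψ => truncSup ψ x) l 0} := by
    rintro x ⟨t, ht⟩
    refine (ENNReal.ofReal_le_ofReal
      (third_le_signSum_min_abs ((x.toFun t : E →ₗ[ℝ] ℝ).toAddMonoidHom) l ht)).trans ?_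
    rw [← signSum_ofReal fun ψ => le_min (abs_nonneg _) zero_le_one]
    refine signSum_mono (fun ψ => ?_) l 0
    rw [ENNReal.ofReal_min, ENNReal.ofReal_one]
    refine min_le_min_right _ ?_
    rw [← Real.norm_eq_abs, ofReal_norm]
    exact le_iSup (fun t => ‖x.toFun t ψ‖ₑ) t
  have hup : signSum (fun ψ => ∫⁻ x, truncSup ψ x ∂μ) l 0 ≤
      ENNReal.ofReal (2 ^ l.length * (ε + (l.map Q).sum)) := by
    refine (signSum_mono hμ l 0).trans_eq ?_
    rw [signSum_ofReal fun ψ => add_nonneg hε (hQ0 ψ), signSum_add, signSum_const,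
      signSum_eq_of_parallelogram hQ, hQz, zero_add, mul_add]
  calc μ {x | ∃ t, 2 / 3 ≤ (l.map fun e => x.toFun t e ^ 2).sum}
      ≤ μ {x | ENNReal.ofReal (2 ^ l.length * (1 / 3)) ≤ signSum (fun ψ => truncSup ψ x) l 0} :=
        measure_mono hlow
    _ ≤ (∫⁻ x, signSum (fun ψ => truncSup ψ x) l 0 ∂μ) /
          ENNReal.ofReal (2 ^ l.length * (1 / 3)) :=
        meas_ge_le_lintegral_div (measurable_signSum measurable_truncSup l 0).aemeasurable
          (by simp) ENNReal.ofReal_ne_top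
    _ ≤ ENNReal.ofReal (2 ^ l.length * (ε + (l.map Q).sum)) /
          ENNReal.ofReal (2 ^ l.length * (1 / 3)) := by
        rw [lintegral_signSum μ measurable_truncSup]
        exact ENNReal.div_le_div_right hup _
    _ = ENNReal.ofReal (3 * (ε + (l.map Q).sum)) := by
        rw [← ENNReal.ofReal_div_of_pos hpos]
        congr 1
        field_simp

end CadlagPath

/-! ### Confinement to a compact ball of the dual -/

namespace CountablyHilbertianNuclear

variable {E : Type*} [AddCommGroup E] [Module ℝ E] [TopologicalSpace E]

theorem seminorm_parallelogram (hE : CountablyHilbertianNuclear E) (n : ℕ) (x y : E) :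
    hE.seminorm n (x + y) ^ 2 + hE.seminorm n (x - y) ^ 2 =
      2 * hE.seminorm n x ^ 2 + 2 * hE.seminorm n y ^ 2 := by
  have h := parallelogram_law_with_norm ℝ (toHilbertianSpace (hE.form n) x)
    (toHilbertianSpace (hE.form n) y)
  have h1 : hE.seminorm n (x + y) =
    ‖toHilbertianSpace (hE.form n) x + toHilbertianSpace (hE.form n) y‖ := rfl
  have h2 : hE.seminorm n (x - y) =
    ‖toHilbertianSpace (hE.form n) x - toHilbertianSpace (hE.form n) y‖ := rfl
  have h3 : hE.seminorm n x = ‖toHilbertianSpace (hE.form n) x‖ := rfl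
  have h4 : hE.seminorm n y = ‖toHilbertianSpace (hE.form n) y‖ := rfl
  rw [h1, h2, h3, h4]
  linear_combination h

/-- Mitoma's bound: if the projections are tight, then up to small probability all paths take
values in a ball of one of the dual Hilbert spaces. -/
theorem exists_measure_not_mem_dualBall_le [IsTopologicalAddGroup E] [ContinuousSMul ℝ E]
    (hE : CountablyHilbertianNuclear E) {T : ℝ}
    {S : Set (Measure (CadlagPath T (StrongDual ℝ E)))} (hS : ∀ μ ∈ S, IsProbabilityMeasure μ)
    (h : ∀ φ : E, IsTightMeasureSet ((fun μ => μ.map (CadlagPath.proj φ)) '' S)) {ε : ℝ}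
    (hε : 0 < ε) :
    ∃ (k : ℕ) (M : ℝ), ∀ μ ∈ S,
      μ {x | ¬ ∀ t, x.toFun t ∈ hE.dualBall k M} ≤ ENNReal.ofReal ε := by
  have := hE.polishSpace
  have hW : {φ : E | ⨆ μ ∈ S, ∫⁻ x, CadlagPath.truncSup φ x ∂μ ≤
      ENNReal.ofReal (ε / 12) + ENNReal.ofReal (ε / 12)} ∈ 𝓝 (0 : E) := by
    let := TopologicalSpace.upgradeIsCompletelyMetrizable E
    refine setOf_le_mem_nhds_zero (W := fun φ : E => ⨆ μ ∈ S, ∫⁻ x, CadlagPath.truncSup φ x ∂μ)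
      (fun φ ψ => ?_) (fun φ => ?_) ?_ fun φ => ?_
    · refine iSup₂_le fun μ hμ => ?_
      refine (lintegral_mono fun x => CadlagPath.truncSup_add_le φ ψ x).trans ?_
      rw [lintegral_add_left (CadlagPath.measurable_truncSup φ)]
      exact add_le_add (le_iSup₂ (f := fun μ _ => ∫⁻ x, CadlagPath.truncSup φ x ∂μ) μ hμ)
        (le_iSup₂ (f := fun μ _ => ∫⁻ x, CadlagPath.truncSup ψ x ∂μ) μ hμ)
    · simp only [CadlagPath.truncSup_neg]
    · simp only [iSup_le_iff]
      have : {φ : E | ∀ μ ∈ S, ∫⁻ x, CadlagPath.truncSup φ x ∂μ ≤ ENNReal.ofReal (ε / 12)} =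
          ⋂ μ ∈ S, {φ : E | ∫⁻ x, CadlagPath.truncSup φ x ∂μ ≤ ENNReal.ofReal (ε / 12)} := by
        ext; simp
      rw [this]
      exact isClosed_biInter fun μ _ => CadlagPath.isClosed_setOf_lintegral_truncSup_le μ _
    · obtain ⟨k, hk⟩ := CadlagPath.exists_lintegral_truncSup_smul_le hS h φ
        (show 0 < ε / 12 by positivity)
      exact ⟨k, iSup₂_le hk⟩
  obtain ⟨m, r, hr, hm⟩ := hE.exists_seminorm_ball_subset hW
  simp only [sub_zero] at hm
  -- Inside the radius `r` the mean is at most 2 · ε/12 by Baire; outside, the truncation at 1 is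
  -- below the quadratic term.
  have hbd : ∀ μ ∈ S, ∀ φ, ∫⁻ x, CadlagPath.truncSup φ x ∂μ ≤
      ENNReal.ofReal (ε / 6 + r⁻¹ ^ 2 * hE.seminorm m φ ^ 2) := fun μ hμ φ => by
    rcases lt_or_ge (hE.seminorm m φ) r with hlt | hge
    · refine (le_iSup₂ (f := fun μ _ => ∫⁻ x, CadlagPath.truncSup φ x ∂μ) μ hμ).trans
        ((hm φ hlt).trans ?_)
      rw [← ENNReal.ofReal_add (by positivity) (by positivity)]
      refine ENNReal.ofReal_le_ofReal ?_
      have : 0 ≤ r⁻¹ ^ 2 * hE.seminorm m φ ^ 2 := by positivity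
      linarith
    · have := hS μ hμ
      calc ∫⁻ x, CadlagPath.truncSup φ x ∂μ ≤ ∫⁻ _, 1 ∂μ :=
            lintegral_mono fun x => min_le_right _ _
        _ = 1 := by simp
        _ ≤ _ := by
            rw [← ENNReal.ofReal_one]
            refine ENNReal.ofReal_le_ofReal ?_
            rw [← mul_pow]
            have h1 : 1 ≤ r⁻¹ * hE.seminorm m φ := by
              rw [inv_mul_eq_div]
              exact (one_le_div hr).2 hge
            nlinarith
  obtain ⟨k, e, -, hsum, hctrl⟩ := hE.exists_summable_controlling m
  set σ := ∑' j, hE.seminorm m (e j) ^ 2 with hσ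
  have hσ0 : 0 ≤ σ := tsum_nonneg fun j => sq_nonneg _
  -- The vectors are rescaled by `a` so that their Hilbert–Schmidt sum contributes at most ε/6; the
  -- final bound is 3(ε/6 + ε/6) = ε.
  obtain ⟨a, ha0, ha⟩ : ∃ a : ℝ, 0 < a ∧ r⁻¹ ^ 2 * (a ^ 2 * σ) ≤ ε / 6 := by
    have hc : Tendsto (fun a : ℝ => r⁻¹ ^ 2 * (a ^ 2 * σ)) (𝓝[>] 0) (𝓝 0) := by
      have : Continuous fun a : ℝ => r⁻¹ ^ 2 * (a ^ 2 * σ) := by fun_prop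
      have h1 := this.tendsto 0
      simp only [ne_eq, OfNat.ofNat_ne_zero, not_false_eq_true, zero_pow, zero_mul,
        mul_zero] at h1
      exact h1.mono_left nhdsWithin_le_nhds
    obtain ⟨a, h1, h2⟩ := ((hc.eventually_lt_const (show 0 < ε / 6 by positivity)).and
      self_mem_nhdsWithin).exists
    exact ⟨a, h2, h1.le⟩
  -- If the squares of x_t(a e_j) sum to less than 2/3, then those of x_t(e_j) sum to at most M² for
  -- this M.
  refine ⟨k, √(2 / 3 / a ^ 2), fun μ hμ => ?_⟩
  have := hS μ hμ
  let A : ℕ → Set (CadlagPath T (StrongDual ℝ E)) := fun J =>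
    {x | ∃ t, 2 / 3 ≤ ∑ j ∈ Finset.range J, x.toFun t (a • e j) ^ 2}
  have hA : ∀ J, μ (A J) ≤ ENNReal.ofReal ε := fun J => by
    have h1 := CadlagPath.measure_exists_sum_sq_le μ (Q := fun φ => r⁻¹ ^ 2 * hE.seminorm m φ ^ 2)
      (fun φ => by positivity) (by simp)
      (fun x y => by linear_combination r⁻¹ ^ 2 * hE.seminorm_parallelogram m x y)
      (show 0 ≤ ε / 6 by positivity) (hbd μ hμ) ((List.range J).map fun j => a • e j)
    simp only [List.map_map, Function.comp_def] at h1
    have hl : ∀ g : ℕ → ℝ, ((List.range J).map g).sum = ∑ j ∈ Finset.range J, g j := fun g => rfl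
    simp only [hl] at h1
    refine h1.trans (ENNReal.ofReal_le_ofReal ?_)
    have h2 : ∑ j ∈ Finset.range J, r⁻¹ ^ 2 * hE.seminorm m (a • e j) ^ 2 ≤
        r⁻¹ ^ 2 * (a ^ 2 * σ) := by
      rw [← Finset.mul_sum]
      refine mul_le_mul_of_nonneg_left ?_ (by positivity)
      simp only [map_smul_eq_mul, mul_pow, Real.norm_eq_abs, sq_abs]
      rw [← Finset.mul_sum]
      exact mul_le_mul_of_nonneg_left (hsum.sum_le_tsum _ fun j _ => sq_nonneg _) (by positivity)
    linarith
  have hmono : Monotone A := fun J L hJL x ⟨t, ht⟩ => ⟨t, ht.trans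
    (Finset.sum_le_sum_of_subset_of_nonneg (Finset.range_subset_range.2 hJL)
      fun _ _ _ => sq_nonneg _)⟩
  have hsub : {x : CadlagPath T (StrongDual ℝ E) |
      ¬ ∀ t, x.toFun t ∈ hE.dualBall k √(2 / 3 / a ^ 2)} ⊆ ⋃ J, A J := fun x hx => by
    by_contra hx'
    refine hx fun t => hctrl _ _ (Real.sqrt_nonneg _) fun J => ?_
    rw [Real.sq_sqrt (by positivity), le_div_iff₀ (by positivity)]
    by_contra hlt
    refine hx' (mem_iUnion.2 ⟨J, t, ?_⟩)
    refine (not_le.1 hlt).le.trans_eq ?_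
    rw [Finset.sum_mul]
    refine Finset.sum_congr rfl fun j _ => ?_
    rw [map_smul, smul_eq_mul]
    ring
  refine (measure_mono hsub).trans ?_
  -- For an increasing union the measure is the supremum, with no measurability needed; so the
  -- bound, uniform in the number of coordinates, survives.
  rw [hmono.measure_iUnion]
  exact iSup_le hA

end CountablyHilbertianNuclear

/-! ### Weak sequential compactness of tight sequences -/

section Prokhorov

variable {X Y : Type*} [TopologicalSpace X] [MeasurableSpace X] [BorelSpace X]
  [TopologicalSpace Y] [T2Space Y] [MeasurableSpace Y] [BorelSpace Y]

/-- By injectivity a compact set is the preimage of its compact, hence closed, image, so the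
measures agree on compact sets. A closed set differs from a compact one by a tail. -/
theorem MeasureTheory.Measure.le_of_map_eq_of_forall_compl_isCompact_le {μ ν : Measure X}
    {Φ : X → Y} (hΦ : Continuous Φ) (hinj : Function.Injective Φ) (h : μ.map Φ = ν.map Φ)
    {K : ℕ → Set X} (hK : ∀ j, IsCompact (K j)) {u : ℕ → ℝ≥0∞} (hu : Tendsto u atTop (𝓝 0))
    (hμ : ∀ j, μ (K j)ᶜ ≤ u j) {F : Set X} (hF : IsClosed F) : μ F ≤ ν F := by
  have hcomp : ∀ S : Set X, IsCompact S → μ S = ν S := fun S hS => by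
    have hm := (hS.image hΦ).isClosed.measurableSet
    rw [← hinj.preimage_image S, ← Measure.map_apply hΦ.measurable hm, h,
      Measure.map_apply hΦ.measurable hm]
  have hj : ∀ j, μ F ≤ ν F + u j := fun j => by
    calc μ F ≤ μ (F ∩ K j ∪ (K j)ᶜ) := measure_mono fun x hx => by
          by_cases hxK : x ∈ K j
          · exact Or.inl ⟨hx, hxK⟩
          · exact Or.inr hxK
      _ ≤ μ (F ∩ K j) + μ (K j)ᶜ := measure_union_le _ _
      _ ≤ ν F + u j := by
          rw [hcomp _ ((hK j).inter_left hF)]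
          exact add_le_add (measure_mono inter_subset_left) (hμ j)
  have hlim : Tendsto (fun j => ν F + u j) atTop (𝓝 (ν F + 0)) := hu.const_add _
  rw [add_zero] at hlim
  exact ge_of_tendsto' hlim hj

theorem MeasureTheory.Measure.eq_of_map_eq_of_forall_compl_isCompact_le {μ ν : Measure X}
    [IsFiniteMeasure μ] {Φ : X → Y} (hΦ : Continuous Φ) (hinj : Function.Injective Φ)
    (h : μ.map Φ = ν.map Φ) {K : ℕ → Set X} (hK : ∀ j, IsCompact (K j)) {u : ℕ → ℝ≥0∞}
    (hu : Tendsto u atTop (𝓝 0)) (hμ : ∀ j, μ (K j)ᶜ ≤ u j) (hν : ∀ j, ν (K j)ᶜ ≤ u j) :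
    μ = ν := by
  have hcl : ∀ F : Set X, IsClosed F → μ F = ν F := fun F hF => le_antisymm
    (le_of_map_eq_of_forall_compl_isCompact_le hΦ hinj h hK hu hμ hF)
    (le_of_map_eq_of_forall_compl_isCompact_le hΦ hinj h.symm hK hu hν hF)
  refine ext_of_generate_finite {s | IsClosed s} ?_ isPiSystem_isClosed hcl
    (hcl univ isClosed_univ)
  rw [BorelSpace.measurable_eq (α := X), borel_eq_generateFrom_isClosed]

/-- A tight sequence of probability measures on a Hausdorff space with a coarser separable
metrizable topology has a weakly convergent subsequence. -/
theorem exists_tendsto_subseq_of_isTightMeasureSet [T2Space X]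
    [TopologicalSpace.PseudoMetrizableSpace Y]
    [TopologicalSpace.SeparableSpace Y] {Φ : X → Y} (hΦ : Continuous Φ)
    (hinj : Function.Injective Φ) (μ : ℕ → ProbabilityMeasure X)
    (hμ : IsTightMeasureSet (range fun n => (μ n : Measure X))) :
    ∃ l : ℕ → ℕ, StrictMono l ∧ ∃ ν : ProbabilityMeasure X,
      Tendsto (fun j => μ (l j)) atTop (𝓝 ν) := by
  obtain ⟨u, -, hu0, hu⟩ := exists_seq_strictAnti_tendsto (0 : NNReal)
  have hex : ∀ j, ∃ K : Set X, IsCompact K ∧ ∀ n, (μ n : Measure X) Kᶜ ≤ u j := fun j => by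
    obtain ⟨K, hK, hμK⟩ := isTightMeasureSet_iff_exists_isCompact_measure_compl_le.1 hμ (u j)
      (by exact_mod_cast hu0 j)
    exact ⟨K, hK, fun n => hμK _ (mem_range_self n)⟩
  choose K₀ hK₀ hμK₀ using hex
  let K : ℕ → Set X := fun j => ⋃ i ∈ Finset.range (j + 1), K₀ i
  have hK : ∀ j, IsCompact (K j) := fun j => Finset.isCompact_biUnion _ fun i _ => hK₀ i
  have hKmono : Monotone K := fun i j hij => biUnion_subset_biUnion_left fun a ha =>
    Finset.range_subset_range.2 (Nat.add_le_add_right hij 1) ha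
  have hsub : ∀ j, K₀ j ⊆ K j := fun j =>
    subset_biUnion_of_mem (u := K₀) (Finset.self_mem_range_succ j)
  -- A compact set of measures containing the sequence. Subsequences are extracted from its image in
  -- the measures on `Y`, which is metrizable, and convergence is lifted back: all cluster points
  -- have the same image, hence coincide.
  let A : Set (ProbabilityMeasure X) := {ν | ∀ j, ν (K j)ᶜ ≤ u j}
  have hA : IsCompact A := isCompact_setOfPred_probabilityMeasure_mass_eq_compl_isCompact_le hu hK
    (Or.inr hKmono)
  have hAm : ∀ ν ∈ A, ∀ j, (ν : Measure X) (K j)ᶜ ≤ u j := fun ν hν j => by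
    rw [← ProbabilityMeasure.ennreal_coeFn_eq_coeFn_toMeasure]
    exact ENNReal.coe_le_coe.2 (hν j)
  have hμA : ∀ n, μ n ∈ A := fun n j => by
    rw [← ENNReal.coe_le_coe, ProbabilityMeasure.ennreal_coeFn_eq_coeFn_toMeasure]
    exact (measure_mono (compl_subset_compl.2 (hsub j))).trans (hμK₀ j n)
  let Φ' : ProbabilityMeasure X → ProbabilityMeasure Y := fun ν => ν.map hΦ.aemeasurable
  have hΦ' : Continuous Φ' := ProbabilityMeasure.continuous_map hΦ
  obtain ⟨_, ⟨ν, hν, rfl⟩, l, hl, hlim⟩ := (hA.image hΦ').tendsto_subseq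
    fun n => mem_image_of_mem Φ' (hμA n)
  refine ⟨l, hl, ν, hA.tendsto_nhds_of_unique_mapClusterPt
    (Eventually.of_forall fun j => hμA (l j)) fun ρ hρ hcl => ?_⟩
  have h1 : MapClusterPt (Φ' ρ) atTop (Φ' ∘ fun j => μ (l j)) :=
    hcl.continuousAt_comp hΦ'.continuousAt
  have h2 : Φ' ρ = Φ' ν := by
    have : (𝓝 (Φ' ρ) ⊓ 𝓝 (Φ' ν)).NeBot := h1.neBot.mono (inf_le_inf_left _ hlim)
    exact eq_of_nhds_neBot this
  exact Subtype.ext (Measure.eq_of_map_eq_of_forall_compl_isCompact_le (μ := (ρ : Measure X))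
    (ν := (ν : Measure X)) hΦ hinj (congrArg Subtype.val h2) hK (ENNReal.tendsto_coe.2 hu) (hAm ρ hρ) (hAm ν hν))

end Prokhorov

/-! ### The theorem -/

namespace CountablyHilbertianNuclear

variable {E : Type*} [AddCommGroup E] [Module ℝ E] [TopologicalSpace E]

open CadlagPath in
-- Half of ε pays for leaving the compact dual ball, the other half for violating the oscillation
-- bounds along the countably many dense directions.
theorem isTightMeasureSet_of_forall_proj [IsTopologicalAddGroup E] [ContinuousSMul ℝ E]
    (hE : CountablyHilbertianNuclear E) {T : ℝ} (hT : 0 < T)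
    {S : Set (Measure (CadlagPath T (StrongDual ℝ E)))} (hS : ∀ μ ∈ S, IsProbabilityMeasure μ)
    (h : ∀ φ : E, IsTightMeasureSet ((fun μ => μ.map (proj φ)) '' S)) :
    IsTightMeasureSet S := by
  have := hE.polishSpace
  refine isTightMeasureSet_iff_exists_isCompact_measure_compl_le.2 fun ε hε => ?_
  obtain ⟨r, hr0, hrε⟩ : ∃ r : ℝ, 0 < r ∧ ENNReal.ofReal r ≤ ε / 2 := by
    obtain ⟨q, hq0, hq⟩ := ENNReal.lt_iff_exists_nnreal_btwn.1 (ENNReal.half_pos hε.ne')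
    exact ⟨q, by exact_mod_cast hq0, by rw [ENNReal.ofReal_coe_nnreal]; exact hq.le⟩
  obtain ⟨n, M, hM⟩ := hE.exists_measure_not_mem_dualBall_le hS h hr0
  obtain ⟨d, hd⟩ := TopologicalSpace.exists_dense_seq E
  obtain ⟨ε', hε'0, hε'⟩ := ENNReal.exists_pos_sum_of_countable (ENNReal.half_pos hε.ne').ne' ℕ
  have hex : ∀ i, ∃ K : Set (CadlagPath T ℝ), IsCompact K ∧
      ∀ μ ∈ S, μ (proj (d i) ⁻¹' Kᶜ) ≤ ε' i := fun i => by
    obtain ⟨K, hK, hμK⟩ := isTightMeasureSet_iff_exists_isCompact_measure_compl_le.1 (h (d i))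
      (ε' i) (by exact_mod_cast hε'0 i)
    refine ⟨K, hK, fun μ hμ => ?_⟩
    rw [← Measure.map_apply (measurable_proj _) hK.isClosed.measurableSet.compl]
    exact hμK _ (mem_image_of_mem _ hμ)
  choose K hK hμK using hex
  have hδ : ∀ i k : ℕ, ∃ δ > 0, ∀ y ∈ K i, UpOsc y.toFun δ (1 / (k + 1)) ∧
      UpStart y.toFun δ (1 / (k + 1)) := fun i k => by
    have hk : (0 : ℝ) < 1 / (k + 1) := by positivity
    obtain ⟨δ₁, hδ₁, h₁⟩ := exists_upOsc_of_isCompact (hK i) hk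
    obtain ⟨δ₂, hδ₂, h₂⟩ := exists_upStart_of_isCompact (hK i) hk
    exact ⟨min δ₁ δ₂, lt_min hδ₁ hδ₂, fun y hy =>
      ⟨(h₁ y hy).mono (min_le_left _ _) le_rfl, (h₂ y hy).mono (min_le_right _ _) le_rfl⟩⟩
  choose δ hδ0 hδ using hδ
  refine ⟨oscSet T (hE.dualBall n M) d δ,
    isCompact_oscSet hT (hE.isCompact_dualBall n M) (hE.convex_dualBall n M) hd hδ0,
    fun μ hμ => ?_⟩
  have hsub : (oscSet T (hE.dualBall n M) d δ)ᶜ ⊆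
      {x | ¬ ∀ t, x.toFun t ∈ hE.dualBall n M} ∪ ⋃ i, proj (d i) ⁻¹' (K i)ᶜ := fun x hx => by
    by_contra hx'
    rw [mem_union, not_or, mem_iUnion, not_exists] at hx'
    exact hx ⟨not_not.1 hx'.1, fun i k => hδ i k _ (not_not.1 (hx'.2 i))⟩
  calc μ (oscSet T (hE.dualBall n M) d δ)ᶜ
      ≤ μ {x | ¬ ∀ t, x.toFun t ∈ hE.dualBall n M} + μ (⋃ i, proj (d i) ⁻¹' (K i)ᶜ) :=
        (measure_mono hsub).trans (measure_union_le _ _)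
    _ ≤ ε / 2 + ε / 2 := by
        refine add_le_add ((hM μ hμ).trans hrε) ((measure_iUnion_le _).trans ?_)
        exact (ENNReal.tsum_le_tsum fun i => hμK i μ hμ).trans hε'.le
    _ = ε := ENNReal.add_halves ε

end CountablyHilbertianNuclear

theorem theorem3p2 {E : Type*} [AddCommGroup E] [Module ℝ E] [TopologicalSpace E]
    [IsTopologicalAddGroup E] [ContinuousSMul ℝ E] (hE : CountablyHilbertianNuclear E)
    {T : ℝ} (hT : 0 < T)
    (μ : ℕ → ProbabilityMeasure (CadlagPath T (StrongDual ℝ E))) :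
    (IsTightMeasureSet
        (Set.range fun n => (μ n : Measure (CadlagPath T (StrongDual ℝ E)))) ↔
      ∀ φ : E, IsTightMeasureSet
        (Set.range fun n =>
          (μ n : Measure (CadlagPath T (StrongDual ℝ E))).map (CadlagPath.proj φ))) ∧
    (IsTightMeasureSet
        (Set.range fun n => (μ n : Measure (CadlagPath T (StrongDual ℝ E)))) →
      IsCompact (closure (Set.range μ)) ∧
      ∀ k : ℕ → ℕ, StrictMono k → ∃ l : ℕ → ℕ, StrictMono l ∧
        ∃ ν : ProbabilityMeasure (CadlagPath T (StrongDual ℝ E)),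
          Tendsto (fun j => μ (k (l j))) atTop (𝓝 ν)) := by
  have := hE.polishSpace
  have himage : ∀ φ : E, (fun ν : Measure (CadlagPath T (StrongDual ℝ E)) =>
      ν.map (CadlagPath.proj φ)) '' (range fun n => (μ n : Measure _)) =
      range fun n => (μ n : Measure _).map (CadlagPath.proj φ) := fun φ => by
    rw [← range_comp]
    rfl
  refine ⟨⟨fun h φ => ?_, fun h => ?_⟩, fun h => ⟨?_, fun k hk => ?_⟩⟩
  · rw [← himage φ]
    exact h.map (CadlagPath.continuous_proj φ)
  · refine hE.isTightMeasureSet_of_forall_proj hT ?_ fun φ => ?_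
    · rintro _ ⟨n, rfl⟩
      infer_instance
    · rw [himage φ]
      exact h φ
  · refine isCompact_closure_of_isTightMeasureSet (h.subset ?_)
    rintro _ ⟨_, ⟨n, rfl⟩, rfl⟩
    exact ⟨n, rfl⟩
  · obtain ⟨Φ, hΦ, hinj⟩ := CadlagPath.exists_continuous_injective (T := T) (E := E)
    refine exists_tendsto_subseq_of_isTightMeasureSet hΦ hinj (fun j => μ (k j)) (h.subset ?_)
    rintro _ ⟨n, rfl⟩
    exact ⟨k n, rfl⟩

end
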